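/- For integers $b>j\ge 1$ and probability vectors $p,q$ of length $b$ let $$\Psi(p,q)=\frac{1}{(b-j-1)!}\sum_{\sigma\in S_b}\Big(p_{\sigma(1)}\cdots p_{\sigma(j)}\,q_{\sigma(j+1)}+q_{\sigma(1)}\cdots q_{\sigma(j)}\,p_{\sigma(j+1)}\Big).$$ For $0<\epsilon<1/(b-1)$ and $1\le i\le b$ let $\check P^i$ be the set of probability vectors $p$ of length $b$ with $p_i>1-\epsilon$, and let $\check P^0$ be the set of those with $p_a\le 1-\epsilon$ for all $a$. For $i\ne h$ in $\{1,\dots,b\}$ put $$\check M_1=\sup_{p,q\in\check P^0}\Psi(p,q),\quad \check M_2=\sup_{p\in\check P^0,\,q\in\check P^i}\Psi(p,q),\quad \check M_3=\sup_{p,q\in\check P^i}\Psi(p,q),\quad \check M_4=\sup_{p\in\check P^i,\,q\in\check P^h}\Psi(p,q);$$ by symmetry these do not depend on the choice of $i$ and $h$. Let $j=k-2$ and let $(b,k,\epsilon)$ be as in one of the rows of the table below. Then the following hold. 1. $\check M_1$ is a maximum, attained when $p$ and $q$ are both uniform, $p=q=(\frac1b,\dots,\frac1b)$. 2. $\check M_2$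 is a maximum, attained when $q$ is the point mass at coordinate $i$ and $p$ has $i$-th coordinate $0$ and all other coordinates $\frac1{b-1}$; that is, since $\Psi$ is symmetric, for $i=1$ it is the value of $\Psi$ at $(1,0,\dots,0;\,0,\frac1{b-1},\dots,\frac1{b-1})$. 3. $\check M_3=\Psi(p,p)$, where $p_i=1-\epsilon$ and all other coordinates of $p$ are $\frac{\epsilon}{b-1}$; this $p$ lies in the closure of $\check P^i$. 4. $\check M_4=\Psi(p,q)$, where $p_i=q_h=1-\epsilon$, $p_h=q_i=0$, and all other coordinates of $p$ and of $q$ are $\frac{\epsilon}{b-2}$; here $p$ and $q$ lie in the closures of $\check P^i$ and $\check P^h$, respectively. 5. The numerical values of these suprema differ from the following decimals by at most one unit of the last printed digit: $$\begin{array}{cccccc} (b,k)&\epsilon&\check M_1&\check M_2&\check M_3&\check M_4\\ \hline (7,7)&9/100&0.085679&0.092593&0.000006&0.000107\\ (8,8)&3/25&0.038453&0.042840&0.000002&0.000022\\ (9,8)&1/10&0.075870&0.076905&0.000001&0.000015\\ (10,9)&1/15&0.036289&0.037935&3.4\cdot10^{-9}&8.5\cdot10^{-8}\\ (11,10)&1/11&0.016928&0.018144&1.4\cdot10^{-9}&2.7\cdot10^{-8}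 \end{array}$$ -/

import Mathlib

open scoped BigOperators

/-- The polynomial function
`Ψ(p, q) = 1/(b-j-1)! · ∑_{σ ∈ S_b} (p_{σ(1)} ⋯ p_{σ(j)} q_{σ(j+1)} + q_{σ(1)} ⋯ q_{σ(j)} p_{σ(j+1)})`.
Coordinates are indexed by `Fin b` (from `0`): the first `j` positions are the images of `Fin j`,
and the `(j+1)`-st position is `⟨j, hj⟩`. -/
noncomputable def Psi {b j : ℕ} (hj : j < b) (p q : Fin b → ℝ) : ℝ :=
  (1 / ((b - j - 1).factorial : ℝ)) *
    ∑ σ : Equiv.Perm (Fin b),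
      ((∏ t : Fin j, p (σ (Fin.castLE hj.le t))) * q (σ ⟨j, hj⟩) +
        (∏ t : Fin j, q (σ (Fin.castLE hj.le t))) * p (σ ⟨j, hj⟩))

/-- Unbalanced distributions (maximum-based partition): probability vectors whose `i`-th
coordinate exceeds `1 - ε`. -/
def maxUnbalanced (b : ℕ) (ε : ℝ) (i : Fin b) : Set (Fin b → ℝ) :=
  {p | p ∈ stdSimplex ℝ (Fin b) ∧ 1 - ε < p i}

/-- Balanced distributions (maximum-based partition): probability vectors all of whose
coordinates are at most `1 - ε`. -/
def maxBalanced (b : ℕ) (ε : ℝ) : Set (Fin b → ℝ) :=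
  {p | p ∈ stdSimplex ℝ (Fin b) ∧ ∀ i, p i ≤ 1 - ε}

/-- The set of values `Ψ(p, q)` with `p ∈ A` and `q ∈ B`. -/
def psiValues {b j : ℕ} (hj : j < b) (A B : Set (Fin b → ℝ)) : Set ℝ :=
  {x | ∃ p ∈ A, ∃ q ∈ B, x = Psi hj p q}

/-- The uniform distribution `(1/b, …, 1/b)`. -/
noncomputable def unif (b : ℕ) : Fin b → ℝ := fun _ => 1 / (b : ℝ)

/-- The point mass at coordinate `i`. -/
noncomputable def pointMass {b : ℕ} (i : Fin b) : Fin b → ℝ :=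
  fun a => if a = i then 1 else 0

/-- Coordinate `i` is `0`, every other coordinate is `1/(b-1)`. -/
noncomputable def unifOff {b : ℕ} (i : Fin b) : Fin b → ℝ :=
  fun a => if a = i then 0 else 1 / ((b : ℝ) - 1)

/-- Coordinate `i` is `1 - ε`, every other coordinate is `ε/(b-1)`. -/
noncomputable def peak {b : ℕ} (ε : ℝ) (i : Fin b) : Fin b → ℝ :=
  fun a => if a = i then 1 - ε else ε / ((b : ℝ) - 1)

/-- Coordinate `i` is `1 - ε`, coordinate `h` is `0`, every other coordinate is `ε/(b-2)`. -/
noncomputable def peakOff {b : ℕ} (ε : ℝ) (i h : Fin b) : Fin b → ℝ :=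
  fun a => if a = i then 1 - ε else if a = h then 0 else ε / ((b : ℝ) - 2)

/-!
Up to the factor `j!`, the function `Psi` is `fsum j p q = ∑ₐ (qₐ e_j(p̂ₐ) + pₐ e_j(q̂ₐ))`, where
`e_j` is the elementary symmetric function and `p̂ₐ` is `p` without its coordinate `a` (`Psi_eq`).

*Averaging.* Move two coordinates `a`, `c` of `p` and of `q` symmetrically together or apart. Along
this motion `fsum` is a constant plus a multiple of the squared distance (`mixed_spread`). Hence among
the maximizers over a compact product of boxes in the simplex, one of least square sum satisfies, for
any two coordinates with the same bounds: the two coordinates agree, both for `p` and for `q`, or they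
are strictly oppositely ordered and some value is at its bound (`IsExtremal.eq_or_opposed`). If only
the bound `0` occurs, then either `p` and `q` are constant on the coordinates concerned, or the pairs
`(pₐ, qₐ)` take only three values `(0, δ)`, `(γ, 0)`, `(α, β)` (`Dichotomy.families`). In the second
case, once the multiplicities are chosen, `fsum` is a polynomial in two free parameters, and it is
bounded by a subdivision into boxes in integer arithmetic: `allFamOk` is the search, and
`mixedFam_add_le_of_allFamOk` its soundness. The kernel evaluates the search.

*Chords.* Write a vector with `q i ≥ 1 - ε` as a point of the segment from the point mass at `i` to a
vector `q'` with `q' i = 1 - ε`. Then `fsum p q` lies below its chord on that segment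
(`fsum_le_chord`), so that unbalanced vectors may be replaced by point masses, where `fsum` is
`e_j` of `p` without its `i`-th coordinate and Maclaurin's inequality `esym_le` applies, or by vectors
with `i`-th coordinate equal to `1 - ε`.

* Both balanced (`fsum_le_of_balanced`): if no coordinate of an extremal pair equals `1 - ε`, the
  dichotomy leaves the uniform pair or the verified families. If `q i = 1 - ε` and `p` has a coordinate
  at least `1/2`, crude bounds suffice; otherwise the mass of `p` at `i` can be moved to the other
  coordinates, which brings the pair into the verified families.
* One balanced (`fsum_le_of_balanced_of_unbalanced`): both ends of the chord are settled, one by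
  Maclaurin's inequality and one by the first case.
* Unbalanced at the same coordinate (`fsum_le_of_same_unbalanced`): after two chords, the dichotomy for
  the other coordinates leaves the claimed pair or the verified families.
* Unbalanced at different coordinates (`fsum_le_of_different_unbalanced`): after two chords, either
  one of the remaining coordinates vanishes and crude bounds suffice, or both vectors are constant there
  and `fsum` is bounded by a bilinear function of the two remaining parameters.

The suprema are values at points of the closures of the sets by continuity of `fsum`.
-/

/-! ### Elementary symmetric functions and Maclaurin's inequality -/

open Finset in
/-- The `k`-th elementary symmetric function of the numbers `p i`, `i ∈ S`. -/
noncomputable def esym {ι : Type*} (S : Finset ι) (k : ℕ) (p : ι → ℝ) : ℝ :=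
  ∑ t ∈ powersetCard k S, ∏ i ∈ t, p i

section Esym

variable {ι : Type*}

lemma esym_zero (S : Finset ι) (p : ι → ℝ) : esym S 0 p = 1 := by
  simp [esym]

lemma esym_congr {S : Finset ι} {k : ℕ} {p q : ι → ℝ} (h : ∀ i ∈ S, p i = q i) :
    esym S k p = esym S k q :=
  Finset.sum_congr rfl fun _ ht =>
    Finset.prod_congr rfl fun i hi => h i ((Finset.mem_powersetCard.1 ht).1 hi)

lemma esym_nonneg {S : Finset ι} {k : ℕ} {p : ι → ℝ} (h : ∀ i ∈ S, 0 ≤ p i) :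
    0 ≤ esym S k p :=
  Finset.sum_nonneg fun _ ht =>
    Finset.prod_nonneg fun i hi => h i ((Finset.mem_powersetCard.1 ht).1 hi)

lemma esym_mono_set {S T : Finset ι} (hST : S ⊆ T) {k : ℕ} {p : ι → ℝ} (h : ∀ i ∈ T, 0 ≤ p i) :
    esym S k p ≤ esym T k p :=
  Finset.sum_le_sum_of_subset_of_nonneg (Finset.powersetCard_mono hST) fun _ ht _ =>
    Finset.prod_nonneg fun i hi => h i ((Finset.mem_powersetCard.1 ht).1 hi)

lemma esym_smul (S : Finset ι) (k : ℕ) (c : ℝ) (p : ι → ℝ) :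
    esym S k (fun i => c * p i) = c ^ k * esym S k p := by
  unfold esym
  rw [Finset.mul_sum]
  refine Finset.sum_congr rfl fun t ht => ?_
  rw [Finset.prod_mul_distrib, Finset.prod_const, (Finset.mem_powersetCard.1 ht).2]

lemma esym_const (S : Finset ι) (k : ℕ) (a : ℝ) :
    esym S k (fun _ => a) = (S.card.choose k : ℝ) * a ^ k := by
  unfold esym
  rw [Finset.sum_congr rfl (g := fun _ => a ^ k)
    fun t ht => by rw [Finset.prod_const, (Finset.mem_powersetCard.1 ht).2]]
  rw [Finset.sum_const, Finset.card_powersetCard, nsmul_eq_mul]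

lemma esym_of_const {S : Finset ι} {k : ℕ} {p : ι → ℝ} {a : ℝ} (h : ∀ i ∈ S, p i = a) :
    esym S k p = (S.card.choose k : ℝ) * a ^ k := by
  rw [← esym_const S k a]; exact esym_congr h

lemma continuous_esym (S : Finset ι) (k : ℕ) : Continuous fun p : ι → ℝ => esym S k p := by
  unfold esym; fun_prop

variable [DecidableEq ι]

lemma esym_insert_succ {S : Finset ι} {a : ι} (ha : a ∉ S) (k : ℕ) (p : ι → ℝ) :
    esym (insert a S) (k + 1) p = esym S (k + 1) p + p a * esym S k p := by
  unfold esym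
  rw [Finset.powersetCard_succ_insert ha, Finset.sum_union, Finset.sum_image, Finset.mul_sum]
  · congr 1
    refine Finset.sum_congr rfl fun t ht => ?_
    rw [Finset.prod_insert fun h => ha ((Finset.mem_powersetCard.1 ht).1 h)]
  · intro s hs t ht h
    have hs' : a ∉ s := fun h => ha ((Finset.mem_powersetCard.1 hs).1 h)
    have ht' : a ∉ t := fun h => ha ((Finset.mem_powersetCard.1 ht).1 h)
    rw [← Finset.erase_insert hs', ← Finset.erase_insert ht']
    exact congrArg (fun u => Finset.erase u a) h
  · rw [Finset.disjoint_left]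
    intro s hs hs'
    obtain ⟨t, _, rfl⟩ := Finset.mem_image.1 hs'
    exact ha ((Finset.mem_powersetCard.1 hs).1 (Finset.mem_insert_self a t))

lemma esym_erase_succ {S : Finset ι} {a : ι} (ha : a ∈ S) (k : ℕ) (p : ι → ℝ) :
    esym S (k + 1) p = esym (S.erase a) (k + 1) p + p a * esym (S.erase a) k p := by
  conv_lhs => rw [← Finset.insert_erase ha]
  exact esym_insert_succ (Finset.notMem_erase a S) k p

lemma esym_erase_of_eq_zero {S : Finset ι} {a : ι} (ha : a ∈ S) {p : ι → ℝ} (hp : p a = 0)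
    (k : ℕ) : esym S k p = esym (S.erase a) k p := by
  cases k with
  | zero => rw [esym_zero, esym_zero]
  | succ k => rw [esym_erase_succ ha, hp]; ring

open Polynomial in
lemma coeff_prod_one_add (S : Finset ι) (k : ℕ) (p : ι → ℝ) :
    (∏ i ∈ S, (1 + C (p i) * X) : ℝ[X]).coeff k = esym S k p := by
  induction S using Finset.induction_on generalizing k with
  | empty =>
    cases k with
    | zero => simp [esym_zero]
    | succ k =>
      rw [Finset.prod_empty, coeff_one, esym, Finset.powersetCard_eq_empty.2 (by simp)]
      simp
  | insert a S ha ih =>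
    rw [Finset.prod_insert ha, add_mul, one_mul, coeff_add, mul_assoc, coeff_C_mul, ih]
    cases k with
    | zero => simp [esym_zero]
    | succ k => rw [coeff_X_mul, ih, esym_insert_succ ha]

/-- The weighted inequality of arithmetic and geometric means `m v ⋯ v ≤ (mᵏ⁺¹ + k vᵏ⁺¹) / (k+1)`. -/
lemma succ_mul_mul_pow_le (k : ℕ) {m v : ℝ} (hm : 0 ≤ m) (hv : 0 ≤ v) :
    ((k : ℝ) + 1) * (m * v ^ k) ≤ m ^ (k + 1) + k * v ^ (k + 1) := by
  induction k with
  | zero => simp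
  | succ k ih =>
    have h1 := mul_le_mul_of_nonneg_left ih hv
    have h2 : 0 ≤ (m ^ (k + 1) - v ^ (k + 1)) * (m - v) := by
      rcases le_total m v with h | h
      · exact mul_nonneg_of_nonpos_of_nonpos (sub_nonpos.2 (pow_le_pow_left₀ hm h _))
          (sub_nonpos.2 h)
      · exact mul_nonneg (sub_nonneg.2 (pow_le_pow_left₀ hv h _)) (sub_nonneg.2 h)
    push_cast
    ring_nf at h1 h2 ⊢
    linarith

/-- Maclaurin's inequality: with a given sum, `e_k` is largest when all numbers are equal. -/
lemma esym_le (S : Finset ι) (hS : S.Nonempty) (k : ℕ) {p : ι → ℝ} (hp : ∀ i ∈ S, 0 ≤ p i) :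
    esym S k p ≤ (S.card.choose k : ℝ) / (S.card : ℝ) ^ k * (∑ i ∈ S, p i) ^ k := by
  induction hS using Finset.Nonempty.cons_induction generalizing k with
  | singleton a =>
    rcases k with _ | _ | k
    · simp [esym_zero]
    · simp [esym, Finset.powersetCard_one]
    · have : esym ({a} : Finset ι) (k + 1 + 1) p = 0 := by
        unfold esym; rw [Finset.powersetCard_eq_empty.2 (by simp)]; simp
      rw [this, Finset.card_singleton, Nat.choose_eq_zero_of_lt (by omega)]; simp
  | cons a S ha hS ih =>
    have hpS : ∀ i ∈ S, 0 ≤ p i := fun i hi => hp i (Finset.mem_cons_of_mem hi)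
    have hpa : 0 ≤ p a := hp a (Finset.mem_cons_self a S)
    rw [Finset.card_cons, Finset.sum_cons]
    cases k with
    | zero => simp [esym_zero]
    | succ k =>
      rw [Finset.cons_eq_insert, esym_insert_succ ha]
      have h1 := ih (k + 1) hpS
      have h2 := mul_le_mul_of_nonneg_left (ih k hpS) hpa
      set N := S.card with hN
      have hN0 : (0 : ℝ) < N := by exact_mod_cast hS.card_pos
      set s := ∑ i ∈ S, p i with hs
      have hs0 : 0 ≤ s := Finset.sum_nonneg hpS
      -- `v` is the mean over `S`, `m` the mean over `S ∪ {a}`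
      obtain ⟨v, hv⟩ : ∃ v, v = s / N := ⟨_, rfl⟩
      have hv0 : 0 ≤ v := by rw [hv]; positivity
      have hsv : s = N * v := by rw [hv]; field_simp
      obtain ⟨m, hm⟩ : ∃ m, m = (p a + s) / (N + 1) := ⟨_, rfl⟩
      have hm0 : 0 ≤ m := by rw [hm]; positivity
      have hpm : p a = (N + 1) * m - N * v := by rw [hm, ← hsv]; field_simp; ring
      have am := succ_mul_mul_pow_le k hm0 hv0
      have e1 : (N.choose (k + 1) : ℝ) / (N : ℝ) ^ (k + 1) * s ^ (k + 1)
          = N.choose (k + 1) * v ^ (k + 1) := by rw [hv, div_pow]; ring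
      have e2 : p a * ((N.choose k : ℝ) / (N : ℝ) ^ k * s ^ k) = p a * (N.choose k * v ^ k) := by
        rw [hv, div_pow]; ring
      have e3 : ((N + 1).choose (k + 1) : ℝ) / ((N + 1 : ℕ) : ℝ) ^ (k + 1) * (p a + s) ^ (k + 1)
          = (N + 1).choose (k + 1) * m ^ (k + 1) := by rw [hm, div_pow]; push_cast; ring
      rw [e1] at h1
      rw [e2] at h2
      rw [e3]
      refine (add_le_add h1 h2).trans ?_
      -- binomial recurrences: `(k+1) C(N,k+1) = (N-k) C(N,k)`, `(k+1) C(N+1,k+1) = (N+1) C(N,k)`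
      have c1 : ((N + 1).choose (k + 1) : ℝ) * (k + 1) = (N + 1) * N.choose k := by
        have := Nat.add_one_mul_choose_eq N k
        have h : (((N + 1) * N.choose k : ℕ) : ℝ) = (((N + 1).choose (k + 1) * (k + 1) : ℕ) : ℝ) := by
          exact_mod_cast this
        push_cast at h; linarith
      have c2 : ((N + 1).choose (k + 1) : ℝ) = N.choose k + N.choose (k + 1) := by
        exact_mod_cast Nat.choose_succ_succ N k
      have hk : (0 : ℝ) < k + 1 := by positivity
      have hc0 : (0 : ℝ) ≤ N.choose k := by positivity
      have key : (N.choose (k + 1) * v ^ (k + 1) + p a * (N.choose k * v ^ k)) * (k + 1)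
          ≤ ((N + 1).choose (k + 1) * m ^ (k + 1)) * (k + 1) := by
        have c3 : (N.choose (k + 1) : ℝ) * (k + 1) = (N - k) * N.choose k := by
          rw [c2] at c1; linarith
        calc (N.choose (k + 1) * v ^ (k + 1) + p a * (N.choose k * v ^ k)) * (k + 1)
            = (N.choose (k + 1) * (k + 1)) * v ^ (k + 1) + p a * (N.choose k * v ^ k) * (k + 1) := by
              ring
          _ = N.choose k * (N + 1) * ((k + 1) * (m * v ^ k) - k * v ^ (k + 1)) := by
              rw [c3, hpm]; ring
          _ ≤ N.choose k * (N + 1) * m ^ (k + 1) := by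
              apply mul_le_mul_of_nonneg_left _ (mul_nonneg hc0 (by linarith)); linarith
          _ = ((N + 1).choose (k + 1) * (k + 1)) * m ^ (k + 1) := by rw [c1]; ring
          _ = _ := by ring
      exact le_of_mul_le_mul_right key hk


end Esym

section Fsum

variable {ι : Type*} [Fintype ι] [DecidableEq ι]

/-- `∑ₐ qₐ e_k(p without the coordinate a)`: the derivative of `e_{k+1}` at `p` in the direction
`q`. -/
noncomputable def mixed (k : ℕ) (p q : ι → ℝ) : ℝ :=
  ∑ a, q a * esym (Finset.univ.erase a) k p

/-- The symmetric function `Psi` up to the factor `j!`. -/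
noncomputable def fsum (k : ℕ) (p q : ι → ℝ) : ℝ := mixed k p q + mixed k q p

lemma fsum_comm (k : ℕ) (p q : ι → ℝ) : fsum k p q = fsum k q p := add_comm _ _

lemma continuous_fsum (k : ℕ) : Continuous fun x : (ι → ℝ) × (ι → ℝ) => fsum k x.1 x.2 := by
  unfold fsum mixed
  have h : ∀ a : ι, Continuous fun p : ι → ℝ => esym (Finset.univ.erase a) k p :=
    fun a => continuous_esym _ k
  refine Continuous.add ?_ ?_
  · exact continuous_finsetSum _ fun a _ =>
      ((continuous_apply a).comp continuous_snd).mul ((h a).comp continuous_fst)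
  · exact continuous_finsetSum _ fun a _ =>
      ((continuous_apply a).comp continuous_fst).mul ((h a).comp continuous_snd)

end Fsum

/-! ### The sum over permutations -/

/-- Every pair `(a, t)` with `a ∉ t`, `|t| = j`, arises from equally many permutations `σ` as
`(σ(j), {σ(0), …, σ(j-1)})`, whence the factor `j! (b-j-1)!`. -/
lemma sum_perm_prod_mul {b j : ℕ} (hj : j < b) (p q : Fin b → ℝ) :
    ∑ σ : Equiv.Perm (Fin b), (∏ t : Fin j, p (σ (Fin.castLE hj.le t))) * q (σ ⟨j, hj⟩)
      = ((j.factorial * (b - j - 1).factorial : ℕ) : ℝ) * mixed j p q := by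
  classical
  let S : Finset (Fin b) := Finset.univ.map (Fin.castLEEmb hj.le)
  have hScard : S.card = j := by simp [S]
  have hjS : (⟨j, hj⟩ : Fin b) ∉ S := by
    simp only [S, Finset.mem_map, Finset.mem_univ, true_and, not_exists]
    intro x hx
    have := congrArg Fin.val hx
    simp at this
    omega
  let key : Equiv.Perm (Fin b) → (Σ _ : Fin b, Finset (Fin b)) :=
    fun σ => ⟨σ ⟨j, hj⟩, S.map σ.toEmbedding⟩
  let pairs : Finset (Σ _ : Fin b, Finset (Fin b)) :=
    Finset.univ.sigma fun a => Finset.powersetCard j (Finset.univ.erase a)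
  have hkey : ∀ σ, key σ ∈ pairs := by
    intro σ
    simp only [key, pairs, Finset.mem_sigma, Finset.mem_univ, true_and, Finset.mem_powersetCard,
      Finset.card_map, hScard, and_true]
    intro x hx
    obtain ⟨y, hy, rfl⟩ := Finset.mem_map.1 hx
    refine Finset.mem_erase.2 ⟨fun h => hjS ?_, Finset.mem_univ _⟩
    rw [← σ.injective h]; exact hy
  have hprod : ∀ σ : Equiv.Perm (Fin b), ∏ t : Fin j, p (σ (Fin.castLE hj.le t))
      = ∏ i ∈ (key σ).2, p i := by
    intro σ; simp [key, S, Finset.prod_map]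
  -- the permutation group acts transitively on the pairs
  have htrans : ∀ x ∈ pairs, ∃ τ, key τ = x := by
    rintro ⟨a, t⟩ hx
    simp only [pairs, Finset.mem_sigma, Finset.mem_univ, true_and, Finset.mem_powersetCard] at hx
    obtain ⟨hta, htc⟩ := hx
    let f : Option (Fin j) → Fin b := fun o => o.elim ⟨j, hj⟩ (Fin.castLE hj.le)
    let g : Option (Fin j) → Fin b := fun o => o.elim a (t.orderEmbOfFin htc)
    have hf : Function.Injective f := by
      rintro (_ | x) (_ | y) h
      · rfl
      · have := congrArg Fin.val h; simp [f] at this; omega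
      · have := congrArg Fin.val h; simp [f] at this; omega
      · simpa [f] using h
    have hmem : ∀ y, t.orderEmbOfFin htc y ≠ a := fun y h =>
      (Finset.mem_erase.1 (hta (Finset.orderEmbOfFin_mem t htc y))).1 h
    have hg : Function.Injective g := by
      rintro (_ | x) (_ | y) h
      · rfl
      · exact absurd h.symm (hmem y)
      · exact absurd h (hmem x)
      · simpa [g] using h
    obtain ⟨τ, hτ⟩ := Equiv.Perm.exists_extending_pair f g hf hg
    refine ⟨τ, ?_⟩
    have h1 : τ ⟨j, hj⟩ = a := hτ none
    have h2 : S.map τ.toEmbedding = t := by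
      apply Finset.eq_of_subset_of_card_le
      · intro x hx
        simp only [S, Finset.mem_map, Finset.mem_univ, true_and] at hx
        obtain ⟨_, ⟨y, rfl⟩, rfl⟩ := hx
        have : τ (Fin.castLE hj.le y) = t.orderEmbOfFin htc y := hτ (some y)
        change τ (Fin.castLE hj.le y) ∈ t
        rw [this]; exact Finset.orderEmbOfFin_mem t htc y
      · rw [Finset.card_map, hScard, htc]
    simp only [key, h1, h2]
  let fib : (Σ _ : Fin b, Finset (Fin b)) → Finset (Equiv.Perm (Fin b)) :=
    fun x => Finset.univ.filter fun σ => key σ = x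
  have hfib : ∀ x ∈ pairs, (fib x).card = (fib (key 1)).card := by
    intro x hx
    obtain ⟨τ, rfl⟩ := htrans x hx
    have hmul : ∀ σ, key (τ * σ) = ⟨τ (key σ).1, (key σ).2.map τ.toEmbedding⟩ := by
      intro σ
      simp only [key, Equiv.Perm.mul_apply, Finset.map_map]
      rfl
    have hinj : ∀ σ ρ, key (τ * σ) = key (τ * ρ) → key σ = key ρ := by
      intro σ ρ h
      rw [hmul, hmul] at h
      obtain ⟨h1, h2⟩ := Sigma.mk.inj h
      exact Sigma.ext (τ.injective h1) (heq_of_eq (Finset.map_injective _ (eq_of_heq h2)))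
    refine (Finset.card_bij (fun σ _ => τ * σ) ?_ ?_ ?_).symm
    · intro σ hσ
      simp only [fib, Finset.mem_filter, Finset.mem_univ, true_and] at hσ ⊢
      rw [hmul, hσ, ← hmul, mul_one]
    · intro σ _ ρ _ h
      exact mul_left_cancel h
    · intro ρ hρ
      simp only [fib, Finset.mem_filter, Finset.mem_univ, true_and] at hρ
      refine ⟨τ⁻¹ * ρ, ?_, by group⟩
      simp only [fib, Finset.mem_filter, Finset.mem_univ, true_and]
      apply hinj
      rw [mul_inv_cancel_left, hρ, mul_one]
  have hmaps : ∀ σ ∈ (Finset.univ : Finset (Equiv.Perm (Fin b))), key σ ∈ pairs := fun σ _ => hkey σ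
  have hcount : b.factorial = pairs.card * (fib (key 1)).card := by
    have := Finset.card_eq_sum_card_fiberwise hmaps
    rw [Finset.card_univ, Fintype.card_perm, Fintype.card_fin] at this
    rw [this, Finset.sum_congr rfl hfib, Finset.sum_const, smul_eq_mul]
  have hpairs : pairs.card = b * (b - 1).choose j := by
    simp [pairs, Finset.card_sigma, Finset.card_erase_of_mem]
  have hfac : (fib (key 1)).card = j.factorial * (b - j - 1).factorial := by
    have h1 := Nat.choose_mul_factorial_mul_factorial (show j ≤ b - 1 by omega)
    have h2 : b * (b - 1).factorial = b.factorial := Nat.mul_factorial_pred (by omega)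
    have h3 : b - 1 - j = b - j - 1 := by omega
    rw [h3] at h1
    have hpos : 0 < b * (b - 1).choose j :=
      Nat.mul_pos (by omega) (Nat.choose_pos (by omega))
    apply Nat.eq_of_mul_eq_mul_left hpos
    rw [← hpairs, ← hcount, ← h2, ← h1, hpairs]; ring
  have hsum : mixed j p q = ∑ x ∈ pairs, (∏ i ∈ x.2, p i) * q x.1 := by
    simp only [mixed, esym, pairs, Finset.sum_sigma, Finset.mul_sum]
    exact Finset.sum_congr rfl fun a _ => Finset.sum_congr rfl fun t _ => mul_comm _ _
  rw [hsum, ← hfac, Finset.mul_sum, ← Finset.sum_fiberwise_of_maps_to hmaps]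
  refine Finset.sum_congr rfl fun x hx => ?_
  rw [← hfib x hx, Finset.sum_congr rfl (g := fun _ => (∏ i ∈ x.2, p i) * q x.1), Finset.sum_const,
    nsmul_eq_mul]
  intro σ hσ
  have : key σ = x := (Finset.mem_filter.1 hσ).2
  rw [hprod, ← this]

lemma Psi_eq {b j : ℕ} (hj : j < b) (p q : Fin b → ℝ) :
    Psi hj p q = (j.factorial : ℝ) * fsum j p q := by
  unfold Psi fsum
  rw [Finset.sum_add_distrib, sum_perm_prod_mul, sum_perm_prod_mul]
  have : ((b - j - 1).factorial : ℝ) ≠ 0 := by positivity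
  push_cast
  field_simp

/-! ### Averaging two coordinates, and extremal pairs -/

section Smoothing

variable {ι : Type*}

section

variable [DecidableEq ι]

/-- Coordinates `a` and `c` of `p` are moved to distance `τ (p a - p c)`, keeping their sum:
`τ = 1` gives `p`, `τ = 0` averages the two. -/
noncomputable def spread (p : ι → ℝ) (a c : ι) (τ : ℝ) : ι → ℝ :=
  fun i => if i = a then (p a + p c) / 2 + τ * ((p a - p c) / 2)
    else if i = c then (p a + p c) / 2 - τ * ((p a - p c) / 2) else p i

lemma spread_left (p : ι → ℝ) (a c : ι) (τ : ℝ) :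
    spread p a c τ a = (p a + p c) / 2 + τ * ((p a - p c) / 2) := by simp [spread]

lemma spread_right (p : ι → ℝ) {a c : ι} (hac : a ≠ c) (τ : ℝ) :
    spread p a c τ c = (p a + p c) / 2 - τ * ((p a - p c) / 2) := by simp [spread, hac.symm]

lemma spread_of_ne (p : ι → ℝ) {a c i : ι} (ha : i ≠ a) (hc : i ≠ c) (τ : ℝ) :
    spread p a c τ i = p i := by simp [spread, ha, hc]

lemma spread_one (p : ι → ℝ) {a c : ι} (hac : a ≠ c) : spread p a c 1 = p := by
  ext i
  by_cases hia : i = a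
  · rw [hia, spread_left]; ring
  by_cases hic : i = c
  · rw [hic, spread_right p hac]; ring
  exact spread_of_ne p hia hic 1

end

variable [Fintype ι]

/-- Probability vectors with prescribed lower and upper bounds on the coordinates. -/
def boxSimplex (l u : ι → ℝ) : Set (ι → ℝ) :=
  {p | p ∈ stdSimplex ℝ ι ∧ ∀ i, l i ≤ p i ∧ p i ≤ u i}

lemma isCompact_boxSimplex (l u : ι → ℝ) : IsCompact (boxSimplex l u) := by
  have : boxSimplex l u = stdSimplex ℝ ι ∩ Set.Icc l u := by
    ext p; simp only [boxSimplex, Set.mem_ofPred_eq, Set.mem_inter_iff, Set.mem_Icc, Pi.le_def]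
    exact and_congr_right fun _ => forall_and
  rw [this]
  exact (isCompact_stdSimplex ℝ ι).inter_right isClosed_Icc

variable [DecidableEq ι]

/-- The dependence of `mixed` on two coordinates `a`, `c`. -/
lemma mixed_pair {a c : ι} (hac : a ≠ c) (k : ℕ) (p q : ι → ℝ) :
    mixed (k + 2) p q =
      ∑ i ∈ (Finset.univ.erase a).erase c, q i *
        (esym (((Finset.univ.erase a).erase c).erase i) (k + 2) p
          + (p a + p c) * esym (((Finset.univ.erase a).erase c).erase i) (k + 1) p
          + p a * p c * esym (((Finset.univ.erase a).erase c).erase i) k p)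
      + (q a + q c) * esym ((Finset.univ.erase a).erase c) (k + 2) p
      + (q a * p c + q c * p a) * esym ((Finset.univ.erase a).erase c) (k + 1) p := by
  have hc : c ∈ Finset.univ.erase a := Finset.mem_erase.2 ⟨hac.symm, Finset.mem_univ _⟩
  have ha : a ∈ Finset.univ.erase c := Finset.mem_erase.2 ⟨hac, Finset.mem_univ _⟩
  unfold mixed
  rw [← Finset.add_sum_erase _ _ (Finset.mem_univ a), ← Finset.add_sum_erase _ _ hc,
    esym_erase_succ hc, esym_erase_succ ha, Finset.erase_right_comm (a := c)]
  have : ∀ i ∈ (Finset.univ.erase a).erase c, q i * esym (Finset.univ.erase i) (k + 2) p =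
      q i * (esym (((Finset.univ.erase a).erase c).erase i) (k + 2) p
          + (p a + p c) * esym (((Finset.univ.erase a).erase c).erase i) (k + 1) p
          + p a * p c * esym (((Finset.univ.erase a).erase c).erase i) k p) := by
    intro i hi
    obtain ⟨hic, hia⟩ := Finset.mem_erase.1 hi
    obtain ⟨hia, -⟩ := Finset.mem_erase.1 hia
    have h1 : a ∈ Finset.univ.erase i := Finset.mem_erase.2 ⟨hia.symm, Finset.mem_univ _⟩
    have h2 : c ∈ (Finset.univ.erase i).erase a :=
      Finset.mem_erase.2 ⟨hac.symm, Finset.mem_erase.2 ⟨hic.symm, Finset.mem_univ _⟩⟩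
    have h3 : ((Finset.univ.erase i).erase a).erase c
        = ((Finset.univ.erase a).erase c).erase i := by
      ext x; simp only [Finset.mem_erase, Finset.mem_univ]; tauto
    rw [esym_erase_succ h1, esym_erase_succ h2, esym_erase_succ h2, h3]; ring
  rw [Finset.sum_congr rfl this]
  ring

lemma sum_pair {a c : ι} (hac : a ≠ c) (f : ι → ℝ) :
    ∑ i, f i = f a + (f c + ∑ i ∈ (Finset.univ.erase a).erase c, f i) := by
  rw [← Finset.add_sum_erase _ _ (Finset.mem_univ a),
    ← Finset.add_sum_erase _ _ (Finset.mem_erase.2 ⟨hac.symm, Finset.mem_univ c⟩)]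

lemma sum_spread (p : ι → ℝ) {a c : ι} (hac : a ≠ c) (τ : ℝ) :
    ∑ i, spread p a c τ i = ∑ i, p i := by
  rw [sum_pair hac, sum_pair hac p, spread_left, spread_right p hac]
  have : ∑ i ∈ (Finset.univ.erase a).erase c, spread p a c τ i
      = ∑ i ∈ (Finset.univ.erase a).erase c, p i := by
    refine Finset.sum_congr rfl fun i hi => ?_
    obtain ⟨hic, hia⟩ := Finset.mem_erase.1 hi
    exact spread_of_ne p (Finset.mem_erase.1 hia).1 hic τ
  rw [this]; ring

/-- Along `spread`, `mixed` is a constant plus `τ²` times an explicit quadratic form in the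
differences of the two coordinates. -/
lemma mixed_spread {a c : ι} (hac : a ≠ c) (k : ℕ) {p q : ι → ℝ} (hp : ∀ i, 0 ≤ p i)
    (hq : ∀ i, 0 ≤ q i) :
    ∃ K L M : ℝ, 0 ≤ L ∧ 0 ≤ M ∧ ∀ τ, mixed (k + 2) (spread p a c τ) (spread q a c τ)
      = K - τ ^ 2 * (L * (p a - p c) ^ 2 + M * ((p a - p c) * (q a - q c))) := by
  set R := (Finset.univ.erase a).erase c with hR
  have hne : ∀ i ∈ R, i ≠ a ∧ i ≠ c := fun i hi =>
    ⟨(Finset.mem_erase.1 (Finset.mem_erase.1 hi).2).1, (Finset.mem_erase.1 hi).1⟩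
  refine ⟨∑ i ∈ R, q i * (esym (R.erase i) (k + 2) p + (p a + p c) * esym (R.erase i) (k + 1) p
      + ((p a + p c) / 2) ^ 2 * esym (R.erase i) k p) + (q a + q c) * esym R (k + 2) p
      + (p a + p c) * (q a + q c) / 2 * esym R (k + 1) p,
    ∑ i ∈ R, q i * esym (R.erase i) k p / 4, esym R (k + 1) p / 2,
    Finset.sum_nonneg fun i _ => div_nonneg (mul_nonneg (hq i) (esym_nonneg fun i _ => hp i))
      (by norm_num), div_nonneg (esym_nonneg fun i _ => hp i) (by norm_num), fun τ => ?_⟩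
  rw [mixed_pair hac, ← hR, spread_left, spread_right p hac, spread_left, spread_right q hac]
  have e : ∀ S ⊆ R, ∀ l, esym S l (spread p a c τ) = esym S l p := fun S hS l =>
    esym_congr fun i hi => spread_of_ne p (hne i (hS hi)).1 (hne i (hS hi)).2 τ
  rw [e R subset_rfl, e R subset_rfl]
  have : ∀ i ∈ R, spread q a c τ i * (esym (R.erase i) (k + 2) (spread p a c τ)
        + ((p a + p c) / 2 + τ * ((p a - p c) / 2) + ((p a + p c) / 2 - τ * ((p a - p c) / 2)))
          * esym (R.erase i) (k + 1) (spread p a c τ)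
        + ((p a + p c) / 2 + τ * ((p a - p c) / 2)) * ((p a + p c) / 2 - τ * ((p a - p c) / 2))
          * esym (R.erase i) k (spread p a c τ))
      = q i * (esym (R.erase i) (k + 2) p + (p a + p c) * esym (R.erase i) (k + 1) p
      + ((p a + p c) / 2) ^ 2 * esym (R.erase i) k p)
      - τ ^ 2 * (p a - p c) ^ 2 * (q i * esym (R.erase i) k p / 4) := by
    intro i hi
    have hs : R.erase i ⊆ R := Finset.erase_subset _ _
    rw [spread_of_ne q (hne i hi).1 (hne i hi).2, e _ hs, e _ hs, e _ hs]; ring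
  rw [Finset.sum_congr rfl this, Finset.sum_sub_distrib, ← Finset.mul_sum]
  ring

/-- The sum of the squares of all coordinates. -/
def sqSum (x : (ι → ℝ) × (ι → ℝ)) : ℝ := ∑ i, (x.1 i ^ 2 + x.2 i ^ 2)

/-- `x = (p, q)` maximizes `fsum` over `K`, and has the least sum of squares among all maximizers.
The second condition breaks ties, for instance on segments on which `fsum` is constant. -/
structure IsExtremal (k : ℕ) (K : Set ((ι → ℝ) × (ι → ℝ))) (x : (ι → ℝ) × (ι → ℝ)) : Prop where
  mem : x ∈ K
  le : ∀ y ∈ K, fsum k y.1 y.2 ≤ fsum k x.1 x.2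
  sq_le : ∀ y ∈ K, fsum k x.1 x.2 ≤ fsum k y.1 y.2 → sqSum x ≤ sqSum y

lemma exists_isExtremal (k : ℕ) {K : Set ((ι → ℝ) × (ι → ℝ))} (hK : IsCompact K)
    (hne : K.Nonempty) : ∃ x, IsExtremal k K x := by
  obtain ⟨y, hy, hmax⟩ := hK.exists_isMaxOn hne (continuous_fsum k).continuousOn
  have hK' : IsCompact (K ∩ {x | fsum k y.1 y.2 ≤ fsum k x.1 x.2}) :=
    hK.inter_right (isClosed_le continuous_const (continuous_fsum k))
  have hs : Continuous (sqSum : (ι → ℝ) × (ι → ℝ) → ℝ) := by unfold sqSum; fun_prop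
  obtain ⟨x, hx, hmin⟩ := hK'.exists_isMinOn ⟨y, hy, le_refl (fsum k y.1 y.2)⟩ hs.continuousOn
  exact ⟨x, hx.1, fun z hz => (hmax hz).trans hx.2, fun z hz h => hmin ⟨hz, hx.2.trans h⟩⟩

/-- The coordinates `a` and `c` are strictly oppositely ordered, with `p a` at its lower bound `0`
or `q c` at its lower bound `0` (or one of the larger values at its upper bound `U`). -/
def Opposed (U : ℝ) (p q : ι → ℝ) (a c : ι) : Prop :=
  p a < p c ∧ q c < q a ∧ (p a = 0 ∨ q c = 0 ∨ p c = U ∨ q a = U)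

lemma spread_mem_boxSimplex {l u p : ι → ℝ} {U : ℝ} {a c : ι} (hac : a ≠ c)
    (hla : l a ≤ 0) (hlc : l c ≤ 0) (hua : u a = U) (huc : u c = U) (hp : p ∈ boxSimplex l u)
    {τ : ℝ} (ha0 : 0 ≤ spread p a c τ a) (hc0 : 0 ≤ spread p a c τ c)
    (haU : spread p a c τ a ≤ U) (hcU : spread p a c τ c ≤ U) :
    spread p a c τ ∈ boxSimplex l u := by
  refine ⟨⟨fun i => ?_, by rw [sum_spread p hac]; exact hp.1.2⟩, fun i => ?_⟩
  · by_cases hia : i = a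
    · rw [hia]; exact ha0
    by_cases hic : i = c
    · rw [hic]; exact hc0
    rw [spread_of_ne p hia hic]; exact hp.1.1 i
  · by_cases hia : i = a
    · rw [hia]; exact ⟨hla.trans ha0, by rw [hua]; exact haU⟩
    by_cases hic : i = c
    · rw [hic]; exact ⟨hlc.trans hc0, by rw [huc]; exact hcU⟩
    rw [spread_of_ne p hia hic]; exact hp.2 i

lemma sqSum_spread_zero (p q : ι → ℝ) {a c : ι} (hac : a ≠ c) :
    sqSum (spread p a c 0, spread q a c 0)
      = sqSum (p, q) - ((p a - p c) ^ 2 + (q a - q c) ^ 2) / 2 := by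
  unfold sqSum
  rw [sum_pair hac, sum_pair hac]
  simp only [spread_left, spread_right _ hac]
  have : ∑ i ∈ (Finset.univ.erase a).erase c, (spread p a c 0 i ^ 2 + spread q a c 0 i ^ 2)
      = ∑ i ∈ (Finset.univ.erase a).erase c, (p i ^ 2 + q i ^ 2) := by
    refine Finset.sum_congr rfl fun i hi => ?_
    obtain ⟨hic, hia⟩ := Finset.mem_erase.1 hi
    rw [spread_of_ne p (Finset.mem_erase.1 hia).1 hic, spread_of_ne q (Finset.mem_erase.1 hia).1 hic]
  rw [this]; ring

/-- If moving `a` and `c` apart increases `fsum`, a maximizer cannot have room to do so. -/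
lemma opposed_of_neg {k : ℕ} {l u l' u' : ι → ℝ} {U : ℝ} {a c : ι} (hac : a ≠ c)
    (hla : l a ≤ 0) (hlc : l c ≤ 0) (hla' : l' a ≤ 0) (hlc' : l' c ≤ 0)
    (hua : u a = U) (huc : u c = U) (hua' : u' a = U) (huc' : u' c = U) {p q : ι → ℝ}
    (hx : IsExtremal k (boxSimplex l u ×ˢ boxSimplex l' u') (p, q)) {K Q : ℝ} (hQ : 0 < Q)
    (hF : ∀ τ, fsum k (spread p a c τ) (spread q a c τ) = K + τ ^ 2 * Q)
    (hp : p a < p c) (hq : q c < q a) : Opposed U p q a c := by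
  refine ⟨hp, hq, ?_⟩
  by_contra hcon
  push Not at hcon
  obtain ⟨h1, h2, h3, h4⟩ := hcon
  obtain ⟨hpK, hqK⟩ := hx.mem
  have b1 : 0 < p a := lt_of_le_of_ne (hpK.1.1 a) (Ne.symm h1)
  have b2 : 0 < q c := lt_of_le_of_ne (hqK.1.1 c) (Ne.symm h2)
  have b3 : p c < U := lt_of_le_of_ne (huc ▸ (hpK.2 c).2) h3
  have b4 : q a < U := lt_of_le_of_ne (hua' ▸ (hqK.2 a).2) h4
  have cl : ∀ p : ι → ℝ, Continuous fun τ : ℝ => spread p a c τ a := by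
    intro p; simp only [spread_left]; fun_prop
  have cr : ∀ p : ι → ℝ, Continuous fun τ : ℝ => spread p a c τ c := by
    intro p; simp only [spread_right p hac]; fun_prop
  have ev : ∀ᶠ τ in nhds (1 : ℝ), 0 < spread p a c τ a ∧ spread p a c τ c < U ∧
      0 < spread q a c τ c ∧ spread q a c τ a < U := by
    refine ((cl p).continuousAt.eventually_const_lt ?_).and
      (((cr p).continuousAt.eventually_lt_const ?_).and
      (((cr q).continuousAt.eventually_const_lt ?_).and
      ((cl q).continuousAt.eventually_lt_const ?_))) <;>
      simpa only [spread_one _ hac]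
  obtain ⟨τ, ⟨e1, e2, e3, e4⟩, hτ1⟩ := ((eventually_nhdsWithin_of_eventually_nhds ev).and
    (self_mem_nhdsWithin (s := Set.Ioi (1 : ℝ)))).exists
  have hτ : 1 < τ := hτ1
  have d1 : spread p a c τ a ≤ spread p a c τ c := by
    rw [spread_left, spread_right p hac]; nlinarith
  have d2 : spread q a c τ c ≤ spread q a c τ a := by
    rw [spread_left, spread_right q hac]; nlinarith
  have m1 := spread_mem_boxSimplex hac hla hlc hua huc hpK (τ := τ) e1.le (e1.le.trans d1)
    (d1.trans e2.le) e2.le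
  have m2 := spread_mem_boxSimplex hac hla' hlc' hua' huc' hqK (τ := τ) (e3.le.trans d2) e3.le
    e4.le (d2.trans e4.le)
  have h := hx.le (spread p a c τ, spread q a c τ) ⟨m1, m2⟩
  have h0 := hF 1
  rw [spread_one p hac, spread_one q hac] at h0
  simp only [hF τ, h0] at h
  have := mul_lt_mul_of_pos_right (one_lt_pow₀ hτ two_ne_zero) hQ
  linarith

/-- In an extremal pair, two coordinates with the same bounds carry the same values, or they are
oppositely ordered and one of the values is at a bound. -/
lemma IsExtremal.eq_or_opposed {k : ℕ} {l u l' u' : ι → ℝ} {U : ℝ} {a c : ι} (hac : a ≠ c)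
    (hla : l a ≤ 0) (hlc : l c ≤ 0) (hla' : l' a ≤ 0) (hlc' : l' c ≤ 0)
    (hua : u a = U) (huc : u c = U) (hua' : u' a = U) (huc' : u' c = U) {p q : ι → ℝ}
    (hx : IsExtremal (k + 2) (boxSimplex l u ×ˢ boxSimplex l' u') (p, q)) :
    (p a = p c ∧ q a = q c) ∨ Opposed U p q a c ∨ Opposed U p q c a := by
  obtain ⟨hpK, hqK⟩ := hx.mem
  have hpK : p ∈ boxSimplex l u := hpK
  have hqK : q ∈ boxSimplex l' u' := hqK
  obtain ⟨K, L, M, hL, hM, h1⟩ := mixed_spread hac k hpK.1.1 hqK.1.1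
  obtain ⟨K', L', M', hL', hM', h2⟩ := mixed_spread hac k hqK.1.1 hpK.1.1
  obtain ⟨x, hx'⟩ : ∃ x, x = p a - p c := ⟨_, rfl⟩
  obtain ⟨y, hy'⟩ : ∃ y, y = q a - q c := ⟨_, rfl⟩
  rw [← hx', ← hy'] at h1 h2
  have hF : ∀ τ, fsum (k + 2) (spread p a c τ) (spread q a c τ)
      = (K + K') + τ ^ 2 * (-(L * x ^ 2 + L' * y ^ 2 + (M + M') * (x * y))) := by
    intro τ; unfold fsum; rw [h1, h2]; ring
  -- if `fsum` grows with the distance of the two coordinates, then the differences have opposite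
  -- signs, and only the bounds can stop the motion; otherwise averaging the two coordinates is a
  -- maximizer with smaller sum of squares, unless they agree already
  rcases lt_or_ge 0 (-(L * x ^ 2 + L' * y ^ 2 + (M + M') * (x * y))) with hQ | hQ
  · right
    have hxy : x * y < 0 := by
      by_contra hcon
      push Not at hcon
      have := mul_nonneg (add_nonneg hM hM') hcon
      have := mul_nonneg hL (sq_nonneg x)
      have := mul_nonneg hL' (sq_nonneg y)
      linarith
    rcases mul_neg_iff.1 hxy with ⟨hx0, hy0⟩ | ⟨hx0, hy0⟩
    · right
      have sw : ∀ (p : ι → ℝ) τ, spread p c a τ = spread p a c τ := by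
        intro p τ; ext i
        by_cases hia : i = a
        · rw [hia, spread_left, spread_right p hac.symm]; ring
        by_cases hic : i = c
        · rw [hic, spread_left, spread_right p hac]; ring
        rw [spread_of_ne p hia hic, spread_of_ne p hic hia]
      refine opposed_of_neg hac.symm hlc hla hlc' hla' huc hua huc' hua' hx (K := K + K') hQ (fun τ => ?_)
        (by linarith) (by linarith)
      rw [sw, sw]; exact hF τ
    · left
      exact opposed_of_neg hac hla hlc hla' hlc' hua huc hua' huc' hx hQ hF
        (by linarith) (by linarith)
  · left
    have avg : ∀ {l u p : ι → ℝ}, l a ≤ 0 → l c ≤ 0 → u a = U → u c = U → p ∈ boxSimplex l u →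
        spread p a c 0 ∈ boxSimplex l u := by
      intro l u p hla hlc hua huc hp
      have g1 := hp.1.1 a
      have g2 := hp.1.1 c
      have g3 := (hp.2 a).2
      have g4 := (hp.2 c).2
      rw [hua] at g3
      rw [huc] at g4
      refine spread_mem_boxSimplex hac hla hlc hua huc hp ?_ ?_ ?_ ?_ <;>
        simp only [spread_left, spread_right _ hac] <;> linarith
    have h0 := hF 1
    rw [spread_one p hac, spread_one q hac] at h0
    have hle : fsum (k + 2) p q ≤ fsum (k + 2) (spread p a c 0) (spread q a c 0) := by
      rw [hF 0, h0]; linarith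
    have := hx.sq_le (spread p a c 0, spread q a c 0)
      ⟨avg hla hlc hua huc hpK, avg hla' hlc' hua' huc' hqK⟩ hle
    rw [sqSum_spread_zero p q hac, ← hx', ← hy'] at this
    have hx0 : x = 0 := by nlinarith [sq_nonneg x, sq_nonneg y]
    have hy0 : y = 0 := by nlinarith [sq_nonneg x, sq_nonneg y]
    constructor <;> linarith

end Smoothing

/-! ### Three-valued pairs -/

section Families

open Polynomial in
/-- `e_k` of a list of numbers in which `c` occurs `r` times, `α` occurs `m` times, `γ` occurs `w`
times, and all other entries vanish. -/
noncomputable def esym3 (k r : ℕ) (c : ℝ) (m : ℕ) (α : ℝ) (w : ℕ) (γ : ℝ) : ℝ :=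
  ((1 + C c * X) ^ r * (1 + C α * X) ^ m * (1 + C γ * X) ^ w : ℝ[X]).coeff k

variable {ι : Type*} [DecidableEq ι]

lemma esym_eq_esym3 {R Z W I : Finset ι} (h1 : Disjoint R (Z ∪ (W ∪ I)))
    (h2 : Disjoint Z (W ∪ I)) (h3 : Disjoint W I) {p : ι → ℝ} {c α γ : ℝ}
    (hR : ∀ i ∈ R, p i = c) (hZ : ∀ i ∈ Z, p i = 0) (hW : ∀ i ∈ W, p i = γ)
    (hI : ∀ i ∈ I, p i = α) (k : ℕ) :
    esym (R ∪ (Z ∪ (W ∪ I))) k p = esym3 k R.card c I.card α W.card γ := by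
  have aux : ∀ (S : Finset ι) (x : ℝ), (∀ i ∈ S, p i = x) →
      ∏ i ∈ S, (1 + Polynomial.C (p i) * Polynomial.X)
        = (1 + Polynomial.C x * Polynomial.X) ^ S.card := by
    intro S x h
    rw [Finset.prod_congr rfl (g := fun _ => 1 + Polynomial.C x * Polynomial.X)
      fun i hi => by rw [h i hi], Finset.prod_const]
  rw [← coeff_prod_one_add, Finset.prod_union h1, Finset.prod_union h2, Finset.prod_union h3,
    aux R c hR, aux Z 0 hZ, aux W γ hW, aux I α hI, esym3]
  congr 1
  simp only [map_zero, zero_mul, add_zero, one_pow, one_mul]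
  ring

variable [Fintype ι]

/-- `mixed k p q`, when the coordinates of `(p, q)` are `r` times `(c, c)`, `z` times `(0, δ)`,
`w` times `(γ, 0)` and `m` times `(α, β)`. -/
noncomputable def mixedFam (k r : ℕ) (c : ℝ) (m z w : ℕ) (α γ β δ : ℝ) : ℝ :=
  r * c * esym3 k (r - 1) c m α w γ
    + (z * δ * esym3 k r c m α w γ + m * β * esym3 k r c (m - 1) α w γ)

lemma mixed_eq_mixedFam {R Z W I : Finset ι} (h1 : Disjoint R (Z ∪ (W ∪ I)))
    (h2 : Disjoint Z (W ∪ I)) (h3 : Disjoint W I) (hu : R ∪ (Z ∪ (W ∪ I)) = Finset.univ)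
    {p q : ι → ℝ} {c α γ β δ : ℝ}
    (hR : ∀ i ∈ R, p i = c ∧ q i = c) (hZ : ∀ i ∈ Z, p i = 0 ∧ q i = δ)
    (hW : ∀ i ∈ W, p i = γ ∧ q i = 0) (hI : ∀ i ∈ I, p i = α ∧ q i = β) (k : ℕ) :
    mixed k p q = mixedFam k R.card c I.card Z.card W.card α γ β δ := by
  have hin : ∀ (A : Finset ι) (i : ι), i ∈ A → ∀ B, Disjoint A B → (A ∪ B).erase i = A.erase i ∪ B := by
    intro A i hi B hd
    rw [Finset.erase_union_distrib, Finset.erase_eq_of_notMem (Finset.disjoint_left.1 hd hi)]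
  have hout : ∀ (A B : Finset ι) (i : ι), i ∈ B → Disjoint A B → (A ∪ B).erase i = A ∪ B.erase i := by
    intro A B i hi hd
    rw [Finset.erase_union_distrib, Finset.erase_eq_of_notMem (Finset.disjoint_right.1 hd hi)]
  have eR : ∀ i ∈ R, q i * esym (Finset.univ.erase i) k p
      = c * esym3 k (R.card - 1) c I.card α W.card γ := by
    intro i hi
    rw [(hR i hi).2, ← hu, hin R i hi _ h1, esym_eq_esym3 (h1.mono_left (Finset.erase_subset _ _)) h2 h3
      (fun j hj => (hR j (Finset.mem_of_mem_erase hj)).1) (fun j hj => (hZ j hj).1)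
      (fun j hj => (hW j hj).1) (fun j hj => (hI j hj).1), Finset.card_erase_of_mem hi]
  have eZ : ∀ i ∈ Z, q i * esym (Finset.univ.erase i) k p
      = δ * esym3 k R.card c I.card α W.card γ := by
    intro i hi
    rw [(hZ i hi).2, ← hu, hout R _ i (Finset.mem_union_left _ hi) h1, hin Z i hi _ h2,
      esym_eq_esym3 (h1.mono_right (Finset.union_subset_union_left (Finset.erase_subset _ _)))
      (h2.mono_left (Finset.erase_subset _ _)) h3
      (fun j hj => (hR j hj).1) (fun j hj => (hZ j (Finset.mem_of_mem_erase hj)).1)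
      (fun j hj => (hW j hj).1) (fun j hj => (hI j hj).1)]
  have eW : ∀ i ∈ W, q i * esym (Finset.univ.erase i) k p = 0 := by
    intro i hi
    rw [(hW i hi).2, zero_mul]
  have eI : ∀ i ∈ I, q i * esym (Finset.univ.erase i) k p
      = β * esym3 k R.card c (I.card - 1) α W.card γ := by
    intro i hi
    rw [(hI i hi).2, ← hu, hout R _ i (Finset.mem_union_right _ (Finset.mem_union_right _ hi)) h1,
      hout Z _ i (Finset.mem_union_right _ hi) h2, hout W _ i hi h3,
      esym_eq_esym3 (h1.mono_right (Finset.union_subset_union_right (Finset.union_subset_union_right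
        (Finset.erase_subset _ _))))
      (h2.mono_right (Finset.union_subset_union_right (Finset.erase_subset _ _)))
      (h3.mono_right (Finset.erase_subset _ _))
      (fun j hj => (hR j hj).1) (fun j hj => (hZ j hj).1)
      (fun j hj => (hW j hj).1) (fun j hj => (hI j (Finset.mem_of_mem_erase hj)).1),
      Finset.card_erase_of_mem hi]
  have hsum : ∀ f : ι → ℝ, ∑ i, f i = ∑ i ∈ R, f i + (∑ i ∈ Z, f i + (∑ i ∈ W, f i + ∑ i ∈ I, f i)) := by
    intro f
    rw [← hu, Finset.sum_union h1, Finset.sum_union h2, Finset.sum_union h3]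
  rw [mixed, hsum, Finset.sum_congr rfl eR, Finset.sum_congr rfl eZ, Finset.sum_congr rfl eW,
    Finset.sum_congr rfl eI]
  simp only [Finset.sum_const, nsmul_eq_mul, mixedFam]
  ring

/-- Any two of the coordinates in `T` carry the same values, or they are strictly oppositely ordered
and one of the two smaller values vanishes. -/
def Dichotomy (T : Finset ι) (p q : ι → ℝ) : Prop :=
  ∀ a ∈ T, ∀ c ∈ T, a ≠ c → (p a = p c ∧ q a = q c) ∨
    (p a < p c ∧ q c < q a ∧ (p a = 0 ∨ q c = 0)) ∨ (p c < p a ∧ q a < q c ∧ (p c = 0 ∨ q a = 0))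

omit [Fintype ι] in
/-- Under the dichotomy, a pair of vectors either is constant on `T`, or takes on `T` only three
values `(0, δ)`, `(γ, 0)` and `(α, β)`. -/
lemma Dichotomy.families {T : Finset ι} {p q : ι → ℝ} (h : Dichotomy T p q)
    (hp0 : ∀ i ∈ T, 0 ≤ p i) (hq0 : ∀ i ∈ T, 0 ≤ q i)
    (hp : 0 < ∑ i ∈ T, p i) :
    (∃ α β : ℝ, ∀ i ∈ T, p i = α ∧ q i = β) ∨
    ∃ Z W I : Finset ι, ∃ α γ β δ : ℝ, Disjoint Z (W ∪ I) ∧ Disjoint W I ∧ Z ∪ (W ∪ I) = T ∧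
      (∀ i ∈ Z, p i = 0 ∧ q i = δ) ∧ (∀ i ∈ W, p i = γ ∧ q i = 0) ∧
      (∀ i ∈ I, p i = α ∧ q i = β) ∧ (Z.Nonempty ∨ W.Nonempty) := by
  have key : ∀ S ⊆ T, (∀ a ∈ S, ∀ c ∈ S, p a = p c ∧ q a = q c) →
      ∃ α β : ℝ, ∀ i ∈ S, p i = α ∧ q i = β := by
    intro S _ hS
    rcases S.eq_empty_or_nonempty with rfl | ⟨a, ha⟩
    · exact ⟨0, 0, by simp⟩
    · exact ⟨p a, q a, fun i hi => hS i hi a ha⟩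
  -- no coordinate vanishes in both vectors: otherwise the dichotomy forces `p` to vanish on `T`
  have hnot : ∀ a ∈ T, p a = 0 → q a ≠ 0 := by
    intro a ha hpa hqa
    have hall : ∀ c ∈ T, p c = 0 := by
      intro c hc
      by_cases hac : a = c
      · rw [← hac]; exact hpa
      rcases h a ha c hc hac with h | ⟨-, h, -⟩ | ⟨h, -, -⟩
      · rw [← h.1, hpa]
      · exact absurd h (by rw [hqa]; exact not_lt.2 (hq0 c hc))
      · exact absurd h (by rw [hpa]; exact not_lt.2 (hp0 c hc))
    rw [Finset.sum_eq_zero hall] at hp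
    exact lt_irrefl _ hp
  set Z := T.filter fun i => p i = 0 with hZ
  set W := T.filter fun i => q i = 0 with hW
  set I := T.filter fun i => p i ≠ 0 ∧ q i ≠ 0 with hI
  by_cases hne : Z.Nonempty ∨ W.Nonempty
  swap
  · left
    simp only [not_or, Finset.not_nonempty_iff_eq_empty, hZ, hW, Finset.filter_eq_empty_iff] at hne
    refine key T subset_rfl fun a ha c hc => ?_
    by_cases hac : a = c
    · rw [hac]; exact ⟨rfl, rfl⟩
    rcases h a ha c hc hac with h | ⟨-, -, h | h⟩ | ⟨-, -, h | h⟩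
    · exact h
    · exact absurd h (hne.1 ha)
    · exact absurd h (hne.2 hc)
    · exact absurd h (hne.1 hc)
    · exact absurd h (hne.2 ha)
  · right
    have mZ : ∀ i, i ∈ Z ↔ i ∈ T ∧ p i = 0 := fun i => Finset.mem_filter
    have mW : ∀ i, i ∈ W ↔ i ∈ T ∧ q i = 0 := fun i => Finset.mem_filter
    have mI : ∀ i, i ∈ I ↔ i ∈ T ∧ p i ≠ 0 ∧ q i ≠ 0 := fun i => Finset.mem_filter
    obtain ⟨_, δ, h1⟩ := key Z (Finset.filter_subset _ _) fun a ha c hc => by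
      rw [mZ] at ha hc
      by_cases hac : a = c
      · rw [hac]; exact ⟨rfl, rfl⟩
      rcases h a ha.1 c hc.1 hac with h | ⟨h, -⟩ | ⟨h, -⟩
      · exact h
      · rw [ha.2, hc.2] at h; exact absurd h (lt_irrefl _)
      · rw [ha.2, hc.2] at h; exact absurd h (lt_irrefl _)
    obtain ⟨γ, _, h2⟩ := key W (Finset.filter_subset _ _) fun a ha c hc => by
      rw [mW] at ha hc
      by_cases hac : a = c
      · rw [hac]; exact ⟨rfl, rfl⟩
      rcases h a ha.1 c hc.1 hac with h | ⟨-, h, -⟩ | ⟨-, h, -⟩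
      · exact h
      · rw [ha.2, hc.2] at h; exact absurd h (lt_irrefl _)
      · rw [ha.2, hc.2] at h; exact absurd h (lt_irrefl _)
    obtain ⟨α, β, h3⟩ := key I (Finset.filter_subset _ _) fun a ha c hc => by
      rw [mI] at ha hc
      by_cases hac : a = c
      · rw [hac]; exact ⟨rfl, rfl⟩
      rcases h a ha.1 c hc.1 hac with h | ⟨-, -, h | h⟩ | ⟨-, -, h | h⟩
      · exact h
      · exact absurd h ha.2.1
      · exact absurd h hc.2.2
      · exact absurd h hc.2.1
      · exact absurd h ha.2.2
    refine ⟨Z, W, I, α, γ, β, δ, ?_, ?_, ?_, fun i hi => ⟨((mZ i).1 hi).2, (h1 i hi).2⟩,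
      fun i hi => ⟨(h2 i hi).1, ((mW i).1 hi).2⟩, h3, hne⟩
    · rw [Finset.disjoint_left]
      intro i hi hi'
      rw [mZ] at hi
      rcases Finset.mem_union.1 hi' with hi' | hi'
      · exact hnot i hi.1 hi.2 ((mW i).1 hi').2
      · exact ((mI i).1 hi').2.1 hi.2
    · rw [Finset.disjoint_left]
      intro i hi hi'
      exact ((mI i).1 hi').2.2 ((mW i).1 hi).2
    · ext i
      simp only [Finset.mem_union, mZ, mW, mI]
      tauto

end Families

/-! ### A verified bound for three-valued pairs -/

section Esym3

open Polynomial

/-- Coefficientwise comparison of polynomials with nonnegative coefficients. -/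
def CoeffLE (P Q : ℝ[X]) : Prop := ∀ n, 0 ≤ P.coeff n ∧ P.coeff n ≤ Q.coeff n

lemma CoeffLE.mul {P Q R S : ℝ[X]} (h1 : CoeffLE P Q) (h2 : CoeffLE R S) :
    CoeffLE (P * R) (Q * S) := by
  intro n
  rw [coeff_mul, coeff_mul]
  exact ⟨Finset.sum_nonneg fun x _ => mul_nonneg (h1 _).1 (h2 _).1,
    Finset.sum_le_sum fun x _ => mul_le_mul (h1 _).2 (h2 _).2 (h2 _).1 ((h1 _).1.trans (h1 _).2)⟩

lemma CoeffLE.one : CoeffLE 1 1 := fun n => by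
  rw [coeff_one]; split_ifs <;> simp

lemma CoeffLE.pow {P Q : ℝ[X]} (h : CoeffLE P Q) (m : ℕ) : CoeffLE (P ^ m) (Q ^ m) := by
  induction m with
  | zero => rw [pow_zero, pow_zero]; exact CoeffLE.one
  | succ m ih => rw [pow_succ, pow_succ]; exact ih.mul h

lemma coeffLE_linear {a b : ℝ} (ha : 0 ≤ a) (hab : a ≤ b) :
    CoeffLE (1 + C a * X) (1 + C b * X) := by
  intro n
  rcases n with _ | _ | n
  · simp
  · simp [coeff_one, ha, hab]
  · simp [coeff_one]

lemma coeffLE_linear_pow {a b : ℝ} {m : ℕ} (ha : 0 ≤ a) (hab : m = 0 ∨ a ≤ b) :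
    CoeffLE ((1 + C a * X) ^ m) ((1 + C b * X) ^ m) := by
  rcases hab with rfl | hab
  · rw [pow_zero, pow_zero]; exact CoeffLE.one
  · exact (coeffLE_linear ha hab).pow m

lemma coeffLE_esym3 {c α α' γ γ' : ℝ} {r m w : ℕ} (hc : 0 ≤ c) (hα : 0 ≤ α) (hγ : 0 ≤ γ)
    (h1 : m = 0 ∨ α ≤ α') (h2 : w = 0 ∨ γ ≤ γ') :
    CoeffLE ((1 + C c * X) ^ r * (1 + C α * X) ^ m * (1 + C γ * X) ^ w)
      ((1 + C c * X) ^ r * (1 + C α' * X) ^ m * (1 + C γ' * X) ^ w) :=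
  ((coeffLE_linear_pow hc (Or.inr le_rfl)).mul (coeffLE_linear_pow hα h1)).mul
    (coeffLE_linear_pow hγ h2)

lemma esym3_mono {c α α' γ γ' : ℝ} {m w : ℕ} (hc : 0 ≤ c) (hα : 0 ≤ α) (hγ : 0 ≤ γ)
    (h1 : m = 0 ∨ α ≤ α') (h2 : w = 0 ∨ γ ≤ γ') (k r : ℕ) :
    esym3 k r c m α w γ ≤ esym3 k r c m α' w γ' :=
  (coeffLE_esym3 hc hα hγ h1 h2 k).2

lemma esym3_pred_le {c α γ : ℝ} (hc : 0 ≤ c) (hα : 0 ≤ α) (hγ : 0 ≤ γ) (k r m w : ℕ) :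
    esym3 k r c (m - 1) α w γ ≤ esym3 k r c m α w γ := by
  have h : CoeffLE ((1 + C α * X) ^ (m - 1)) ((1 + C α * X) ^ m) := by
    cases m with
    | zero => exact CoeffLE.one
    | succ m =>
      have h1 : CoeffLE 1 (1 + C α * X) := by
        simpa using coeffLE_linear (le_refl (0 : ℝ)) hα
      simpa [pow_succ] using (coeffLE_linear_pow hα (Or.inr le_rfl)).mul h1
  exact (((coeffLE_linear_pow hc (Or.inr le_rfl)).mul h).mul
    (coeffLE_linear_pow hγ (Or.inr le_rfl)) k).2

lemma esym3_div {T : ℝ} (hT : T ≠ 0) (k r : ℕ) (c : ℝ) (m : ℕ) (α : ℝ) (w : ℕ) (γ : ℝ) :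
    esym3 k r (c / T) m (α / T) w (γ / T) * T ^ k = esym3 k r c m α w γ := by
  unfold esym3
  rw [← comp_C_mul_X_coeff]
  congr 1
  have : ∀ x : ℝ, C (x / T) * (C T * X) = C x * X := fun x => by
    rw [← mul_assoc, ← C_mul, div_mul_cancel₀ _ hT]
  simp [this]

lemma coeff_le_eval_one (P : ℕ[X]) (j : ℕ) : P.coeff j ≤ P.eval 1 := by
  rw [eval_eq_sum_range]
  simp only [one_pow, mul_one]
  by_cases hj : j ∈ Finset.range (P.natDegree + 1)
  · exact Finset.single_le_sum (f := fun i => P.coeff i) (fun _ _ => Nat.zero_le _) hj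
  · rw [coeff_eq_zero_of_natDegree_lt (by simpa using hj)]; exact Nat.zero_le _

/-- The coefficients of a polynomial over `ℕ` are the digits of its value at a large base. -/
lemma eval_div_pow_mod (P : ℕ[X]) (B j : ℕ) (h : P.eval 1 < B) :
    P.eval B / B ^ j % B = P.coeff j := by
  induction j generalizing P with
  | zero =>
    conv_lhs => rw [← divX_mul_X_add P]
    simp [Nat.add_mod, Nat.mod_eq_of_lt ((coeff_le_eval_one P 0).trans_lt h)]
  | succ j ih =>
    have h0 := (coeff_le_eval_one P 0).trans_lt h
    have e : ∀ x, P.eval x = P.divX.eval x * x + P.coeff 0 := by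
      intro x; conv_lhs => rw [← divX_mul_X_add P]
      simp
    have h1 : P.divX.eval 1 < B := by have := e 1; omega
    rw [pow_succ', ← Nat.div_div_eq_div_mul, e B, mul_comm, Nat.mul_add_div (by omega),
      Nat.div_eq_of_lt h0, add_zero, ih _ h1, coeff_divX]

end Esym3

/-- The digit number `k`, to the base `B`, of the value of `(1 + cX)ʳ (1 + aX)ᵐ (1 + gX)ʷ` at
`X = B`. -/
def kronDigit (k r c m a w g B : ℕ) : ℕ :=
  (1 + c * B) ^ r * (1 + a * B) ^ m * (1 + g * B) ^ w / B ^ k % B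

/-- `esym3` of natural numbers, computed with few operations on large numbers by Kronecker
substitution: the base exceeds the sum of all coefficients, so that the digits are the
coefficients. -/
def kron (k r c m a w g : ℕ) : ℕ :=
  kronDigit k r c m a w g ((1 + c) ^ r * (1 + a) ^ m * (1 + g) ^ w + 1)

open Polynomial in
lemma kron_cast (k r c m a w g : ℕ) : (kron k r c m a w g : ℝ) = esym3 k r c m a w g := by
  let P : ℕ[X] := (1 + C c * X) ^ r * (1 + C a * X) ^ m * (1 + C g * X) ^ w
  have h : kron k r c m a w g = P.coeff k := by
    have := eval_div_pow_mod P ((1 + c) ^ r * (1 + a) ^ m * (1 + g) ^ w + 1) k (by simp [P])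
    rw [← this]
    simp [P, kron, kronDigit]
  have h2 : (P.map (Nat.castRingHom ℝ)).coeff k = P.coeff k := by simp
  rw [h, ← h2]
  simp [P, esym3, Polynomial.map_mul, Polynomial.map_pow]

/-- An upper bound, in integers, for `mixedFam` on a box of parameters. The values `α`, `γ` and `c` are
replaced by upper bounds with a common denominator, whose numerators are `a`, `g` and `c`. Of the mass
of `q` outside the `r` fixed coordinates, the fraction `Q / D` is put on the coordinates `(0, δ)`, whose
weight in `mixedFam` is the larger one. -/
def halfBound (k r cn mu D m w a g c Q : ℕ) : ℕ :=
  mu * (Q * kron k r c m a w g + (D - Q) * kron k r c (m - 1) a w g)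
    + r * (D * cn * kron k (r - 1) c m a w g)

/-- The test that the two halves of `fsum`, scaled by a common denominator, add up to at most `bn` on
the box where `z δ` lies between `Q₀ / D` and `Q₁ / D` times the mass outside the fixed coordinates,
and `w γ` between `P₀ / D` and `P₁ / D` times this mass. -/
def boxOk (k r cn mu D z w m bn P₀ P₁ Q₀ Q₁ : ℕ) : Bool :=
  Nat.ble
    (halfBound k r cn mu D m w (mu * (D - P₀) * max w 1) (mu * P₁ * max m 1)
        (cn * D * max m 1 * max w 1) Q₁ * max z 1 ^ k
      + halfBound k r cn mu D m z (mu * (D - Q₀) * max z 1) (mu * Q₁ * max m 1)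
        (cn * D * max m 1 * max z 1) P₁ * max w 1 ^ k) bn

/-- Bisection of a box along its longer side until `boxOk` accepts all pieces. The first unnamed
argument bounds the depth, the other four are the ends of the two intervals. -/
def search (k r cn mu D z w m bn : ℕ) : ℕ → ℕ → ℕ → ℕ → ℕ → Bool
  | 0, _, _, _, _ => false
  | n + 1, P₀, P₁, Q₀, Q₁ =>
    bif boxOk k r cn mu D z w m bn P₀ P₁ Q₀ Q₁ then true else
    bif Nat.ble (P₁ - P₀) (Q₁ - Q₀) then
      search k r cn mu D z w m bn n P₀ P₁ Q₀ ((Q₀ + Q₁) / 2) &&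
        search k r cn mu D z w m bn n P₀ P₁ ((Q₀ + Q₁) / 2) Q₁
    else
      search k r cn mu D z w m bn n P₀ ((P₀ + P₁) / 2) Q₀ Q₁ &&
        search k r cn mu D z w m bn n ((P₀ + P₁) / 2) P₁ Q₀ Q₁

/-- Verification of the bound `num / den` for one family: `r` coordinates `(c, c)` with
`c = cn / (mu + r cn)`, `z` coordinates `(0, δ)`, `w` coordinates `(γ, 0)` and `m = n - z - w`
coordinates `(α, β)`, where no coordinate exceeds `cap / D` times the mass `mu / (mu + r cn)`. The
first two tests recognize that the family is empty, because the coordinates that may be nonzero cannot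
reach that mass. For `m = 0` the whole mass lies on `(0, δ)` and `(γ, 0)`, and the box is a point or
empty. -/
def famOk (k r cn mu D cap num den n z w : ℕ) : Bool :=
  Nat.blt ((n - z) * cap) D || Nat.blt ((n - w) * cap) D ||
  search k r cn mu D z w (n - z - w)
    (num * ((mu + r * cn) * D
      * ((mu + r * cn) * D * max (n - z - w) 1 * max w 1 * max z 1) ^ k) / den) 60
    (if n - z - w = 0 then D else 0) (min (w * cap) D)
    (if n - z - w = 0 then D else 0) (min (z * cap) D)

/-- Verification of the bound `num / den` for all families with `z ≥ 1`, `w ≤ z`. The other families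
arise from these by exchanging the two vectors. -/
def allFamOk (k r cn mu D cap num den n : ℕ) : Bool :=
  (List.range n).all fun z => (List.range (z + 2)).all fun w =>
    Nat.blt n (z + 1 + w) || famOk k r cn mu D cap num den n (z + 1) w

section Soundness

/-- Soundness of `halfBound`: `mixedFam` increases with `α` and `γ`, and with the share of `q` on the
coordinates `(0, δ)`. -/
lemma mixedFam_le_halfBound {k r cn mu D m z w P₀ P₁ Q₁ : ℕ} (hD : 0 < D) (hmu : 0 < mu)
    (hQ1 : Q₁ ≤ D) (hP0 : P₀ ≤ D) {c μ α β γ δ : ℝ} (hc : c = cn / ((mu + r * cn : ℕ) : ℝ))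
    (hμ : μ = mu / ((mu + r * cn : ℕ) : ℝ)) (hα : 0 ≤ α) (hβ : 0 ≤ β) (hγ : 0 ≤ γ) (hδ : 0 ≤ δ)
    (hp : m * α + w * γ = μ) (hq : m * β + z * δ = μ)
    (h0 : μ * P₀ ≤ D * (w * γ)) (h1 : D * (w * γ) ≤ μ * P₁) (h2 : D * (z * δ) ≤ μ * Q₁) :
    mixedFam k r c m z w α γ β δ * (((mu + r * cn : ℕ) : ℝ) * D
        * (((mu + r * cn : ℕ) : ℝ) * D * (max m 1 : ℕ) * (max w 1 : ℕ)) ^ k)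
      ≤ halfBound k r cn mu D m w (mu * (D - P₀) * max w 1) (mu * P₁ * max m 1)
        (cn * D * max m 1 * max w 1) Q₁ := by
  obtain ⟨e, he⟩ : ∃ e : ℝ, e = ((mu + r * cn : ℕ) : ℝ) := ⟨_, rfl⟩
  obtain ⟨M, hM⟩ : ∃ M : ℝ, M = ((max m 1 : ℕ) : ℝ) := ⟨_, rfl⟩
  obtain ⟨V, hV⟩ : ∃ V : ℝ, V = ((max w 1 : ℕ) : ℝ) := ⟨_, rfl⟩
  obtain ⟨T, hT⟩ : ∃ T : ℝ, T = e * D * M * V := ⟨_, rfl⟩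
  have hDr : (0 : ℝ) < D := by exact_mod_cast hD
  have he0 : 0 < e := by rw [he]; exact_mod_cast Nat.add_pos_left hmu _
  have hM0 : 0 < M := by rw [hM]; exact_mod_cast Nat.lt_of_lt_of_le one_pos (le_max_right _ _)
  have hV0 : 0 < V := by rw [hV]; exact_mod_cast Nat.lt_of_lt_of_le one_pos (le_max_right _ _)
  have hT0 : 0 < T := by rw [hT]; positivity
  have hMm : m = 0 ∨ (m : ℝ) = M := by
    rcases Nat.eq_zero_or_pos m with h | h
    · exact Or.inl h
    · right; rw [hM, max_eq_left h]
  have hVw : w = 0 ∨ (w : ℝ) = V := by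
    rcases Nat.eq_zero_or_pos w with h | h
    · exact Or.inl h
    · right; rw [hV, max_eq_left h]
  rw [← he] at hc hμ
  have hc0 : 0 ≤ c := by rw [hc]; positivity
  have hμ0 : 0 ≤ μ := by rw [hμ]; positivity
  obtain ⟨a, ha⟩ : ∃ a : ℕ, a = mu * (D - P₀) * max w 1 := ⟨_, rfl⟩
  obtain ⟨g, hg⟩ : ∃ g : ℕ, g = mu * P₁ * max m 1 := ⟨_, rfl⟩
  obtain ⟨cc, hcc⟩ : ∃ cc : ℕ, cc = cn * D * max m 1 * max w 1 := ⟨_, rfl⟩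
  have hcT : c = (cc : ℝ) / T := by
    rw [hc, hcc, hT]; push_cast [← hM, ← hV]; field_simp
  have haT : (a : ℝ) / T = μ * (D - P₀) / (D * M) := by
    rw [ha, hT, hμ]; push_cast [← hM, ← hV, Nat.cast_sub hP0]; field_simp
  have hgT : (g : ℝ) / T = μ * P₁ / (D * V) := by
    rw [hg, hT, hμ]; push_cast [← hM, ← hV]; field_simp
  have hα' : m = 0 ∨ α ≤ (a : ℝ) / T := by
    refine hMm.imp id fun h => ?_
    rw [haT, le_div_iff₀ (by positivity)]
    rw [h] at hp
    have : α * (D * M) = D * (M * α) := by ring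
    rw [this, show M * α = μ - w * γ by linarith]
    linarith
  have hγ' : w = 0 ∨ γ ≤ (g : ℝ) / T := by
    refine hVw.imp id fun h => ?_
    rw [hgT, le_div_iff₀ (by positivity)]
    rw [h] at h1
    linarith
  have hα'' : m - 1 = 0 ∨ α ≤ (a : ℝ) / T := hα'.imp (fun h => by omega) id
  have haT0 : (0 : ℝ) ≤ (a : ℝ) / T := by positivity
  have hgT0 : (0 : ℝ) ≤ (g : ℝ) / T := by positivity
  have K : ∀ r' m', (kron k r' cc m' a w g : ℝ) = esym3 k r' c m' (a / T) w (g / T) * T ^ k := by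
    intro r' m'
    rw [kron_cast, ← esym3_div hT0.ne', ← hcT]
  have b0 := esym3_mono hc0 hα hγ hα' hγ' k (r - 1)
  have b1 := esym3_mono hc0 hα hγ hα' hγ' k r
  have b2 := esym3_mono hc0 hα hγ hα'' hγ' k r
  have b3 := esym3_pred_le hc0 haT0 hgT0 k r m w
  rw [← ha, ← hg, ← hcc]
  unfold halfBound mixedFam
  push_cast [← hM, ← hV, Nat.cast_sub hQ1, K]
  rw [show (mu : ℝ) + r * cn = e by rw [he]; push_cast; ring]
  rw [← hT]
  obtain ⟨x0, hx0⟩ : ∃ x, x = esym3 k (r - 1) c m (a / T) w (g / T) := ⟨_, rfl⟩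
  obtain ⟨x1, hx1⟩ : ∃ x, x = esym3 k r c m (a / T) w (g / T) := ⟨_, rfl⟩
  obtain ⟨x2, hx2⟩ : ∃ x, x = esym3 k r c (m - 1) (a / T) w (g / T) := ⟨_, rfl⟩
  rw [← hx0] at b0
  rw [← hx1] at b1 b3
  rw [← hx2] at b2 b3
  rw [← hx0, ← hx1, ← hx2]
  have hmu' : (mu : ℝ) = e * μ := by rw [hμ]; field_simp
  have hcn' : (cn : ℝ) = e * c := by rw [hc]; field_simp
  rw [hmu', hcn']
  have s1 : r * c * esym3 k (r - 1) c m α w γ ≤ r * c * x0 :=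
    mul_le_mul_of_nonneg_left b0 (by positivity)
  have s2 : z * δ * esym3 k r c m α w γ ≤ z * δ * x1 :=
    mul_le_mul_of_nonneg_left b1 (by positivity)
  have s3 : m * β * esym3 k r c (m - 1) α w γ ≤ m * β * x2 :=
    mul_le_mul_of_nonneg_left b2 (by positivity)
  have s4 : D * (z * δ * x1 + m * β * x2) ≤ μ * (Q₁ * x1 + (D - Q₁) * x2) := by
    rw [show (m : ℝ) * β = μ - z * δ by linarith]
    have := mul_le_mul_of_nonneg_right h2 (sub_nonneg.2 b3)
    linarith
  have s5 : D * (r * c * esym3 k (r - 1) c m α w γ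
      + (z * δ * esym3 k r c m α w γ + m * β * esym3 k r c (m - 1) α w γ))
      ≤ D * (r * c * x0) + μ * (Q₁ * x1 + (D - Q₁) * x2) := by
    have := mul_le_mul_of_nonneg_left (add_le_add s1 (add_le_add s2 s3)) hDr.le
    linarith
  have s6 := mul_le_mul_of_nonneg_left s5 (show 0 ≤ e * T ^ k by positivity)
  linarith

lemma mixedFam_add_le_of_boxOk {k r cn mu D z w m bn P₀ P₁ Q₀ Q₁ : ℕ} (hD : 0 < D) (hmu : 0 < mu)
    (hP0 : P₀ ≤ D) (hP1 : P₁ ≤ D) (hQ0 : Q₀ ≤ D) (hQ1 : Q₁ ≤ D)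
    {c μ α β γ δ : ℝ} (hc : c = cn / ((mu + r * cn : ℕ) : ℝ))
    (hμ : μ = mu / ((mu + r * cn : ℕ) : ℝ)) (hα : 0 ≤ α) (hβ : 0 ≤ β) (hγ : 0 ≤ γ) (hδ : 0 ≤ δ)
    (hp : m * α + w * γ = μ) (hq : m * β + z * δ = μ)
    (hok : boxOk k r cn mu D z w m bn P₀ P₁ Q₀ Q₁ = true)
    (p0 : μ * P₀ ≤ D * (w * γ)) (p1 : D * (w * γ) ≤ μ * P₁)
    (q0 : μ * Q₀ ≤ D * (z * δ)) (q1 : D * (z * δ) ≤ μ * Q₁) :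
    (mixedFam k r c m z w α γ β δ + mixedFam k r c m w z β δ α γ)
      * (((mu + r * cn) * D * ((mu + r * cn) * D * max m 1 * max w 1 * max z 1) ^ k : ℕ) : ℝ)
      ≤ bn := by
  have h1 := mixedFam_le_halfBound (k := k) hD hmu hQ1 hP0 hc hμ hα hβ hγ hδ hp hq p0 p1 q1
  have h2 := mixedFam_le_halfBound (k := k) hD hmu hP1 hQ0 hc hμ hβ hα hδ hγ hq hp q0 q1 p1
  obtain ⟨A, hA⟩ : ∃ A, A = halfBound k r cn mu D m w (mu * (D - P₀) * max w 1) (mu * P₁ * max m 1)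
    (cn * D * max m 1 * max w 1) Q₁ := ⟨_, rfl⟩
  obtain ⟨B, hB⟩ : ∃ B, B = halfBound k r cn mu D m z (mu * (D - Q₀) * max z 1) (mu * Q₁ * max m 1)
    (cn * D * max m 1 * max z 1) P₁ := ⟨_, rfl⟩
  rw [boxOk, ← hA, ← hB] at hok
  rw [← hA] at h1
  rw [← hB] at h2
  have h3 : (A : ℝ) * ((max z 1 ^ k : ℕ) : ℝ) + B * ((max w 1 ^ k : ℕ) : ℝ) ≤ bn := by
    rw [← Nat.cast_mul, ← Nat.cast_mul, ← Nat.cast_add]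
    exact Nat.cast_le.2 (Nat.le_of_ble_eq_true hok)
  refine le_trans (le_of_eq ?_) ((add_le_add
    (mul_le_mul_of_nonneg_right h1 (Nat.cast_nonneg (max z 1 ^ k)))
    (mul_le_mul_of_nonneg_right h2 (Nat.cast_nonneg (max w 1 ^ k)))).trans h3)
  obtain ⟨M, hM⟩ : ∃ M : ℕ, M = max m 1 := ⟨_, rfl⟩
  obtain ⟨V, hV⟩ : ∃ V : ℕ, V = max w 1 := ⟨_, rfl⟩
  obtain ⟨Y, hY⟩ : ∃ Y : ℕ, Y = max z 1 := ⟨_, rfl⟩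
  obtain ⟨e, he⟩ : ∃ e : ℕ, e = mu + r * cn := ⟨_, rfl⟩
  rw [← hM, ← hV, ← hY, ← he]
  push_cast
  simp only [mul_pow]
  ring

lemma mixedFam_add_le_of_search {k r cn mu D z w m bn : ℕ} (hD : 0 < D) (hmu : 0 < mu)
    {c μ α β γ δ : ℝ} (hc : c = cn / ((mu + r * cn : ℕ) : ℝ))
    (hμ : μ = mu / ((mu + r * cn : ℕ) : ℝ)) (hα : 0 ≤ α) (hβ : 0 ≤ β) (hγ : 0 ≤ γ) (hδ : 0 ≤ δ)
    (hp : m * α + w * γ = μ) (hq : m * β + z * δ = μ) (n : ℕ) {P₀ P₁ Q₀ Q₁ : ℕ}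
    (hok : search k r cn mu D z w m bn n P₀ P₁ Q₀ Q₁ = true)
    (hP0 : P₀ ≤ D) (hP1 : P₁ ≤ D) (hQ0 : Q₀ ≤ D) (hQ1 : Q₁ ≤ D)
    (p0 : μ * P₀ ≤ D * (w * γ)) (p1 : D * (w * γ) ≤ μ * P₁)
    (q0 : μ * Q₀ ≤ D * (z * δ)) (q1 : D * (z * δ) ≤ μ * Q₁) :
    (mixedFam k r c m z w α γ β δ + mixedFam k r c m w z β δ α γ)
      * (((mu + r * cn) * D * ((mu + r * cn) * D * max m 1 * max w 1 * max z 1) ^ k : ℕ) : ℝ)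
      ≤ bn := by
  induction n generalizing P₀ P₁ Q₀ Q₁ with
  | zero => simp [search] at hok
  | succ n ih =>
    rw [search] at hok
    cases hb : boxOk k r cn mu D z w m bn P₀ P₁ Q₀ Q₁ with
    | true =>
      exact mixedFam_add_le_of_boxOk hD hmu hP0 hP1 hQ0 hQ1 hc hμ hα hβ hγ hδ hp hq hb p0 p1 q0 q1
    | false =>
      rw [hb, cond_false] at hok
      cases hs : Nat.ble (P₁ - P₀) (Q₁ - Q₀) with
      | true =>
        rw [hs, cond_true, Bool.and_eq_true] at hok
        have hm : (Q₀ + Q₁) / 2 ≤ D := by omega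
        rcases le_total (D * (z * δ)) (μ * ((Q₀ + Q₁) / 2 : ℕ)) with h | h
        · exact ih hok.1 hP0 hP1 hQ0 hm p0 p1 q0 h
        · exact ih hok.2 hP0 hP1 hm hQ1 p0 p1 h q1
      | false =>
        rw [hs, cond_false, Bool.and_eq_true] at hok
        have hm : (P₀ + P₁) / 2 ≤ D := by omega
        rcases le_total (D * (w * γ)) (μ * ((P₀ + P₁) / 2 : ℕ)) with h | h
        · exact ih hok.1 hP0 hm hQ0 hQ1 p0 h q0 q1
        · exact ih hok.2 hm hP1 hQ0 hQ1 h p1 q0 q1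

lemma mixedFam_add_le_of_famOk {k r cn mu D cap num den n z w m : ℕ} (hD : 0 < D) (hmu : 0 < mu)
    (hden : 0 < den) (hm : m + z + w = n)
    {c μ α β γ δ : ℝ} (hc : c = cn / ((mu + r * cn : ℕ) : ℝ))
    (hμ : μ = mu / ((mu + r * cn : ℕ) : ℝ)) (hα : 0 ≤ α) (hβ : 0 ≤ β) (hγ : 0 ≤ γ) (hδ : 0 ≤ δ)
    (hp : m * α + w * γ = μ) (hq : m * β + z * δ = μ)
    (cα : m = 0 ∨ D * α ≤ cap * μ) (cβ : m = 0 ∨ D * β ≤ cap * μ)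
    (cγ : w = 0 ∨ D * γ ≤ cap * μ) (cδ : z = 0 ∨ D * δ ≤ cap * μ)
    (hok : famOk k r cn mu D cap num den n z w = true) :
    mixedFam k r c m z w α γ β δ + mixedFam k r c m w z β δ α γ ≤ num / den := by
  have hDr : (0 : ℝ) < D := by exact_mod_cast hD
  have he0 : (0 : ℝ) < ((mu + r * cn : ℕ) : ℝ) := by exact_mod_cast Nat.add_pos_left hmu _
  have hμ0 : 0 < μ := by rw [hμ]; have : (0 : ℝ) < mu := by exact_mod_cast hmu
                         positivity
  have hmul : ∀ {l : ℕ} {x : ℝ}, (l = 0 ∨ D * x ≤ cap * μ) → D * (l * x) ≤ (l * cap : ℕ) * μ := by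
    intro l x h
    rcases h with rfl | h
    · simp
    · have := mul_le_mul_of_nonneg_left h (Nat.cast_nonneg (α := ℝ) l)
      push_cast; linarith
  have hcap : ∀ {l l' : ℕ} {x y : ℝ}, (l = 0 ∨ D * x ≤ cap * μ) → (l' = 0 ∨ D * y ≤ cap * μ) →
      l * x + l' * y = μ → ¬ (l + l') * cap < D := by
    intro l l' x y h h' hs hlt
    have hlt' : (((l + l') * cap : ℕ) : ℝ) < D := by exact_mod_cast hlt
    have h1 := hmul h
    have h2 := hmul h'
    have h3 : D * μ ≤ ((l + l') * cap : ℕ) * μ := by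
      rw [← hs] at h1 h2 ⊢; push_cast at h1 h2 ⊢; linarith
    have h4 := mul_lt_mul_of_pos_right hlt' hμ0
    linarith
  have e1 : n - z = m + w := by omega
  have e2 : n - w = m + z := by omega
  have e3 : m + w - w = m := by omega
  rw [famOk, e1, e2, e3, Bool.or_eq_true, Bool.or_eq_true] at hok
  rcases hok with (hok | hok) | hok
  · exact absurd (Nat.le_of_ble_eq_true hok) (hcap cα cγ hp)
  · exact absurd (Nat.le_of_ble_eq_true hok) (hcap cβ cδ hq)
  have low : ∀ {l : ℕ} {x y : ℝ}, m * x + l * y = μ → 0 ≤ y →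
      μ * ((if m = 0 then D else 0 : ℕ) : ℝ) ≤ D * (l * y) := by
    intro l x y h hy
    split_ifs with hm0
    · rw [hm0] at h
      simp only [Nat.cast_zero, zero_mul, zero_add] at h
      rw [h]; linarith
    · simp only [Nat.cast_zero, mul_zero]; positivity
  have up : ∀ {l : ℕ} {x y : ℝ}, m * x + l * y = μ → 0 ≤ x → (l = 0 ∨ D * y ≤ cap * μ) →
      D * (l * y) ≤ μ * ((min (l * cap) D : ℕ) : ℝ) := by
    intro l x y h hx hy
    rcases min_choice (l * cap) D with hmin | hmin
    · rw [hmin]; have := hmul hy; linarith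
    · rw [hmin]
      have hmx : 0 ≤ m * x := by positivity
      have : D * (l * y) ≤ D * μ := mul_le_mul_of_nonneg_left (by linarith) hDr.le
      linarith
  have h01 : (if m = 0 then D else 0 : ℕ) ≤ D := by split_ifs <;> omega
  have := mixedFam_add_le_of_search hD hmu hc hμ hα hβ hγ hδ hp hq 60 hok h01 (min_le_right _ _)
    h01 (min_le_right _ _) (low hp hγ) (up hp hα cγ) (low hq hδ) (up hq hβ cδ)
  obtain ⟨E, hE⟩ : ∃ E : ℕ, E = (mu + r * cn) * D
      * ((mu + r * cn) * D * max m 1 * max w 1 * max z 1) ^ k := ⟨_, rfl⟩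
  have hE0 : (0 : ℝ) < E := by
    have : 0 < E := by
      have h1 : 0 < mu + r * cn := Nat.add_pos_left hmu _
      have h2 : 0 < max m 1 := Nat.lt_of_lt_of_le one_pos (le_max_right _ _)
      have h3 : 0 < max w 1 := Nat.lt_of_lt_of_le one_pos (le_max_right _ _)
      have h4 : 0 < max z 1 := Nat.lt_of_lt_of_le one_pos (le_max_right _ _)
      rw [hE]; positivity
    exact_mod_cast this
  rw [← hE] at this
  have hdiv : ((num * E / den : ℕ) : ℝ) ≤ (num * E : ℕ) / den := Nat.cast_div_le
  have hden' : (0 : ℝ) < den := by exact_mod_cast hden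
  have h5 := this.trans hdiv
  rw [← mul_le_mul_iff_left₀ hE0]
  refine h5.trans (le_of_eq ?_)
  push_cast; ring

lemma famOk_of_allFamOk {k r cn mu D cap num den n z w : ℕ}
    (h : allFamOk k r cn mu D cap num den n = true) (hz : 1 ≤ z) (hw : w ≤ z) (hn : z + w ≤ n) :
    famOk k r cn mu D cap num den n z w = true := by
  rw [allFamOk, List.all_eq_true] at h
  have h1 := h (z - 1) (List.mem_range.2 (by omega))
  rw [List.all_eq_true] at h1
  have h2 := h1 w (List.mem_range.2 (by omega))
  rw [Nat.sub_add_cancel hz, Bool.or_eq_true] at h2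
  rcases h2 with h2 | h2
  · exact absurd (Nat.le_of_ble_eq_true h2) (by omega)
  · exact h2

/-- The verified bound holds for all families with some coordinate `(0, δ)` or `(γ, 0)`. -/
lemma mixedFam_add_le_of_allFamOk {k r cn mu D cap num den n z w m : ℕ} (hD : 0 < D) (hmu : 0 < mu)
    (hden : 0 < den) (hm : m + z + w = n) (hzw : z ≠ 0 ∨ w ≠ 0)
    {c μ α β γ δ : ℝ} (hc : c = cn / ((mu + r * cn : ℕ) : ℝ))
    (hμ : μ = mu / ((mu + r * cn : ℕ) : ℝ)) (hα : 0 ≤ α) (hβ : 0 ≤ β) (hγ : 0 ≤ γ) (hδ : 0 ≤ δ)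
    (hp : m * α + w * γ = μ) (hq : m * β + z * δ = μ)
    (cα : m = 0 ∨ D * α ≤ cap * μ) (cβ : m = 0 ∨ D * β ≤ cap * μ)
    (cγ : w = 0 ∨ D * γ ≤ cap * μ) (cδ : z = 0 ∨ D * δ ≤ cap * μ)
    (hok : allFamOk k r cn mu D cap num den n = true) :
    mixedFam k r c m z w α γ β δ + mixedFam k r c m w z β δ α γ ≤ num / den := by
  rcases le_total w z with h | h
  · exact mixedFam_add_le_of_famOk hD hmu hden hm hc hμ hα hβ hγ hδ hp hq cα cβ cγ cδ
      (famOk_of_allFamOk hok (by omega) h (by omega))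
  · rw [add_comm]
    exact mixedFam_add_le_of_famOk hD hmu hden (by omega) hc hμ hβ hα hδ hγ hq hp cβ cα cδ cγ
      (famOk_of_allFamOk hok (by omega) h (by omega))

end Soundness

/-! ### Pairs satisfying the dichotomy -/

section FamilyBound

variable {ι : Type*} [Fintype ι] [DecidableEq ι]

/-- A pair with constant value `(c, c)` on `R` that satisfies the dichotomy outside `R` is constant
outside `R`, or a member of one of the families covered by the verified bound. Here `c` and the mass
`μ` outside `R` are rational, and no coordinate outside `R` exceeds `cap / D` times `μ`. -/
lemma Dichotomy.const_or_fsum_le {k r cn mu D cap num den : ℕ} (hD : 0 < D) (hmu : 0 < mu)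
    (hden : 0 < den) {R : Finset ι} {p q : ι → ℝ} {c μ : ℝ} (hr : R.card = r)
    (hc : c = cn / ((mu + r * cn : ℕ) : ℝ)) (hμ : μ = mu / ((mu + r * cn : ℕ) : ℝ))
    (hp : p ∈ stdSimplex ℝ ι) (hq : q ∈ stdSimplex ℝ ι) (hR : ∀ i ∈ R, p i = c ∧ q i = c)
    (hcap : ∀ i, i ∉ R → D * p i ≤ cap * μ ∧ D * q i ≤ cap * μ) (h : Dichotomy Rᶜ p q)
    (hok : allFamOk k r cn mu D cap num den Rᶜ.card = true) :
    (∃ α β : ℝ, ∀ i ∈ Rᶜ, p i = α ∧ q i = β) ∨ fsum k p q ≤ num / den := by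
  have he0 : (0 : ℝ) < ((mu + r * cn : ℕ) : ℝ) := by exact_mod_cast Nat.add_pos_left hmu _
  have hμ0 : 0 < μ := by
    rw [hμ]; have : (0 : ℝ) < mu := by exact_mod_cast hmu
    positivity
  have hrc : r * c + μ = 1 := by
    rw [hc, hμ]; field_simp; push_cast; ring
  have sumR : ∀ f : ι → ℝ, f ∈ stdSimplex ℝ ι → (∀ i ∈ R, f i = c) → ∑ i ∈ Rᶜ, f i = μ := by
    intro f hf hfR
    have h1 := Finset.sum_add_sum_compl R f
    rw [hf.2, Finset.sum_congr rfl hfR, Finset.sum_const, nsmul_eq_mul, hr] at h1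
    linarith
  have sp := sumR p hp fun i hi => (hR i hi).1
  have sq := sumR q hq fun i hi => (hR i hi).2
  rcases h.families (fun i _ => hp.1 i) (fun i _ => hq.1 i) (by rw [sp]; exact hμ0) with h | h
  · exact Or.inl h
  obtain ⟨Z, W, I, α, γ, β, δ, hd1, hd2, hU, hZ, hW, hI, hne⟩ := h
  right
  have hdR : Disjoint R (Z ∪ (W ∪ I)) := by rw [hU]; exact disjoint_compl_right
  have hu : R ∪ (Z ∪ (W ∪ I)) = Finset.univ := by rw [hU]; exact Finset.union_compl R
  have hcomm : W ∪ (Z ∪ I) = Z ∪ (W ∪ I) := Finset.union_left_comm W Z I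
  have hd1' : Disjoint W (Z ∪ I) := Finset.disjoint_union_right.2
    ⟨(Finset.disjoint_union_right.1 hd1).1.symm, hd2⟩
  have hd2' : Disjoint Z I := (Finset.disjoint_union_right.1 hd1).2
  have e1 := mixed_eq_mixedFam hdR hd1 hd2 hu hR hZ hW hI k
  have e2 := mixed_eq_mixedFam (R := R) (Z := W) (W := Z) (I := I) (p := q) (q := p)
    (by rw [hcomm]; exact hdR) hd1' hd2' (by rw [hcomm]; exact hu) (fun i hi => (hR i hi).symm)
    (fun i hi => (hW i hi).symm) (fun i hi => (hZ i hi).symm) (fun i hi => (hI i hi).symm) k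
  rw [fsum, e1, e2, hr]
  have sums : ∀ f : ι → ℝ, ∑ i ∈ Rᶜ, f i = ∑ i ∈ Z, f i + (∑ i ∈ W, f i + ∑ i ∈ I, f i) := by
    intro f; rw [← hU, Finset.sum_union hd1, Finset.sum_union hd2]
  have hcard : I.card + Z.card + W.card = Rᶜ.card := by
    rw [← hU, Finset.card_union_of_disjoint hd1, Finset.card_union_of_disjoint hd2]; ring
  have cst : ∀ {S : Finset ι} {f : ι → ℝ} {x : ℝ}, (∀ i ∈ S, f i = x) →
      ∑ i ∈ S, f i = S.card * x := by
    intro S f x hf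
    rw [Finset.sum_congr rfl hf, Finset.sum_const, nsmul_eq_mul]
  have hpsum : I.card * α + W.card * γ = μ := by
    rw [← sp, sums, cst fun i hi => (hZ i hi).1, cst fun i hi => (hW i hi).1,
      cst fun i hi => (hI i hi).1]; ring
  have hqsum : I.card * β + Z.card * δ = μ := by
    rw [← sq, sums, cst fun i hi => (hZ i hi).2, cst fun i hi => (hW i hi).2,
      cst fun i hi => (hI i hi).2]; ring
  have hnotR : ∀ i ∈ Z ∪ (W ∪ I), i ∉ R := fun i hi hiR => Finset.disjoint_left.1 hdR hiR hi
  -- values on empty classes are irrelevant, and are replaced by `0`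
  have val : ∀ {S : Finset ι} {f : ι → ℝ} {x : ℝ}, (∀ i, 0 ≤ f i) → (∀ i, i ∉ R → D * f i ≤ cap * μ) →
      S ⊆ Z ∪ (W ∪ I) → (∀ i ∈ S, f i = x) → S.card = 0 ∨ (0 ≤ x ∧ D * x ≤ cap * μ) := by
    intro S f x h0 h1 hS hx
    rcases S.eq_empty_or_nonempty with rfl | ⟨i, hi⟩
    · left; rfl
    · right; rw [← hx i hi]; exact ⟨h0 i, h1 i (hnotR i (hS hi))⟩
  have hZs : Z ⊆ Z ∪ (W ∪ I) := Finset.subset_union_left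
  have hWs : W ⊆ Z ∪ (W ∪ I) := Finset.subset_union_left.trans Finset.subset_union_right
  have hIs : I ⊆ Z ∪ (W ∪ I) := Finset.subset_union_right.trans Finset.subset_union_right
  have vα := val hp.1 (fun i hi => (hcap i hi).1) hIs fun i hi => (hI i hi).1
  have vβ := val hq.1 (fun i hi => (hcap i hi).2) hIs fun i hi => (hI i hi).2
  have vγ := val hp.1 (fun i hi => (hcap i hi).1) hWs fun i hi => (hW i hi).1
  have vδ := val hq.1 (fun i hi => (hcap i hi).2) hZs fun i hi => (hZ i hi).2
  have fix : ∀ {m : ℕ} {x : ℝ}, (m = 0 ∨ (0 ≤ x ∧ D * x ≤ cap * μ)) →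
      ∃ y, 0 ≤ y ∧ (m = 0 ∨ D * y ≤ cap * μ) ∧ (m = 0 ∨ x = y) := by
    intro m x h
    rcases h with h | h
    · exact ⟨0, le_rfl, Or.inl h, Or.inl h⟩
    · exact ⟨x, h.1, Or.inr h.2, Or.inr rfl⟩
  obtain ⟨α', a1, a2, a3⟩ := fix vα
  obtain ⟨β', b1, b2, b3⟩ := fix vβ
  obtain ⟨γ', g1, g2, g3⟩ := fix vγ
  obtain ⟨δ', d1, d2, d3⟩ := fix vδ
  have mul_fix : ∀ {m : ℕ} {x y : ℝ}, (m = 0 ∨ x = y) → (m : ℝ) * x = m * y := by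
    rintro m x y (rfl | rfl) <;> simp
  have pow_fix : ∀ {m : ℕ} {x y : ℝ}, (m = 0 ∨ x = y) → ∀ l ≤ m,
      (1 + Polynomial.C x * Polynomial.X) ^ l = (1 + Polynomial.C y * Polynomial.X) ^ l := by
    rintro m x y (rfl | rfl) l hl
    · rw [Nat.le_zero.1 hl, pow_zero, pow_zero]
    · rfl
  have e3 : ∀ s, ∀ l ≤ I.card, esym3 k s c l α W.card γ = esym3 k s c l α' W.card γ' := by
    intro s l hl
    unfold esym3
    rw [pow_fix a3 l hl, pow_fix g3 _ le_rfl]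
  have e4 : ∀ s, ∀ l ≤ I.card, esym3 k s c l β Z.card δ = esym3 k s c l β' Z.card δ' := by
    intro s l hl
    unfold esym3
    rw [pow_fix b3 l hl, pow_fix d3 _ le_rfl]
  have e5 : mixedFam k r c I.card Z.card W.card α γ β δ
      = mixedFam k r c I.card Z.card W.card α' γ' β' δ' := by
    unfold mixedFam
    rw [e3 _ _ le_rfl, e3 _ _ le_rfl, e3 _ _ (Nat.sub_le _ _), mul_fix d3, mul_fix b3]
  have e6 : mixedFam k r c I.card W.card Z.card β δ α γ
      = mixedFam k r c I.card W.card Z.card β' δ' α' γ' := by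
    unfold mixedFam
    rw [e4 _ _ le_rfl, e4 _ _ le_rfl, e4 _ _ (Nat.sub_le _ _), mul_fix g3, mul_fix a3]
  rw [e5, e6]
  refine mixedFam_add_le_of_allFamOk hD hmu hden hcard ?_ hc hμ a1 b1 g1 d1 ?_ ?_ a2 b2 g2 d2 hok
  · exact hne.imp (fun h => h.card_pos.ne') fun h => h.card_pos.ne'
  · rw [← hpsum, mul_fix a3, mul_fix g3]
  · rw [← hqsum, mul_fix b3, mul_fix d3]

end FamilyBound

section Bounds

variable {ι : Type*} [Fintype ι] [DecidableEq ι]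

lemma mixed_nonneg {k : ℕ} {p q : ι → ℝ} (hp : ∀ i, 0 ≤ p i) (hq : ∀ i, 0 ≤ q i) :
    0 ≤ mixed k p q :=
  Finset.sum_nonneg fun i _ => mul_nonneg (hq i) (esym_nonneg fun j _ => hp j)

lemma mixed_le_esym_univ {k : ℕ} {p q : ι → ℝ} (hp : ∀ i, 0 ≤ p i) (hq : q ∈ stdSimplex ℝ ι) :
    mixed k p q ≤ esym Finset.univ k p := by
  calc mixed k p q ≤ ∑ i, q i * esym Finset.univ k p :=
        Finset.sum_le_sum fun i _ => mul_le_mul_of_nonneg_left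
          (esym_mono_set (Finset.erase_subset _ _) fun j _ => hp j) (hq.1 i)
    _ = esym Finset.univ k p := by rw [← Finset.sum_mul, hq.2, one_mul]

lemma sum_erase_of_simplex {p : ι → ℝ} (hp : p ∈ stdSimplex ℝ ι) (i : ι) :
    ∑ j ∈ Finset.univ.erase i, p j = 1 - p i := by
  have := Finset.add_sum_erase Finset.univ p (Finset.mem_univ i)
  rw [hp.2] at this; linarith

lemma card_erase_univ (i : ι) : (Finset.univ.erase i).card = Fintype.card ι - 1 := by
  rw [Finset.card_erase_of_mem (Finset.mem_univ i), Finset.card_univ]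

/-- The value of `e_k` at the uniform distribution on `n` points. -/
noncomputable def unifEsym (n k : ℕ) : ℝ := (n.choose k : ℝ) / (n : ℝ) ^ k

lemma unifEsym_nonneg (n k : ℕ) : 0 ≤ unifEsym n k := by unfold unifEsym; positivity

omit [Fintype ι] in
lemma esym_le_unifEsym {S : Finset ι} {n : ℕ} (hS : S.card = n) (hn : 0 < n) (k : ℕ) {p : ι → ℝ}
    (hp : ∀ i ∈ S, 0 ≤ p i) : esym S k p ≤ unifEsym n k * (∑ i ∈ S, p i) ^ k := by
  have := esym_le S (Finset.card_pos.1 (hS ▸ hn)) k hp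
  rwa [hS] at this

/-- If one probability is `1 - s`, then `e_k` is small of order `s^(k-1)`. -/
lemma esym_univ_le {p : ι → ℝ} (hp : p ∈ stdSimplex ℝ ι) (i : ι) {n : ℕ}
    (hn : Fintype.card ι = n + 1) (hn0 : 0 < n) (k : ℕ) :
    esym Finset.univ (k + 1) p ≤ unifEsym n (k + 1) * (1 - p i) ^ (k + 1)
      + p i * (unifEsym n k * (1 - p i) ^ k) := by
  rw [esym_erase_succ (Finset.mem_univ i)]
  have hc : (Finset.univ.erase i).card = n := by rw [card_erase_univ, hn]; rfl
  have h1 := esym_le_unifEsym hc hn0 (k + 1) fun j _ => hp.1 j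
  have h2 := esym_le_unifEsym hc hn0 k fun j _ => hp.1 j
  rw [sum_erase_of_simplex hp] at h1 h2
  exact add_le_add h1 (mul_le_mul_of_nonneg_left h2 (hp.1 i))

end Bounds

/-! ### Splitting off one coordinate, and the chord bound -/

section MixedOn

variable {ι : Type*} [DecidableEq ι]

/-- The analogue of `mixed` with all coordinates restricted to `S`. -/
noncomputable def mixedOn (S : Finset ι) (k : ℕ) (p q : ι → ℝ) : ℝ :=
  ∑ a ∈ S, q a * esym (S.erase a) k p

lemma mixedOn_univ [Fintype ι] (k : ℕ) (p q : ι → ℝ) : mixedOn Finset.univ k p q = mixed k p q :=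
  rfl

lemma mixedOn_succ {S : Finset ι} {i : ι} (hi : i ∈ S) (k : ℕ) (p q : ι → ℝ) :
    mixedOn S (k + 1) p q = q i * esym (S.erase i) (k + 1) p + mixedOn (S.erase i) (k + 1) p q
      + p i * mixedOn (S.erase i) k p q := by
  unfold mixedOn
  rw [← Finset.add_sum_erase _ _ hi, add_assoc, Finset.mul_sum, ← Finset.sum_add_distrib]
  congr 1
  refine Finset.sum_congr rfl fun a ha => ?_
  have : i ∈ S.erase a := Finset.mem_erase.2 ⟨(Finset.ne_of_mem_erase ha).symm, hi⟩
  rw [esym_erase_succ this, Finset.erase_right_comm]; ring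

lemma mixedOn_nonneg {S : Finset ι} {k : ℕ} {p q : ι → ℝ} (hp : ∀ i ∈ S, 0 ≤ p i)
    (hq : ∀ i ∈ S, 0 ≤ q i) : 0 ≤ mixedOn S k p q :=
  Finset.sum_nonneg fun i hi => mul_nonneg (hq i hi)
    (esym_nonneg fun j hj => hp j (Finset.mem_of_mem_erase hj))

omit [DecidableEq ι] in
lemma esym_of_eq_mul {S : Finset ι} {p p' : ι → ℝ} {c : ℝ} (h : ∀ a ∈ S, p a = c * p' a) (k : ℕ) :
    esym S k p = c ^ k * esym S k p' := by
  rw [← esym_smul]; exact esym_congr h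

lemma mixedOn_of_eq_mul {S : Finset ι} {p p' : ι → ℝ} {c : ℝ} (h : ∀ a ∈ S, p a = c * p' a) (k : ℕ)
    (q : ι → ℝ) : mixedOn S k p q = c ^ k * mixedOn S k p' q := by
  unfold mixedOn
  rw [Finset.mul_sum]
  refine Finset.sum_congr rfl fun a _ => ?_
  rw [esym_of_eq_mul fun b hb => h b (Finset.mem_of_mem_erase hb)]; ring

lemma mixedOn_of_const {S : Finset ι} {n : ℕ} (hS : S.card = n + 1) {p q : ι → ℝ} {α β : ℝ}
    (h : ∀ a ∈ S, p a = α ∧ q a = β) (k : ℕ) :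
    mixedOn S k p q = (n + 1) * β * (n.choose k * α ^ k) := by
  have : ∀ a ∈ S, q a * esym (S.erase a) k p = β * (n.choose k * α ^ k) := by
    intro a ha
    rw [(h a ha).2, esym_of_const fun b hb => (h b (Finset.mem_of_mem_erase hb)).1,
      Finset.card_erase_of_mem ha, hS, Nat.add_sub_cancel]
  rw [mixedOn, Finset.sum_congr rfl this, Finset.sum_const, hS, nsmul_eq_mul]
  push_cast; ring

/-- Maclaurin's inequality, applied to each term. -/
lemma mixedOn_le {S : Finset ι} {n : ℕ} (hS : S.card = n + 1) (hn : 0 < n) (k : ℕ) {p q : ι → ℝ}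
    (hp : ∀ i ∈ S, 0 ≤ p i) (hq : ∀ i ∈ S, 0 ≤ q i) :
    mixedOn S k p q ≤ (∑ i ∈ S, q i) * (unifEsym n k * (∑ i ∈ S, p i) ^ k) := by
  rw [Finset.sum_mul]
  refine Finset.sum_le_sum fun a ha => mul_le_mul_of_nonneg_left ?_ (hq a ha)
  have hc : (S.erase a).card = n := by rw [Finset.card_erase_of_mem ha, hS, Nat.add_sub_cancel]
  refine (esym_le_unifEsym hc hn k fun i hi => hp i (Finset.mem_of_mem_erase hi)).trans ?_
  refine mul_le_mul_of_nonneg_left (pow_le_pow_left₀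
    (Finset.sum_nonneg fun i hi => hp i (Finset.mem_of_mem_erase hi)) ?_ k) (unifEsym_nonneg n k)
  exact Finset.sum_le_sum_of_subset_of_nonneg (Finset.erase_subset _ _) fun i hi _ => hp i hi

variable [Fintype ι]

lemma mixed_succ (i : ι) (k : ℕ) (p q : ι → ℝ) :
    mixed (k + 1) p q = q i * esym (Finset.univ.erase i) (k + 1) p
      + mixedOn (Finset.univ.erase i) (k + 1) p q + p i * mixedOn (Finset.univ.erase i) k p q :=
  mixedOn_succ (Finset.mem_univ i) k p q

/-- `mixed` is linear in its second argument; here along a segment that starts in a point mass. -/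
lemma mixed_eq_of_segment {i : ι} {p q q' : ι → ℝ} {τ : ℝ} (hi : q i = (1 - τ) + τ * q' i)
    (hq : ∀ a, a ≠ i → q a = τ * q' a) (k : ℕ) :
    mixed k p q = (1 - τ) * esym (Finset.univ.erase i) k p + τ * mixed k p q' := by
  unfold mixed
  rw [← Finset.add_sum_erase _ _ (Finset.mem_univ i),
    ← Finset.add_sum_erase (a := i) _ (fun a => q' a * _) (Finset.mem_univ i), hi, mul_add,
    Finset.mul_sum, Finset.sum_congr rfl fun a ha => by rw [hq a (Finset.ne_of_mem_erase ha), mul_assoc]]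
  ring

lemma fsum_of_const {n : ℕ} (hn : Fintype.card ι = n + 1) {p q : ι → ℝ} {α β : ℝ}
    (h : ∀ a, p a = α ∧ q a = β) (k : ℕ) :
    fsum k p q = (n + 1) * β * (n.choose k * α ^ k) + (n + 1) * α * (n.choose k * β ^ k) := by
  have hc : (Finset.univ : Finset ι).card = n + 1 := by rw [Finset.card_univ, hn]
  rw [fsum, ← mixedOn_univ, ← mixedOn_univ, mixedOn_of_const hc (fun a _ => h a),
    mixedOn_of_const hc (fun a _ => (h a).symm)]

end MixedOn

section Chord

variable {ι : Type*} [DecidableEq ι] [Fintype ι]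

/-- A vector whose `i`-th coordinate is at least `1 - ε` lies on the segment from the point mass at
`i` to a vector whose `i`-th coordinate is `1 - ε`. -/
lemma exists_segment (h1 : 1 < Fintype.card ι) {q : ι → ℝ} (hq : q ∈ stdSimplex ℝ ι) {ε : ℝ}
    (hε0 : 0 < ε) (hε1 : ε ≤ 1) {i : ι} (hi : 1 - ε ≤ q i) :
    ∃ q' ∈ stdSimplex ℝ ι, ∃ τ : ℝ, 0 ≤ τ ∧ τ ≤ 1 ∧ q' i = 1 - ε ∧ q i = (1 - τ) + τ * q' i ∧
      ∀ a, a ≠ i → q a = τ * q' a := by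
  have hs := sum_erase_of_simplex hq i
  have hsum : ∀ q' : ι → ℝ, q' i = 1 - ε → ∑ a ∈ Finset.univ.erase i, q' a = ε → ∑ a, q' a = 1 := by
    intro q' h1 h2
    rw [← Finset.add_sum_erase _ _ (Finset.mem_univ i), h1, h2]; ring
  rcases (show q i ≤ 1 by
    have := Finset.sum_nonneg fun a (_ : a ∈ Finset.univ.erase i) => hq.1 a
    linarith).eq_or_lt with h | h
  · -- `q` is the point mass at `i`, so that the other end of the segment is arbitrary
    obtain ⟨c, hc⟩ : ∃ c, c ≠ i := Fintype.exists_ne_of_one_lt_card h1 i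
    refine ⟨fun a => if a = i then 1 - ε else if a = c then ε else 0, ⟨fun a => ?_, ?_⟩, 0, le_rfl,
      zero_le_one, by simp, by simp [h], fun a ha => ?_⟩
    · dsimp only; split_ifs <;> linarith
    · refine hsum _ (by simp) ?_
      rw [Finset.sum_congr rfl (g := fun a => if a = c then ε else 0)
        fun a ha => by simp [Finset.ne_of_mem_erase ha]]
      simp [hc]
    · rw [h, sub_self, Finset.sum_eq_zero_iff_of_nonneg fun a _ => hq.1 a] at hs
      simp [hs a (by simp [ha])]
  · have hs0 : 0 < 1 - q i := by linarith
    refine ⟨fun a => if a = i then 1 - ε else ε / (1 - q i) * q a, ⟨fun a => ?_, ?_⟩,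
      (1 - q i) / ε, by positivity, (div_le_one hε0).2 (by linarith), by simp, ?_, fun a ha => ?_⟩
    · dsimp only; split_ifs
      · linarith
      · exact mul_nonneg (by positivity) (hq.1 a)
    · refine hsum _ (by simp) ?_
      rw [Finset.sum_congr rfl (g := fun a => ε / (1 - q i) * q a)
        fun a ha => by simp [Finset.ne_of_mem_erase ha], ← Finset.mul_sum, hs]
      field_simp
    · simp only [if_true]; field_simp; ring
    · simp only [ha, if_false]; field_simp

/-- Along a segment that starts in a point mass, `fsum` stays below its chord. In `fsum k p q` one
summand is linear in `q`. In the other one, the coordinates of `q` off `i` enter in degree `k` or in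
degree `k - 1` with the factor `q i`; both vanish at the point mass and are at most linear in `τ`. -/
lemma fsum_le_chord {k : ℕ} (hk : 1 ≤ k) {p q q' : ι → ℝ} (hp : ∀ a, 0 ≤ p a) (hq' : ∀ a, 0 ≤ q' a)
    {ε τ : ℝ} (hε : ε ≤ 1 / 2) (h0 : 0 ≤ τ) (h1 : τ ≤ 1) {i : ι} (hi' : q' i = 1 - ε)
    (hi : q i = (1 - τ) + τ * q' i) (hq : ∀ a, a ≠ i → q a = τ * q' a) :
    fsum (k + 2) p q
      ≤ (1 - τ) * esym (Finset.univ.erase i) (k + 2) p + τ * fsum (k + 2) p q' := by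
  have hS : ∀ a ∈ Finset.univ.erase i, q a = τ * q' a := fun a ha => hq a (Finset.ne_of_mem_erase ha)
  have e1 := mixed_eq_of_segment (p := p) hi hq (k + 2)
  have e2 : mixed (k + 2) q p ≤ τ * mixed (k + 2) q' p := by
    rw [mixed_succ i, mixed_succ i, esym_of_eq_mul hS, mixedOn_of_eq_mul hS, mixedOn_of_eq_mul hS, hi,
      hi']
    have g1 : 0 ≤ p i * esym (Finset.univ.erase i) (k + 2) q' :=
      mul_nonneg (hp i) (esym_nonneg fun a _ => hq' a)
    have g2 : 0 ≤ mixedOn (Finset.univ.erase i) (k + 2) q' p :=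
      mixedOn_nonneg (fun a _ => hq' a) fun a _ => hp a
    have g3 : 0 ≤ mixedOn (Finset.univ.erase i) (k + 1) q' p :=
      mixedOn_nonneg (fun a _ => hq' a) fun a _ => hp a
    have t1 : τ ^ (k + 2) ≤ τ := pow_le_of_le_one h0 h1 (by omega)
    have t2 : τ ^ k ≤ τ := pow_le_of_le_one h0 h1 (by omega)
    -- `x ↦ x (1 - ε x)` increases on `[0, 1]`, since `ε ≤ 1/2`
    have t3 : (1 - τ * ε) * τ ≤ 1 - ε := by
      have := mul_nonneg (mul_nonneg (sub_nonneg.2 hε) (by linarith : 0 ≤ 1 + τ)) (sub_nonneg.2 h1)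
      nlinarith [sq_nonneg (1 - τ)]
    have t4 : (1 - τ * ε) * τ ^ (k + 1) ≤ τ * (1 - ε) := by
      have : 0 ≤ 1 - τ * ε := by nlinarith
      calc (1 - τ * ε) * τ ^ (k + 1) = τ * ((1 - τ * ε) * τ ^ k) := by ring
        _ ≤ τ * ((1 - τ * ε) * τ) := by gcongr
        _ ≤ τ * (1 - ε) := by gcongr
    have h3 := mul_le_mul_of_nonneg_right t4 g3
    have h4 := mul_le_mul_of_nonneg_right t1 g1
    have h5 := mul_le_mul_of_nonneg_right t1 g2
    have : (1 - τ) + τ * (1 - ε) = 1 - τ * ε := by ring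
    rw [this]
    linarith
  unfold fsum
  rw [e1]; linarith

end Chord

/-! ### Balanced pairs -/

section Balanced

lemma pow_mul_one_add_le_one (k : ℕ) {τ : ℝ} (h0 : 0 ≤ τ) (h1 : τ ≤ 1) :
    (1 - τ) ^ k * (1 + k * τ) ≤ 1 := by
  have h1t : 0 ≤ 1 - τ := by linarith
  calc (1 - τ) ^ k * (1 + k * τ) ≤ (1 - τ) ^ k * (1 + τ) ^ k := by
        gcongr; exact one_add_mul_le_pow (by linarith) k
    _ = ((1 - τ) * (1 + τ)) ^ k := (mul_pow _ _ _).symm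
    _ ≤ 1 := pow_le_one₀ (mul_nonneg h1t (by linarith)) (by nlinarith)

variable {ι : Type*} [DecidableEq ι] [Fintype ι]

/-- An upper bound for `e_k` of a probability vector that has a coordinate `1 - ε`. -/
noncomputable def crudeBound (n k : ℕ) (ε : ℝ) : ℝ :=
  unifEsym n (k + 1) * ε ^ (k + 1) + unifEsym n k * ε ^ k

lemma esym_univ_le_crudeBound {n k : ℕ} (hb : Fintype.card ι = n + 1) (hn : 0 < n) {q : ι → ℝ}
    (hq : q ∈ stdSimplex ℝ ι) {ε : ℝ} (hε : 0 ≤ ε) {i : ι} (hi : q i = 1 - ε) :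
    esym Finset.univ (k + 1) q ≤ crudeBound n k ε := by
  have h := esym_univ_le hq i hb hn k
  rw [hi, sub_sub_cancel] at h
  have h2 : 0 ≤ unifEsym n k * ε ^ k := mul_nonneg (unifEsym_nonneg n k) (pow_nonneg hε k)
  unfold crudeBound
  nlinarith

/-- If `q i = 1 - ε` and `t = p i` is small, the mass `t` of `p` may be distributed over the other
coordinates of `p`, proportionally to their values: if `fsum` is at most `R` for the resulting `π`, it
is so for `p`. -/
lemma fsum_le_of_light_coordinate {k n : ℕ} {ε R t : ℝ} (hb : Fintype.card ι = n + 2) (hn : 0 < n)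
    {p q π : ι → ℝ} (hp : p ∈ stdSimplex ℝ ι) (hq : q ∈ stdSimplex ℝ ι) (hπ : π ∈ stdSimplex ℝ ι)
    {i : ι} (ht0 : 0 ≤ t) (ht : t ≤ 1 / ((n : ℝ) + 2)) (hi : p i = t) (hπi : π i = 0)
    (hpπ : ∀ a, a ≠ i → p a = (1 - t) * π a) (hε0 : 0 ≤ ε) (hqi : q i = 1 - ε)
    (hR : fsum (k + 2) π q ≤ R)
    (hN : ε * unifEsym n (k + 1) * (1 / ((k : ℝ) + 1) + 1 / ((n : ℝ) + 2))
      + crudeBound (n + 1) (k + 1) ε ≤ R) :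
    fsum (k + 2) p q ≤ R := by
  have hk0 : (0 : ℝ) < (k : ℝ) + 1 := by positivity
  have ht1 : t ≤ 1 := ht.trans ((div_le_one (by positivity)).2 (by linarith [n.cast_nonneg (α := ℝ)]))
  have h1t : 0 ≤ 1 - t := by linarith
  have h1t' : 1 - t ≤ 1 := by linarith
  have hcard : (Finset.univ.erase i).card = n + 1 := by rw [card_erase_univ, hb]; rfl
  have hS : ∀ a ∈ Finset.univ.erase i, p a = (1 - t) * π a := fun a ha =>
    hpπ a (Finset.ne_of_mem_erase ha)
  have sq := sum_erase_of_simplex hq i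
  have sπ := sum_erase_of_simplex hπ i
  rw [hqi, sub_sub_cancel] at sq
  rw [hπi, sub_zero] at sπ
  have hE := unifEsym_nonneg n (k + 1)
  obtain ⟨A₁, hA₁⟩ : ∃ x, x = mixedOn (Finset.univ.erase i) (k + 1) π q := ⟨_, rfl⟩
  obtain ⟨A₀, hA₀⟩ : ∃ x, x = mixed (k + 2) π q := ⟨_, rfl⟩
  have e1 : mixed (k + 2) p q = (1 - t) ^ (k + 2) * A₀ + t * ((1 - t) ^ (k + 1) * A₁) := by
    rw [hA₀, hA₁, mixed_succ i, mixed_succ i, esym_of_eq_mul hS, mixedOn_of_eq_mul hS,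
      mixedOn_of_eq_mul hS, hi, hπi]
    ring
  have e2 : mixed (k + 2) q p
      = t * esym (Finset.univ.erase i) (k + 2) q + (1 - t) * mixed (k + 2) q π := by
    rw [mixed_eq_of_segment (i := i) (q' := π) (τ := 1 - t) (by rw [hi, hπi]; ring) hpπ,
      sub_sub_cancel]
  have a1 : 0 ≤ A₁ := by rw [hA₁]; exact mixedOn_nonneg (fun a _ => hπ.1 a) fun a _ => hq.1 a
  have a0 : 0 ≤ A₀ := by rw [hA₀]; exact mixed_nonneg hπ.1 hq.1
  have bA : A₁ ≤ ε * unifEsym n (k + 1) := by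
    have := mixedOn_le hcard hn (k + 1) (fun a _ => hπ.1 a) fun a _ => hq.1 a
    rwa [sq, sπ, one_pow, mul_one, ← hA₁] at this
  have hcr := esym_univ_le_crudeBound (k := k + 1) hb n.succ_pos hq hε0 hqi
  have hKR : 0 ≤ ε * unifEsym n (k + 1) * (1 / ((k : ℝ) + 1) + 1 / ((n : ℝ) + 2)) := by positivity
  -- `mixed p q` is a polynomial in `t` with coefficients `A₀`, `A₁`; it decreases at least linearly
  -- unless `A₀` is small compared with `A₁`, and then `mixed p q` is small anyway
  rcases le_or_gt A₁ ((k + 1) * A₀) with h | h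
  · have be : esym (Finset.univ.erase i) (k + 2) q ≤ R :=
      (esym_mono_set (Finset.erase_subset _ _) fun a _ => hq.1 a).trans (by linarith)
    have bern := pow_mul_one_add_le_one k ht0 ht1
    have c1 : mixed (k + 2) p q ≤ (1 - t) * A₀ := by
      rw [e1]
      calc (1 - t) ^ (k + 2) * A₀ + t * ((1 - t) ^ (k + 1) * A₁)
          ≤ (1 - t) ^ (k + 2) * A₀ + t * ((1 - t) ^ (k + 1) * ((k + 1) * A₀)) := by gcongr
        _ = (1 - t) * A₀ * ((1 - t) ^ k * (1 + k * t)) := by ring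
        _ ≤ (1 - t) * A₀ * 1 := mul_le_mul_of_nonneg_left bern (mul_nonneg h1t a0)
        _ = _ := mul_one _
    unfold fsum at hR ⊢
    rw [e2]
    rw [← hA₀] at hR
    have c2 := mul_le_mul_of_nonneg_left hR h1t
    have c3 := mul_le_mul_of_nonneg_left be ht0
    linarith
  · have d0 : A₀ ≤ ε * unifEsym n (k + 1) * (1 / ((k : ℝ) + 1)) := by
      rw [mul_one_div, le_div_iff₀ hk0]; linarith
    have d1 : t * A₁ ≤ ε * unifEsym n (k + 1) * (1 / ((n : ℝ) + 2)) := by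
      rw [mul_comm t]; exact mul_le_mul bA ht ht0 (mul_nonneg hε0 hE)
    have d2 : mixed (k + 2) p q ≤ A₀ + t * A₁ := by
      rw [e1]
      have g1 : (1 - t) ^ (k + 2) * A₀ ≤ A₀ := mul_le_of_le_one_left a0 (pow_le_one₀ h1t h1t')
      have g2 : (1 - t) ^ (k + 1) * A₁ ≤ A₁ := mul_le_of_le_one_left a1 (pow_le_one₀ h1t h1t')
      have g3 := mul_le_mul_of_nonneg_left g2 ht0
      linarith
    have d3 := (mixed_le_esym_univ (k := k + 2) hq.1 hp).trans hcr
    unfold fsum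
    linarith

/-- If `p` has a coordinate in `[1/2, 1]` and `q` has a coordinate `1 - ε`, crude bounds suffice. -/
lemma fsum_le_of_heavy_coordinate {k n : ℕ} {ε : ℝ} (hb : Fintype.card ι = n + 1) (hn : 0 < n)
    {p q : ι → ℝ} (hp : p ∈ stdSimplex ℝ ι) (hq : q ∈ stdSimplex ℝ ι) {i h : ι}
    (hε0 : 0 ≤ ε) (hqi : q i = 1 - ε) (hh : 1 / 2 ≤ p h) :
    fsum (k + 2) p q ≤ (1 / 2) ^ (k + 2) * (unifEsym n (k + 1) + unifEsym n (k + 2))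
      + crudeBound n (k + 1) ε := by
  have h1 := (mixed_le_esym_univ (k := k + 2) hq.1 hp).trans
    (esym_univ_le_crudeBound (k := k + 1) hb hn hq hε0 hqi)
  have h2 := (mixed_le_esym_univ (k := k + 2) hp.1 hq).trans (esym_univ_le hp h hb hn (k + 1))
  have hs0 : 0 ≤ 1 - p h := by
    rw [← sum_erase_of_simplex hp]; exact Finset.sum_nonneg fun a _ => hp.1 a
  obtain ⟨s, hs⟩ : ∃ s, s = 1 - p h := ⟨_, rfl⟩
  have hps : p h = 1 - s := by linarith
  rw [← hs, hps] at h2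
  rw [← hs] at hs0
  have hs1 : s ≤ 1 / 2 := by linarith
  have p1 : s ^ (k + 2) ≤ (1 / 2) ^ (k + 2) := by gcongr
  have p2 : (1 - s) * s ^ (k + 1) ≤ (1 / 2) ^ (k + 2) := by
    calc (1 - s) * s ^ (k + 1) = s ^ k * ((1 - s) * s) := by ring
      _ ≤ (1 / 2) ^ k * (1 / 2) ^ 2 := by
        gcongr
        · exact mul_nonneg (by linarith) hs0
        · nlinarith [sq_nonneg (1 - 2 * s)]
      _ = _ := (pow_add _ _ _).symm
  have g1 := mul_le_mul_of_nonneg_left p1 (unifEsym_nonneg n (k + 2))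
  have g2 := mul_le_mul_of_nonneg_left p2 (unifEsym_nonneg n (k + 1))
  unfold fsum
  linarith

/-- The value of `fsum` at an extremal balanced pair with a coordinate at the upper bound `1 - ε` is at
most `R`. -/
lemma IsExtremal.le_of_eq_upper {k n D cap num den : ℕ} {ε R : ℝ} (hb : Fintype.card ι = n + 2)
    (hn : 0 < n) (hε0 : 0 < ε) (hε : ε < 1 / 2) (hc : 1 / 2 ≤ (1 - ε) * (1 - 1 / ((n : ℝ) + 2)))
    (hD : 0 < D) (hden : 0 < den) (hcap : D * (1 - ε) ≤ cap)
    (hok : allFamOk (k + 2) 0 0 1 D cap num den (n + 2) = true) (hR : (num : ℝ) / den ≤ R)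
    (hN1 : (1 / 2) ^ (k + 2) * (unifEsym (n + 1) (k + 1) + unifEsym (n + 1) (k + 2))
      + crudeBound (n + 1) (k + 1) ε ≤ R)
    (hN2 : ε * unifEsym n (k + 1) * (1 / ((k : ℝ) + 1) + 1 / ((n : ℝ) + 2))
      + crudeBound (n + 1) (k + 1) ε ≤ R) {p q : ι → ℝ}
    (hx : IsExtremal (k + 2) (boxSimplex 0 (fun _ : ι => 1 - ε) ×ˢ boxSimplex 0 fun _ => 1 - ε) (p, q))
    {i : ι} (hi : q i = 1 - ε) : fsum (k + 2) p q ≤ R := by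
  obtain ⟨hpK, hqK⟩ := hx.mem
  have hp : p ∈ stdSimplex ℝ ι := hpK.1
  have hq : q ∈ stdSimplex ℝ ι := hqK.1
  by_cases hbig : ∃ h, 1 / 2 ≤ p h
  · obtain ⟨h, hh⟩ := hbig
    exact (fsum_le_of_heavy_coordinate hb n.succ_pos hp hq hε0.le hi hh).trans hN1
  push Not at hbig
  have hqa : ∀ a, a ≠ i → q a ≤ ε := by
    intro a ha
    have h1 := Finset.single_le_sum (fun c _ => hq.1 c) (Finset.mem_erase.2 ⟨ha, Finset.mem_univ a⟩)
    rw [sum_erase_of_simplex hq, hi] at h1; linarith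
  have hpair : ∀ a c : ι, a ≠ c → _ := fun a c hac =>
    hx.eq_or_opposed (U := 1 - ε) hac le_rfl le_rfl le_rfl le_rfl rfl rfl rfl rfl
  have hlt : ∀ a, a ≠ i → p i < p a := by
    intro a ha
    have := hqa a ha
    rcases hpair i a ha.symm with h | h | h
    · linarith [h.2]
    · exact h.1
    · linarith [h.2.1]
  -- `i` is the lightest coordinate of `p`; its mass is moved to the other coordinates
  obtain ⟨t, ht⟩ : ∃ t, t = p i := ⟨_, rfl⟩
  have ht0 : 0 ≤ t := ht ▸ hp.1 i
  have htb : t ≤ 1 / ((n : ℝ) + 2) := by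
    have h1 : ∑ _a : ι, t ≤ ∑ a, p a := by
      refine Finset.sum_le_sum fun a _ => ?_
      by_cases ha : a = i
      · rw [ha, ht]
      · rw [ht]; exact (hlt a ha).le
    rw [hp.2, Finset.sum_const, Finset.card_univ, hb, nsmul_eq_mul] at h1
    rw [le_div_iff₀ (by positivity)]
    push_cast at h1; linarith
  have h1t : 0 < 1 - t := by linarith [hbig i]
  have hπ0 : ∀ a, 0 ≤ p a / (1 - t) := fun a => div_nonneg (hp.1 a) h1t.le
  obtain ⟨π, hπ⟩ : ∃ π : ι → ℝ, π = fun a => if a = i then 0 else p a / (1 - t) := ⟨_, rfl⟩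
  have πi : π i = 0 := by rw [hπ]; simp
  have πa : ∀ a, a ≠ i → π a = p a / (1 - t) := fun a ha => by rw [hπ]; simp [ha]
  have πs : π ∈ stdSimplex ℝ ι := by
    refine ⟨fun a => ?_, ?_⟩
    · by_cases ha : a = i
      · rw [ha, πi]
      · rw [πa a ha]; exact hπ0 a
    · rw [← Finset.add_sum_erase _ _ (Finset.mem_univ i), πi, zero_add,
        Finset.sum_congr rfl fun a ha => πa a (Finset.ne_of_mem_erase ha), ← Finset.sum_div,
        sum_erase_of_simplex hp, ← ht, div_self h1t.ne']
  have πpos : ∀ a, a ≠ i → 0 < π a := by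
    intro a ha
    rw [πa a ha]
    exact div_pos (by linarith [hlt a ha]) h1t
  have hdich : Dichotomy (∅ᶜ : Finset ι) π q := by
    intro a _ c _ hac
    by_cases hai : a = i
    · right; left
      rw [hai] at hac ⊢
      have := hqa c hac.symm
      exact ⟨by rw [πi]; exact πpos c hac.symm, by linarith, Or.inl πi⟩
    by_cases hci : c = i
    · right; right
      rw [hci] at hac ⊢
      have := hqa a hac
      exact ⟨by rw [πi]; exact πpos a hac, by linarith, Or.inl πi⟩
    have hq1 := hqa a hai
    have hq2 := hqa c hci
    have hp1 := hbig a
    have hp2 := hbig c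
    rw [πa a hai, πa c hci]
    rcases hpair a c hac with h | h | h
    · left; rw [h.1]; exact ⟨rfl, h.2⟩
    · right; left
      refine ⟨by have := h.1; gcongr, h.2.1, ?_⟩
      rcases h.2.2 with h | h | h | h
      · left; rw [h, zero_div]
      · right; exact h
      · linarith
      · linarith
    · right; right
      refine ⟨by have := h.1; gcongr, h.2.1, ?_⟩
      rcases h.2.2 with h | h | h | h
      · left; rw [h, zero_div]
      · right; exact h
      · linarith
      · linarith
  have πle : ∀ a, π a ≤ 1 - ε := by
    intro a
    by_cases ha : a = i
    · rw [ha, πi]; linarith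
    rw [πa a ha, div_le_iff₀ h1t]
    have := hbig a
    have h2 : (1 - ε) * (1 - 1 / ((n : ℝ) + 2)) ≤ (1 - ε) * (1 - t) :=
      mul_le_mul_of_nonneg_left (by linarith) (by linarith)
    linarith
  have hD0 : (0 : ℝ) ≤ D := D.cast_nonneg
  have hπR : fsum (k + 2) π q ≤ R := by
    rcases Dichotomy.const_or_fsum_le (k := k + 2) (r := 0) (cn := 0) (mu := 1) (R := ∅) (c := 0)
      (μ := 1) hD one_pos hden rfl (by simp) (by simp) πs hq (by simp)
      (fun a _ => ⟨by
        rw [mul_one]; exact (mul_le_mul_of_nonneg_left (πle a) hD0).trans hcap, by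
        rw [mul_one]; exact (mul_le_mul_of_nonneg_left (hqK.2 a).2 hD0).trans hcap⟩) hdich
      (by rw [Finset.compl_empty, Finset.card_univ, hb]; exact hok) with ⟨α, β, h⟩ | h
    · exfalso
      obtain ⟨c, hci⟩ := Fintype.exists_ne_of_one_lt_card (by omega) i
      have h1 := (h i (by simp)).1
      have h2 := (h c (by simp)).1
      have := πpos c hci
      linarith
    · exact h.trans hR
  exact fsum_le_of_light_coordinate hb hn hp hq πs ht0 htb ht.symm πi
    (fun a ha => by rw [πa a ha]; field_simp) hε0.le hi hπR hN2

lemma IsExtremal.symm {k : ℕ} {K : Set (ι → ℝ)} {p q : ι → ℝ} (hx : IsExtremal k (K ×ˢ K) (p, q)) :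
    IsExtremal k (K ×ˢ K) (q, p) := by
  have hs : ∀ x : (ι → ℝ) × (ι → ℝ), sqSum x.swap = sqSum x := fun x =>
    Finset.sum_congr rfl fun i _ => add_comm _ _
  refine ⟨⟨hx.mem.2, hx.mem.1⟩, fun y hy => ?_, fun y hy h => ?_⟩
  · rw [fsum_comm, fsum_comm k q]; exact hx.le y.swap ⟨hy.2, hy.1⟩
  · rw [fsum_comm, fsum_comm k y.1] at h
    rw [← hs y, ← hs (q, p)]; exact hx.sq_le y.swap ⟨hy.2, hy.1⟩ h

/-- On pairs of balanced vectors, `fsum` is at most its value `R` at a pair of uniform distributions,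
provided that the verified bound holds for the families and two crude bounds do not exceed `R`. -/
theorem fsum_le_of_balanced {k n D cap num den : ℕ} {ε R : ℝ} (hb : Fintype.card ι = n + 2)
    (hn : 0 < n) (hε0 : 0 < ε) (hε : ε < 1 / 2) (hc : 1 / 2 ≤ (1 - ε) * (1 - 1 / ((n : ℝ) + 2)))
    (hD : 0 < D) (hden : 0 < den) (hcap : D * (1 - ε) ≤ cap)
    (hok : allFamOk (k + 2) 0 0 1 D cap num den (n + 2) = true) (hR : (num : ℝ) / den ≤ R)
    (hval : 2 * ((n + 1).choose (k + 2) : ℝ) / ((n : ℝ) + 2) ^ (k + 2) = R)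
    (hN1 : (1 / 2) ^ (k + 2) * (unifEsym (n + 1) (k + 1) + unifEsym (n + 1) (k + 2))
      + crudeBound (n + 1) (k + 1) ε ≤ R)
    (hN2 : ε * unifEsym n (k + 1) * (1 / ((k : ℝ) + 1) + 1 / ((n : ℝ) + 2))
      + crudeBound (n + 1) (k + 1) ε ≤ R) {p q : ι → ℝ}
    (hp : p ∈ boxSimplex 0 fun _ : ι => 1 - ε) (hq : q ∈ boxSimplex 0 fun _ : ι => 1 - ε) :
    fsum (k + 2) p q ≤ R := by
  obtain ⟨⟨x, y⟩, hx⟩ := exists_isExtremal (k + 2)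
    ((isCompact_boxSimplex 0 fun _ : ι => 1 - ε).prod (isCompact_boxSimplex 0 fun _ : ι => 1 - ε))
    ⟨(p, q), hp, hq⟩
  refine (hx.le (p, q) ⟨hp, hq⟩).trans ?_
  obtain ⟨hxK, hyK⟩ := hx.mem
  have hxK : x ∈ boxSimplex 0 fun _ : ι => 1 - ε := hxK
  have hyK : y ∈ boxSimplex 0 fun _ : ι => 1 - ε := hyK
  by_cases h1 : ∃ i, y i = 1 - ε
  · obtain ⟨i, hi⟩ := h1
    exact hx.le_of_eq_upper hb hn hε0 hε hc hD hden hcap hok hR hN1 hN2 hi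
  by_cases h2 : ∃ i, x i = 1 - ε
  · obtain ⟨i, hi⟩ := h2
    rw [fsum_comm]
    exact hx.symm.le_of_eq_upper hb hn hε0 hε hc hD hden hcap hok hR hN1 hN2 hi
  push Not at h1 h2
  have hdich : Dichotomy (∅ᶜ : Finset ι) x y := by
    intro a _ c _ hac
    have hv : ∀ {a c : ι}, Opposed (1 - ε) x y a c →
        x a < x c ∧ y c < y a ∧ (x a = 0 ∨ y c = 0) := by
      rintro a c ⟨g1, g2, g | g | g | g⟩
      · exact ⟨g1, g2, Or.inl g⟩
      · exact ⟨g1, g2, Or.inr g⟩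
      · exact absurd g (h2 c)
      · exact absurd g (h1 a)
    exact (hx.eq_or_opposed (U := 1 - ε) hac le_rfl le_rfl le_rfl le_rfl rfl rfl rfl rfl).imp_right
      (Or.imp hv hv)
  have hD0 : (0 : ℝ) ≤ D := D.cast_nonneg
  rcases Dichotomy.const_or_fsum_le (k := k + 2) (r := 0) (cn := 0) (mu := 1) (R := ∅) (c := 0)
    (μ := 1) hD one_pos hden rfl (by simp) (by simp) hxK.1 hyK.1 (by simp)
    (fun a _ => ⟨by
      rw [mul_one]; exact (mul_le_mul_of_nonneg_left (hxK.2 a).2 hD0).trans hcap, by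
      rw [mul_one]; exact (mul_le_mul_of_nonneg_left (hyK.2 a).2 hD0).trans hcap⟩) hdich
    (by rw [Finset.compl_empty, Finset.card_univ, hb]; exact hok) with ⟨α, β, h⟩ | h
  · have hn2 : (0 : ℝ) < (n : ℝ) + 2 := by positivity
    have cst : ∀ {f : ι → ℝ} {x : ℝ}, f ∈ stdSimplex ℝ ι → (∀ i, f i = x) → x = 1 / ((n : ℝ) + 2) := by
      intro f x hf hx
      have := hf.2
      rw [Finset.sum_congr rfl fun i _ => hx i, Finset.sum_const, Finset.card_univ, hb,
        nsmul_eq_mul] at this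
      rw [eq_div_iff hn2.ne']
      push_cast at this; linarith
    have hα := cst hxK.1 fun i => (h i (by simp)).1
    have hβ := cst hyK.1 fun i => (h i (by simp)).2
    refine le_of_eq ?_
    change fsum (k + 2) x y = R
    rw [fsum_of_const (n := n + 1) hb (fun i => h i (by simp)), hα, hβ, ← hval, one_div_pow]
    push_cast
    field_simp
    ring
  · exact h.trans hR

end Balanced

/-! ### Pairs with an unbalanced vector -/

section Unbalanced

variable {ι : Type*} [DecidableEq ι] [Fintype ι]

/-- The value of `mixed` when each vector is constant off the coordinate `i`. -/
lemma mixed_of_const_erase {k n : ℕ} (hb : Fintype.card ι = n + 2) {p q : ι → ℝ} {i : ι}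
    {c c' α β : ℝ} (hi : p i = c ∧ q i = c') (h : ∀ a, a ≠ i → p a = α ∧ q a = β) :
    mixed (k + 1) p q = c' * ((n + 1).choose (k + 1) * α ^ (k + 1))
      + (n + 1) * β * (n.choose (k + 1) * α ^ (k + 1)) + c * ((n + 1) * β * (n.choose k * α ^ k)) := by
  have hcard : (Finset.univ.erase i).card = n + 1 := by rw [card_erase_univ, hb]; rfl
  have hS : ∀ a ∈ Finset.univ.erase i, p a = α ∧ q a = β := fun a ha =>
    h a (Finset.ne_of_mem_erase ha)
  rw [mixed_succ i, mixedOn_of_const hcard hS, mixedOn_of_const hcard hS,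
    esym_of_const fun a ha => (hS a ha).1, hcard, hi.1, hi.2]

lemma le_of_sum_erase {q : ι → ℝ} (hq : q ∈ stdSimplex ℝ ι) {i a : ι} (ha : a ≠ i) {ε : ℝ}
    (hi : 1 - ε ≤ q i) : q a ≤ ε := by
  have h1 := Finset.single_le_sum (fun c _ => hq.1 c) (Finset.mem_erase.2 ⟨ha, Finset.mem_univ a⟩)
  rw [sum_erase_of_simplex hq] at h1; linarith

/-- Let `p` be balanced and `q` unbalanced. By the chord bound `q` may be taken to be a point mass,
or balanced, provided that `fsum` is at most `N` on balanced pairs. -/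
theorem fsum_le_of_balanced_of_unbalanced {k n : ℕ} {ε N : ℝ} (hk : 1 ≤ k)
    (hb : Fintype.card ι = n + 2) (hε0 : 0 < ε) (hε : ε ≤ 1 / 2)
    (hbal : ∀ p ∈ boxSimplex 0 (fun _ : ι => 1 - ε), ∀ q ∈ boxSimplex 0 (fun _ : ι => 1 - ε),
      fsum (k + 2) p q ≤ N)
    (hN : unifEsym (n + 1) (k + 2) ≤ N) {p q : ι → ℝ}
    (hp : p ∈ boxSimplex 0 fun _ : ι => 1 - ε) (hq : q ∈ stdSimplex ℝ ι) {i : ι}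
    (hi : 1 - ε ≤ q i) : fsum (k + 2) p q ≤ N := by
  obtain ⟨q', hq', τ, h0, h1, hi', hqi, hqa⟩ :=
    exists_segment (by omega) hq hε0 (by linarith) hi
  have h := fsum_le_chord hk hp.1.1 hq'.1 hε h0 h1 hi' hqi hqa
  have hcard : (Finset.univ.erase i).card = n + 1 := by rw [card_erase_univ, hb]; rfl
  have he : esym (Finset.univ.erase i) (k + 2) p ≤ N := by
    refine ((esym_le_unifEsym hcard n.succ_pos (k + 2) fun a _ => hp.1.1 a).trans ?_).trans hN
    rw [sum_erase_of_simplex hp.1]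
    refine mul_le_of_le_one_right (unifEsym_nonneg _ _) (pow_le_one₀ ?_ ?_)
    · linarith [(hp.2 i).2]
    · linarith [hp.1.1 i]
  have hq'b : q' ∈ boxSimplex 0 fun _ : ι => 1 - ε := by
    refine ⟨hq', fun a => ⟨hq'.1 a, ?_⟩⟩
    by_cases ha : a = i
    · rw [ha, hi']
    · linarith [le_of_sum_erase hq' ha hi'.ge]
  have h2 := mul_le_mul_of_nonneg_left he (sub_nonneg.2 h1)
  have h3 := mul_le_mul_of_nonneg_left (hbal p hp q' hq'b) h0
  linarith

/-- On pairs of vectors with `i`-th coordinate at least `1 - ε`, `fsum` is at most its value when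
both `i`-th coordinates are `1 - ε` and the rest is distributed evenly. -/
theorem fsum_le_of_same_unbalanced {k n D cn mu num den : ℕ} {ε T : ℝ} (hk : 1 ≤ k)
    (hb : Fintype.card ι = n + 2) (hε0 : 0 < ε) (hε : ε ≤ 1 / 2)
    (hD : 0 < D) (hmu : 0 < mu) (hden : 0 < den) (hεmu : ε = mu / ((mu + cn : ℕ) : ℝ))
    (hok : allFamOk (k + 2) 1 cn mu D D num den (n + 1) = true) (hT : (num : ℝ) / den ≤ T)
    (hval : 2 * ((1 - ε) * ((n + 1).choose (k + 2) * (ε / ((n : ℝ) + 1)) ^ (k + 2))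
      + ε * (n.choose (k + 2) * (ε / ((n : ℝ) + 1)) ^ (k + 2))
      + (1 - ε) * (ε * (n.choose (k + 1) * (ε / ((n : ℝ) + 1)) ^ (k + 1)))) = T)
    (hN : unifEsym (n + 1) (k + 2) * ε ^ (k + 2) ≤ T) {p q : ι → ℝ}
    (hp : p ∈ stdSimplex ℝ ι) (hq : q ∈ stdSimplex ℝ ι) {i : ι}
    (hpi : 1 - ε ≤ p i) (hqi : 1 - ε ≤ q i) : fsum (k + 2) p q ≤ T := by
  have hcard : (Finset.univ.erase i).card = n + 1 := by rw [card_erase_univ, hb]; rfl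
  have he : ∀ p ∈ stdSimplex ℝ ι, 1 - ε ≤ p i → esym (Finset.univ.erase i) (k + 2) p ≤ T := by
    intro p hp hpi
    refine (esym_le_unifEsym hcard n.succ_pos (k + 2) fun a _ => hp.1 a).trans (le_trans ?_ hN)
    have h1 := sum_erase_of_simplex hp i
    have h0 := Finset.sum_nonneg fun a (_ : a ∈ Finset.univ.erase i) => hp.1 a
    rw [h1] at h0
    rw [h1]
    exact mul_le_mul_of_nonneg_left (pow_le_pow_left₀ h0 (by linarith) _) (unifEsym_nonneg _ _)
  -- it suffices to treat vectors with `i`-th coordinate equal to `1 - ε`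
  suffices hedge : ∀ p ∈ stdSimplex ℝ ι, ∀ q ∈ stdSimplex ℝ ι, p i = 1 - ε → q i = 1 - ε →
      fsum (k + 2) p q ≤ T by
    have hone : 1 < Fintype.card ι := by omega
    obtain ⟨q', hq', τ, h0, h1, hqi', g1, g2⟩ := exists_segment hone hq hε0 (by linarith) hqi
    obtain ⟨p', hp', τ', h0', h1', hpi', g1', g2'⟩ := exists_segment hone hp hε0 (by linarith) hpi
    have c1 := fsum_le_chord hk hp.1 hq'.1 hε h0 h1 hqi' g1 g2
    have c2 := fsum_le_chord hk hq'.1 hp'.1 hε h0' h1' hpi' g1' g2'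
    rw [fsum_comm _ q' p] at c2
    have d1 := mul_le_mul_of_nonneg_left (he p hp hpi) (sub_nonneg.2 h1)
    have d2 := mul_le_mul_of_nonneg_left (he q' hq' hqi'.ge) (sub_nonneg.2 h1')
    have d3 := mul_le_mul_of_nonneg_left (hedge q' hq' p' hp' hqi' hpi') h0'
    have d4 : fsum (k + 2) p q' ≤ T := by linarith
    have d5 := mul_le_mul_of_nonneg_left d4 h0
    linarith
  intro p hp q hq hpi hqi
  obtain ⟨l, hl⟩ : ∃ l : ι → ℝ, l = fun a => if a = i then 1 - ε else 0 := ⟨_, rfl⟩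
  obtain ⟨u, hu⟩ : ∃ u : ι → ℝ, u = fun a => if a = i then 1 - ε else 1 := ⟨_, rfl⟩
  have li : l i = 1 - ε := by rw [hl]; simp
  have ui : u i = 1 - ε := by rw [hu]; simp
  have la : ∀ a, a ≠ i → l a = 0 := fun a ha => by rw [hl]; simp [ha]
  have ua : ∀ a, a ≠ i → u a = 1 := fun a ha => by rw [hu]; simp [ha]
  have hmem : ∀ p ∈ stdSimplex ℝ ι, p i = 1 - ε → p ∈ boxSimplex l u := by
    refine fun p hp hpi => ⟨hp, fun a => ?_⟩
    by_cases ha : a = i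
    · rw [ha, li, ui, hpi]; exact ⟨le_rfl, le_rfl⟩
    · rw [la a ha, ua a ha]
      exact ⟨hp.1 a, (le_of_sum_erase hp ha hpi.ge).trans (by linarith)⟩
  have hmem' : ∀ p ∈ boxSimplex l u, p i = 1 - ε := fun p hp =>
    le_antisymm (ui ▸ (hp.2 i).2) (li ▸ (hp.2 i).1)
  obtain ⟨⟨x, y⟩, hx⟩ := exists_isExtremal (k + 2)
    ((isCompact_boxSimplex l u).prod (isCompact_boxSimplex l u))
    ⟨(p, q), hmem p hp hpi, hmem q hq hqi⟩
  refine (hx.le (p, q) ⟨hmem p hp hpi, hmem q hq hqi⟩).trans ?_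
  obtain ⟨hxK, hyK⟩ := hx.mem
  have hxK : x ∈ boxSimplex l u := hxK
  have hyK : y ∈ boxSimplex l u := hyK
  have hxi := hmem' x hxK
  have hyi := hmem' y hyK
  have hxa : ∀ a, a ≠ i → x a ≤ ε := fun a ha => le_of_sum_erase hxK.1 ha hxi.ge
  have hya : ∀ a, a ≠ i → y a ≤ ε := fun a ha => le_of_sum_erase hyK.1 ha hyi.ge
  have hdich : Dichotomy ({i}ᶜ : Finset ι) x y := by
    intro a ha c hc hac
    have ha : a ≠ i := by simpa using ha
    have hc : c ≠ i := by simpa using hc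
    have hv : ∀ {a c : ι}, a ≠ i → c ≠ i → Opposed 1 x y a c →
        x a < x c ∧ y c < y a ∧ (x a = 0 ∨ y c = 0) := by
      rintro a c ha hc ⟨g1, g2, g | g | g | g⟩
      · exact ⟨g1, g2, Or.inl g⟩
      · exact ⟨g1, g2, Or.inr g⟩
      · linarith [hxa c hc]
      · linarith [hya a ha]
    exact (hx.eq_or_opposed (U := 1) hac (la a ha).le (la c hc).le (la a ha).le (la c hc).le
      (ua a ha) (ua c hc) (ua a ha) (ua c hc)).imp_right (Or.imp (hv ha hc) (hv hc ha))
  have hD0 : (0 : ℝ) ≤ D := D.cast_nonneg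
  have hmu0 : (0 : ℝ) < mu := by exact_mod_cast hmu
  have hcε : 1 - ε = cn / ((mu + 1 * cn : ℕ) : ℝ) := by
    rw [hεmu]; push_cast; field_simp; ring
  rcases Dichotomy.const_or_fsum_le (k := k + 2) (r := 1) (cn := cn) (mu := mu) (R := {i})
    (c := 1 - ε) (μ := ε) hD hmu hden (by simp) hcε (by rw [hεmu, one_mul]) hxK.1 hyK.1
    (by simpa using ⟨hxi, hyi⟩)
    (fun a ha => by
      have ha : a ≠ i := by simpa using ha
      exact ⟨mul_le_mul_of_nonneg_left (hxa a ha) hD0, mul_le_mul_of_nonneg_left (hya a ha) hD0⟩)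
    hdich (by rw [Finset.card_compl, Finset.card_singleton, hb]; exact hok) with ⟨α, β, h⟩ | h
  · have h : ∀ a, a ≠ i → x a = α ∧ y a = β := fun a ha => h a (by simpa using ha)
    have hn1 : (0 : ℝ) < (n : ℝ) + 1 := by positivity
    have cst : ∀ {f : ι → ℝ} {x : ℝ}, f ∈ stdSimplex ℝ ι → f i = 1 - ε → (∀ a, a ≠ i → f a = x) →
        x = ε / ((n : ℝ) + 1) := by
      intro f x hf hfi hx
      have := sum_erase_of_simplex hf i
      rw [Finset.sum_congr rfl fun a ha => hx a (Finset.ne_of_mem_erase ha), Finset.sum_const, hcard,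
        nsmul_eq_mul, hfi] at this
      rw [eq_div_iff hn1.ne']
      push_cast at this; linarith
    have hα := cst hxK.1 hxi fun a ha => (h a ha).1
    have hβ := cst hyK.1 hyi fun a ha => (h a ha).2
    refine le_of_eq ?_
    change fsum (k + 2) x y = T
    have hm : ((n : ℝ) + 1) * (ε / ((n : ℝ) + 1)) = ε := by field_simp
    rw [fsum, mixed_of_const_erase hb ⟨hxi, hyi⟩ h,
      mixed_of_const_erase hb ⟨hyi, hxi⟩ fun a ha => (h a ha).symm, hα, hβ, hm, ← hval]
    ring
  · exact h.trans hT

end Unbalanced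

/-! ### Vectors that are unbalanced at different coordinates -/

section DifferentPeaks

variable {ι : Type*} [DecidableEq ι]

/-- The value of `e_k` at the uniform distribution on `n + 1` points with one point removed. -/
noncomputable def offEsym (n k : ℕ) : ℝ := (n.choose k : ℝ) / ((n : ℝ) + 1) ^ k

lemma offEsym_nonneg (n k : ℕ) : 0 ≤ offEsym n k := by unfold offEsym; positivity

/-- The dependence of `mixed` on two coordinates, in terms of `mixedOn`. -/
lemma mixed_pair_mixedOn [Fintype ι] {i h : ι} (hih : i ≠ h) (k : ℕ) (p q : ι → ℝ) :
    mixed (k + 2) p q =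
      mixedOn ((Finset.univ.erase i).erase h) (k + 2) p q
      + (p i + p h) * mixedOn ((Finset.univ.erase i).erase h) (k + 1) p q
      + p i * p h * mixedOn ((Finset.univ.erase i).erase h) k p q
      + (q i + q h) * esym ((Finset.univ.erase i).erase h) (k + 2) p
      + (q i * p h + q h * p i) * esym ((Finset.univ.erase i).erase h) (k + 1) p := by
  rw [mixed_pair hih]
  unfold mixedOn
  rw [Finset.mul_sum, Finset.mul_sum, ← Finset.sum_add_distrib, ← Finset.sum_add_distrib]
  congr 2
  refine Finset.sum_congr rfl fun a _ => ?_
  ring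

/-- A bound for the expression of `mixed_pair_mixedOn` with `p i = q h = 1 - ε`, `p h = τ ε`,
`q i = τ' ε`, in terms of bounds for the symmetric functions of the remaining coordinates. -/
lemma pair_expression_le {k : ℕ} {ε τ τ' F F' G G' H m₀ m₁ m₂ e₁ e₂ : ℝ} (hε0 : 0 ≤ ε)
    (hε1 : ε ≤ 1) (h0 : 0 ≤ τ) (h1 : τ ≤ 1) (h0' : 0 ≤ τ') (h1' : τ' ≤ 1)
    (hF : 0 ≤ F) (hF' : 0 ≤ F') (hG : 0 ≤ G) (hG' : 0 ≤ G') (hH : 0 ≤ H)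
    (hm₂ : m₂ ≤ ((1 - τ') * ε) * (G' * ((1 - τ) * ε) ^ (k + 2)))
    (hm₁ : m₁ ≤ ((1 - τ') * ε) * (G * ((1 - τ) * ε) ^ (k + 1)))
    (hm₀ : m₀ ≤ ((1 - τ') * ε) * (H * ((1 - τ) * ε) ^ k))
    (he₂ : e₂ ≤ F' * ((1 - τ) * ε) ^ (k + 2)) (he₁ : e₁ ≤ F * ((1 - τ) * ε) ^ (k + 1))
    (hHF : ε * H ≤ (k + 1) * ((1 - ε) * F)) :
    m₂ + (1 - ε + τ * ε) * m₁ + (1 - ε) * (τ * ε) * m₀ + (τ' * ε + (1 - ε)) * e₂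
        + (τ' * ε * (τ * ε) + (1 - ε) * (1 - ε)) * e₁
      ≤ ε ^ (k + 1) * ((1 - ε) ^ 2 * F + ε ^ 2 * F + ε * F' + ε * G + ε ^ 2 * G') := by
  have hc : 0 ≤ 1 - ε := by linarith
  have ht : 0 ≤ 1 - τ := by linarith
  have ht' : 0 ≤ 1 - τ' := by linarith
  have a1 : 1 - τ ≤ 1 := by linarith
  have a2 : 1 - τ' ≤ 1 := by linarith
  have a3 : τ * ε ≤ ε := mul_le_of_le_one_left hε0 h1
  have a4 : τ' * ε ≤ ε := mul_le_of_le_one_left hε0 h1'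
  have s1 : (1 - τ) * ε ≤ ε := mul_le_of_le_one_left hε0 a1
  have b2 : m₂ ≤ ε ^ (k + 1) * (ε ^ 2 * G') := by
    refine hm₂.trans ?_
    calc ((1 - τ') * ε) * (G' * ((1 - τ) * ε) ^ (k + 2)) ≤ (1 * ε) * (G' * ε ^ (k + 2)) := by
          gcongr
      _ = _ := by ring
  have b1 : (1 - ε + τ * ε) * m₁ ≤ ε ^ (k + 1) * (ε * G) := by
    calc (1 - ε + τ * ε) * m₁
        ≤ (1 - ε + τ * ε) * (((1 - τ') * ε) * (G * ((1 - τ) * ε) ^ (k + 1))) := by gcongr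
      _ ≤ 1 * ((1 * ε) * (G * ε ^ (k + 1))) := by
        gcongr
        linarith
      _ = _ := by ring
  have b4 : (τ' * ε + (1 - ε)) * e₂ ≤ ε ^ (k + 1) * (ε * F') := by
    calc (τ' * ε + (1 - ε)) * e₂ ≤ (τ' * ε + (1 - ε)) * (F' * ((1 - τ) * ε) ^ (k + 2)) := by gcongr
      _ ≤ 1 * (F' * ε ^ (k + 2)) := by
        gcongr
        linarith
      _ = _ := by ring
  have b5 : τ' * ε * (τ * ε) * e₁ ≤ ε ^ (k + 1) * (ε ^ 2 * F) := by
    calc τ' * ε * (τ * ε) * e₁ ≤ τ' * ε * (τ * ε) * (F * ((1 - τ) * ε) ^ (k + 1)) := by gcongr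
      _ ≤ ε * ε * (F * ε ^ (k + 1)) := by gcongr
      _ = _ := by ring
  have b3 : (1 - ε) * (τ * ε) * m₀ + (1 - ε) * (1 - ε) * e₁ ≤ ε ^ (k + 1) * ((1 - ε) ^ 2 * F) := by
    calc (1 - ε) * (τ * ε) * m₀ + (1 - ε) * (1 - ε) * e₁
        ≤ (1 - ε) * (τ * ε) * (((1 - τ') * ε) * (H * ((1 - τ) * ε) ^ k))
          + (1 - ε) * (1 - ε) * (F * ((1 - τ) * ε) ^ (k + 1)) := by gcongr
      _ ≤ (1 - ε) * (τ * ε) * ((1 * ε) * (H * ((1 - τ) * ε) ^ k))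
          + (1 - ε) * (1 - ε) * (F * ((1 - τ) * ε) ^ (k + 1)) := by gcongr
      _ = ε ^ (k + 1) * ((1 - τ) ^ k * ((1 - ε) * τ * (ε * H) + (1 - ε) ^ 2 * F * (1 - τ))) := by
        rw [mul_pow, mul_pow]; ring
      _ ≤ ε ^ (k + 1) * ((1 - τ) ^ k * ((1 - ε) * τ * ((k + 1) * ((1 - ε) * F))
          + (1 - ε) ^ 2 * F * (1 - τ))) := by gcongr
      _ = ε ^ (k + 1) * ((1 - ε) ^ 2 * F) * ((1 - τ) ^ k * (1 + k * τ)) := by ring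
      _ ≤ ε ^ (k + 1) * ((1 - ε) ^ 2 * F) * 1 := by
        gcongr; exact pow_mul_one_add_le_one k h0 h1
      _ = _ := mul_one _
  linarith

/-- When the remaining coordinates are constant, the expression of `mixed_pair_mixedOn` decreases at
least linearly as mass `τ ε` is moved from them to the coordinate `h`. -/
lemma pair_expression_le_linear {k : ℕ} {ε τ τ' F F' G G' H : ℝ} (hε0 : 0 ≤ ε)
    (hε1 : ε ≤ 1) (h0 : 0 ≤ τ) (h1 : τ ≤ 1) (h0' : 0 ≤ τ') (h1' : τ' ≤ 1)
    (hF : 0 ≤ F) (hF' : 0 ≤ F') (hG : 0 ≤ G) (hG' : 0 ≤ G') (hH : 0 ≤ H)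
    (hHF : ε ^ 2 * F + ε * (1 - ε) * H + ε ^ 2 * G ≤ (k + 1) * ((1 - ε) ^ 2 * F)) :
    ((1 - τ') * ε) * (G' * ((1 - τ) * ε) ^ (k + 3))
        + (1 - ε + τ * ε) * (((1 - τ') * ε) * (G * ((1 - τ) * ε) ^ (k + 2)))
        + (1 - ε) * (τ * ε) * (((1 - τ') * ε) * (H * ((1 - τ) * ε) ^ (k + 1)))
        + (τ' * ε + (1 - ε)) * (F' * ((1 - τ) * ε) ^ (k + 3))
        + (τ' * ε * (τ * ε) + (1 - ε) * (1 - ε)) * (F * ((1 - τ) * ε) ^ (k + 2))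
      ≤ (1 - τ) * (ε ^ (k + 2) * ((1 - τ') * (ε * (ε * G' + (1 - ε) * G))
        + (τ' * ε + (1 - ε)) * (ε * F') + (1 - ε) ^ 2 * F)) := by
  have hc : 0 ≤ 1 - ε := by linarith
  have ht : 0 ≤ 1 - τ := by linarith
  have ht' : 0 ≤ 1 - τ' := by linarith
  have a1 : 1 - τ ≤ 1 := by linarith
  have a2 : 1 - τ' ≤ 1 := by linarith
  have s : ∀ l, (1 - τ) ^ (l + 1) ≤ 1 - τ := fun l => pow_le_of_le_one ht a1 (by omega)
  have b1 : ((1 - τ') * ε) * (G' * ((1 - τ) * ε) ^ (k + 3))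
      ≤ (1 - τ) * (ε ^ (k + 2) * ((1 - τ') * (ε * (ε * G')))) := by
    calc _ = (1 - τ) ^ (k + 3) * (ε ^ (k + 2) * ((1 - τ') * (ε * (ε * G')))) := by rw [mul_pow]; ring
      _ ≤ _ := by gcongr; exact s _
  have b2 : (1 - ε) * (((1 - τ') * ε) * (G * ((1 - τ) * ε) ^ (k + 2)))
      ≤ (1 - τ) * (ε ^ (k + 2) * ((1 - τ') * (ε * ((1 - ε) * G)))) := by
    calc _ = (1 - τ) ^ (k + 2) * (ε ^ (k + 2) * ((1 - τ') * (ε * ((1 - ε) * G)))) := by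
          rw [mul_pow]; ring
      _ ≤ _ := by gcongr; exact s _
  have b3 : (τ' * ε + (1 - ε)) * (F' * ((1 - τ) * ε) ^ (k + 3))
      ≤ (1 - τ) * (ε ^ (k + 2) * ((τ' * ε + (1 - ε)) * (ε * F'))) := by
    calc _ = (1 - τ) ^ (k + 3) * (ε ^ (k + 2) * ((τ' * ε + (1 - ε)) * (ε * F'))) := by
          rw [mul_pow]; ring
      _ ≤ _ := by gcongr; exact s _
  have b4 : τ * ε * (((1 - τ') * ε) * (G * ((1 - τ) * ε) ^ (k + 2)))
        + (1 - ε) * (τ * ε) * (((1 - τ') * ε) * (H * ((1 - τ) * ε) ^ (k + 1)))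
        + (τ' * ε * (τ * ε) + (1 - ε) * (1 - ε)) * (F * ((1 - τ) * ε) ^ (k + 2))
      ≤ (1 - τ) * (ε ^ (k + 2) * ((1 - ε) ^ 2 * F)) := by
    calc _ = ε ^ (k + 2) * (1 - τ) * ((1 - τ) ^ k * (τ * ((1 - τ') * (1 - τ) * (ε ^ 2 * G)
          + (1 - τ') * (ε * (1 - ε) * H) + τ' * (1 - τ) * (ε ^ 2 * F)) + (1 - τ) * ((1 - ε) ^ 2 * F))) := by
          rw [mul_pow, mul_pow]; ring
      _ ≤ ε ^ (k + 2) * (1 - τ) * ((1 - τ) ^ k * (τ * (1 * 1 * (ε ^ 2 * G)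
          + 1 * (ε * (1 - ε) * H) + 1 * 1 * (ε ^ 2 * F)) + (1 - τ) * ((1 - ε) ^ 2 * F))) := by gcongr
      _ ≤ ε ^ (k + 2) * (1 - τ) * ((1 - τ) ^ k * (τ * ((k + 1) * ((1 - ε) ^ 2 * F))
          + (1 - τ) * ((1 - ε) ^ 2 * F))) := by gcongr; linarith
      _ = ε ^ (k + 2) * (1 - τ) * ((1 - ε) ^ 2 * F) * ((1 - τ) ^ k * (1 + k * τ)) := by ring
      _ ≤ ε ^ (k + 2) * (1 - τ) * ((1 - ε) ^ 2 * F) * 1 := by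
        gcongr; exact pow_mul_one_add_le_one k h0 h1
      _ = _ := by ring
  linarith

/-- If `p` vanishes at a point of `S`, Maclaurin's inequality for the other points of `S` applies. -/
lemma mixedOn_le_of_eq_zero {S : Finset ι} {n : ℕ} (hS : S.card = n + 1) (hn : 0 < n) (k : ℕ)
    {p q : ι → ℝ} (hp : ∀ i ∈ S, 0 ≤ p i) (hq : ∀ i ∈ S, 0 ≤ q i) {a : ι} (ha : a ∈ S)
    (hpa : p a = 0) :
    esym S k p ≤ unifEsym n k * (∑ i ∈ S, p i) ^ k ∧
    mixedOn S k p q ≤ (∑ i ∈ S, q i) * (unifEsym n k * (∑ i ∈ S, p i) ^ k) := by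
  have h1 : esym S k p ≤ unifEsym n k * (∑ i ∈ S, p i) ^ k := by
    have hc : (S.erase a).card = n := by rw [Finset.card_erase_of_mem ha, hS, Nat.add_sub_cancel]
    have := esym_le_unifEsym hc hn k fun i hi => hp i (Finset.mem_of_mem_erase hi)
    rwa [← esym_erase_of_eq_zero ha hpa, Finset.sum_erase _ hpa] at this
  refine ⟨h1, ?_⟩
  rw [Finset.sum_mul]
  exact Finset.sum_le_sum fun i hi => mul_le_mul_of_nonneg_left
    ((esym_mono_set (Finset.erase_subset _ _) hp).trans h1) (hq i hi)

variable [Fintype ι]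

lemma sum_erase_erase {p : ι → ℝ} (hp : p ∈ stdSimplex ℝ ι) {i h : ι} (hih : i ≠ h) :
    ∑ a ∈ (Finset.univ.erase i).erase h, p a = 1 - p i - p h := by
  have h1 := Finset.add_sum_erase (Finset.univ.erase i) p
    (Finset.mem_erase.2 ⟨hih.symm, Finset.mem_univ h⟩)
  rw [sum_erase_of_simplex hp] at h1; linarith

/-- The parameter `τ` measures the share of the mass `ε` outside `i` that lies on the coordinate `h`. -/
lemma exists_eq_mul {p : ι → ℝ} (hp : p ∈ stdSimplex ℝ ι) {ε : ℝ} (hε0 : 0 < ε) {i h : ι}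
    (hih : i ≠ h) (hi : p i = 1 - ε) : ∃ τ, 0 ≤ τ ∧ τ ≤ 1 ∧ p h = τ * ε ∧
      ∑ a ∈ (Finset.univ.erase i).erase h, p a = (1 - τ) * ε := by
  have h1 := le_of_sum_erase hp hih.symm hi.ge
  refine ⟨p h / ε, div_nonneg (hp.1 h) hε0.le, (div_le_one hε0).2 h1, by field_simp, ?_⟩
  rw [sum_erase_erase hp hih, hi]; field_simp; ring

/-- If one of the remaining coordinates of `p` vanishes, crude bounds suffice. -/
lemma fsum_le_of_eq_zero {k n : ℕ} {ε : ℝ} (hb : Fintype.card ι = n + 3) (hn : 0 < n)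
    (hε0 : 0 < ε) (hε1 : ε ≤ 1) (h2 : ε * unifEsym n k ≤ (k + 1) * ((1 - ε) * unifEsym n (k + 1)))
    (h1 : ε * unifEsym n k ≤ (k + 1) * ((1 - ε) * unifEsym (n + 1) (k + 1)))
    {p q : ι → ℝ} (hp : p ∈ stdSimplex ℝ ι) (hq : q ∈ stdSimplex ℝ ι) {i h a : ι} (hih : i ≠ h)
    (hpi : p i = 1 - ε) (hqh : q h = 1 - ε) (hai : a ≠ i) (hah : a ≠ h) (ha : p a = 0) :
    fsum (k + 2) p q ≤ ε ^ (k + 1) * ((1 - ε) ^ 2 * unifEsym n (k + 1) + ε ^ 2 * unifEsym n (k + 1)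
          + ε * unifEsym n (k + 2) + ε * unifEsym n (k + 1) + ε ^ 2 * unifEsym n (k + 2))
        + ε ^ (k + 1) * ((1 - ε) ^ 2 * unifEsym (n + 1) (k + 1) + ε ^ 2 * unifEsym (n + 1) (k + 1)
          + ε * unifEsym (n + 1) (k + 2) + ε * unifEsym n (k + 1) + ε ^ 2 * unifEsym n (k + 2)) := by
  obtain ⟨τ, a0, a1, a2, a3⟩ := exists_eq_mul hp hε0 hih hpi
  obtain ⟨τ', b0, b1, b2, b3⟩ := exists_eq_mul hq hε0 hih.symm hqh
  rw [Finset.erase_right_comm] at b3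
  have hi := mixed_pair_mixedOn hih k p q
  have hh := mixed_pair_mixedOn hih k q p
  obtain ⟨S, hS⟩ : ∃ S, S = (Finset.univ.erase i).erase h := ⟨_, rfl⟩
  have haS : a ∈ S := by rw [hS]; simp [hai, hah]
  have hcard : S.card = n + 1 := by
    rw [hS, Finset.card_erase_of_mem (by simp [hih.symm]), card_erase_univ, hb]; rfl
  rw [← hS] at hi hh a3 b3
  have u := unifEsym_nonneg
  have hp0 : ∀ i ∈ S, 0 ≤ p i := fun i _ => hp.1 i
  have hq0 : ∀ i ∈ S, 0 ≤ q i := fun i _ => hq.1 i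
  have z := fun l => mixedOn_le_of_eq_zero hcard hn l hp0 hq0 haS ha
  have w := fun l => mixedOn_le hcard hn l hq0 hp0
  have v := fun l => esym_le_unifEsym hcard n.succ_pos l hq0
  rw [a3, b3] at z w
  rw [b3] at v
  rw [hpi, hqh, a2, b2] at hi hh
  have g1 := pair_expression_le hε0.le hε1 a0 a1 b0 b1 (u n (k + 1)) (u n (k + 2)) (u n (k + 1))
    (u n (k + 2)) (u n k) (z (k + 2)).2 (z (k + 1)).2 (z k).2 (z (k + 2)).1 (z (k + 1)).1 h2
  have g2 := pair_expression_le hε0.le hε1 b0 b1 a0 a1 (u (n + 1) (k + 1)) (u (n + 1) (k + 2))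
    (u n (k + 1)) (u n (k + 2)) (u n k) (w (k + 2)) (w (k + 1)) (w k) (v (k + 2)) (v (k + 1)) h1
  unfold fsum
  rw [hi, hh]
  linarith

/-- If the remaining coordinates of `p` and of `q` are constant, then `fsum` is largest when
`p h = q i = 0`. -/
lemma fsum_le_of_const {k n : ℕ} {ε : ℝ} (hb : Fintype.card ι = n + 3)
    (hε0 : 0 < ε) (hε : ε ≤ 1 / 2)
    (hW : ε ^ 2 * unifEsym (n + 1) (k + 2) + ε * (1 - ε) * offEsym n (k + 1)
      + ε ^ 2 * offEsym n (k + 2) ≤ (k + 1) * ((1 - ε) ^ 2 * unifEsym (n + 1) (k + 2)))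
    {p q : ι → ℝ} (hp : p ∈ stdSimplex ℝ ι) (hq : q ∈ stdSimplex ℝ ι) {i h : ι} (hih : i ≠ h)
    (hpi : p i = 1 - ε) (hqh : q h = 1 - ε) {α β : ℝ}
    (hc : ∀ a, a ≠ i → a ≠ h → p a = α ∧ q a = β) :
    fsum (k + 3) p q ≤ 2 * (ε ^ (k + 2) * (ε * (ε * offEsym n (k + 3) + (1 - ε) * offEsym n (k + 2))
      + (1 - ε) * (ε * unifEsym (n + 1) (k + 3)) + (1 - ε) ^ 2 * unifEsym (n + 1) (k + 2))) := by
  obtain ⟨τ, a0, a1, a2, a3⟩ := exists_eq_mul hp hε0 hih hpi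
  obtain ⟨τ', b0, b1, b2, b3⟩ := exists_eq_mul hq hε0 hih.symm hqh
  rw [Finset.erase_right_comm] at b3
  have hi := mixed_pair_mixedOn hih (k + 1) p q
  have hh := mixed_pair_mixedOn hih (k + 1) q p
  obtain ⟨S, hS⟩ : ∃ S, S = (Finset.univ.erase i).erase h := ⟨_, rfl⟩
  have hcard : S.card = n + 1 := by
    rw [hS, Finset.card_erase_of_mem (by simp [hih.symm]), card_erase_univ, hb]; rfl
  have hcS : ∀ a ∈ S, p a = α ∧ q a = β := by
    intro a ha
    rw [hS] at ha
    obtain ⟨h1, h2⟩ := Finset.mem_erase.1 ha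
    exact hc a (Finset.ne_of_mem_erase h2) h1
  rw [← hS] at hi hh a3 b3
  have hn1 : (0 : ℝ) < (n : ℝ) + 1 := by positivity
  rw [Finset.sum_congr rfl fun a ha => (hcS a ha).1, Finset.sum_const, hcard, nsmul_eq_mul] at a3
  rw [Finset.sum_congr rfl fun a ha => (hcS a ha).2, Finset.sum_const, hcard, nsmul_eq_mul] at b3
  push_cast at a3 b3
  have pw : ∀ {α μ : ℝ}, ((n : ℝ) + 1) * α = μ → ∀ l, α ^ l = μ ^ l / ((n : ℝ) + 1) ^ l := by
    intro α μ h l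
    rw [← h, mul_pow]; field_simp
  have m1 : ∀ l, mixedOn S l p q = ((1 - τ') * ε) * (offEsym n l * ((1 - τ) * ε) ^ l) := by
    intro l
    rw [mixedOn_of_const hcard hcS, b3, pw a3, offEsym]; ring
  have m2 : ∀ l, mixedOn S l q p = ((1 - τ) * ε) * (offEsym n l * ((1 - τ') * ε) ^ l) := by
    intro l
    rw [mixedOn_of_const hcard fun a ha => (hcS a ha).symm, a3, pw b3, offEsym]; ring
  have e1 : ∀ l, esym S l p = unifEsym (n + 1) l * ((1 - τ) * ε) ^ l := by
    intro l
    rw [esym_of_const fun a ha => (hcS a ha).1, hcard, pw a3, unifEsym]; push_cast; ring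
  have e2 : ∀ l, esym S l q = unifEsym (n + 1) l * ((1 - τ') * ε) ^ l := by
    intro l
    rw [esym_of_const fun a ha => (hcS a ha).2, hcard, pw b3, unifEsym]; push_cast; ring
  rw [hpi, hqh, a2, b2] at hi hh
  simp only [m1, m2, e1, e2] at hi hh
  have u := unifEsym_nonneg
  have o := offEsym_nonneg
  have g1 := pair_expression_le_linear hε0.le (by linarith) a0 a1 b0 b1 (u (n + 1) (k + 2))
    (u (n + 1) (k + 3)) (o n (k + 2)) (o n (k + 3)) (o n (k + 1)) hW
  have g2 := pair_expression_le_linear hε0.le (by linarith) b0 b1 a0 a1 (u (n + 1) (k + 2))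
    (u (n + 1) (k + 3)) (o n (k + 2)) (o n (k + 3)) (o n (k + 1)) hW
  -- both bounds are bilinear in `τ`, `τ'`
  have key : fsum (k + 3) p q ≤
      (1 - τ) * (ε ^ (k + 2) * ((1 - τ') * (ε * (ε * offEsym n (k + 3) + (1 - ε) * offEsym n (k + 2)))
        + (τ' * ε + (1 - ε)) * (ε * unifEsym (n + 1) (k + 3)) + (1 - ε) ^ 2 * unifEsym (n + 1) (k + 2)))
      + (1 - τ') * (ε ^ (k + 2) * ((1 - τ) * (ε * (ε * offEsym n (k + 3) + (1 - ε) * offEsym n (k + 2)))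
        + (τ * ε + (1 - ε)) * (ε * unifEsym (n + 1) (k + 3)) + (1 - ε) ^ 2 * unifEsym (n + 1) (k + 2))) := by
    unfold fsum
    rw [show k + 3 = k + 1 + 2 from rfl, hi, hh]
    linarith
  refine key.trans ?_
  obtain ⟨X, hX⟩ : ∃ X, X = ε * (ε * offEsym n (k + 3) + (1 - ε) * offEsym n (k + 2)) := ⟨_, rfl⟩
  obtain ⟨Y, hY⟩ : ∃ Y, Y = ε * unifEsym (n + 1) (k + 3) := ⟨_, rfl⟩
  obtain ⟨Z, hZ⟩ : ∃ Z, Z = (1 - ε) ^ 2 * unifEsym (n + 1) (k + 2) := ⟨_, rfl⟩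
  have hc0 : 0 ≤ 1 - ε := by linarith
  have X0 : 0 ≤ X := by
    rw [hX]; exact mul_nonneg hε0.le (add_nonneg (mul_nonneg hε0.le (o _ _)) (mul_nonneg hc0 (o _ _)))
  have Y0 : 0 ≤ Y := by rw [hY]; exact mul_nonneg hε0.le (u _ _)
  have Z0 : 0 ≤ Z := by rw [hZ]; exact mul_nonneg (sq_nonneg _) (u _ _)
  rw [← hX, ← hY, ← hZ]
  have e : ∀ P : ℝ, (1 - τ) * (P * ((1 - τ') * X + (τ' * ε + (1 - ε)) * Y + Z))
      + (1 - τ') * (P * ((1 - τ) * X + (τ * ε + (1 - ε)) * Y + Z))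
      = P * ((1 - τ) * ((1 - τ') * X + (τ' * ε + (1 - ε)) * Y + Z)
        + (1 - τ') * ((1 - τ) * X + (τ * ε + (1 - ε)) * Y + Z)) := fun P => by ring
  rw [e, mul_left_comm 2]
  refine mul_le_mul_of_nonneg_left ?_ (pow_nonneg hε0.le _)
  have f1 : (1 - τ) * (1 - τ') * X ≤ 1 * X := mul_le_mul_of_nonneg_right
    (mul_le_one₀ (by linarith) (by linarith) (by linarith)) X0
  have f2 : ((1 - τ) * (τ' * ε + (1 - ε)) + (1 - τ') * (τ * ε + (1 - ε))) * Y
      ≤ 2 * (1 - ε) * Y := by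
    refine mul_le_mul_of_nonneg_right ?_ Y0
    have s1 := mul_nonneg (add_nonneg a0 b0) (by linarith : 0 ≤ 1 - 2 * ε)
    have s2 := mul_nonneg (mul_nonneg a0 b0) hε0.le
    linarith
  have f3 : ((1 - τ) + (1 - τ')) * Z ≤ 2 * Z := mul_le_mul_of_nonneg_right (by linarith) Z0
  calc _ = 2 * ((1 - τ) * (1 - τ') * X)
        + ((1 - τ) * (τ' * ε + (1 - ε)) + (1 - τ') * (τ * ε + (1 - ε))) * Y
        + ((1 - τ) + (1 - τ')) * Z := by ring
    _ ≤ 2 * (1 * X) + 2 * (1 - ε) * Y + 2 * Z := by gcongr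
    _ = _ := by rw [hY]; ring

end DifferentPeaks

section DifferentPeaks

variable {ι : Type*} [DecidableEq ι] [Fintype ι]

/-- If `p` has a coordinate at least `1 - ε` at `i`, and `q` has one at `h ≠ i`, then `fsum` is at
most its value when these coordinates equal `1 - ε`, when `p h = q i = 0`, and when the remaining
mass is distributed evenly. -/
theorem fsum_le_of_different_unbalanced {k n : ℕ} {ε T : ℝ} (hb : Fintype.card ι = n + 3)
    (hn : 0 < n) (hε0 : 0 < ε) (hε : ε ≤ 1 / 2)
    (hval : 2 * (ε ^ (k + 2) * (ε * (ε * offEsym n (k + 3) + (1 - ε) * offEsym n (k + 2))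
      + (1 - ε) * (ε * unifEsym (n + 1) (k + 3)) + (1 - ε) ^ 2 * unifEsym (n + 1) (k + 2))) = T)
    (hW : ε ^ 2 * unifEsym (n + 1) (k + 2) + ε * (1 - ε) * offEsym n (k + 1)
      + ε ^ 2 * offEsym n (k + 2) ≤ (k + 1) * ((1 - ε) ^ 2 * unifEsym (n + 1) (k + 2)))
    (h2 : ε * unifEsym n (k + 1) ≤ (k + 2) * ((1 - ε) * unifEsym n (k + 2)))
    (h1 : ε * unifEsym n (k + 1) ≤ (k + 2) * ((1 - ε) * unifEsym (n + 1) (k + 2)))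
    (hZ : ε ^ (k + 2) * ((1 - ε) ^ 2 * unifEsym n (k + 2) + ε ^ 2 * unifEsym n (k + 2)
          + ε * unifEsym n (k + 3) + ε * unifEsym n (k + 2) + ε ^ 2 * unifEsym n (k + 3))
        + ε ^ (k + 2) * ((1 - ε) ^ 2 * unifEsym (n + 1) (k + 2) + ε ^ 2 * unifEsym (n + 1) (k + 2)
          + ε * unifEsym (n + 1) (k + 3) + ε * unifEsym n (k + 2) + ε ^ 2 * unifEsym n (k + 3)) ≤ T)
    (hN : unifEsym (n + 1) (k + 3) * ε ^ (k + 3) + unifEsym (n + 1) (k + 2) * ε ^ (k + 2) ≤ T)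
    {p q : ι → ℝ} (hp : p ∈ stdSimplex ℝ ι) (hq : q ∈ stdSimplex ℝ ι) {i h : ι} (hih : i ≠ h)
    (hpi : 1 - ε ≤ p i) (hqh : 1 - ε ≤ q h) : fsum (k + 3) p q ≤ T := by
  -- the value at the end of the chord where the other vector is a point mass
  have he : ∀ p ∈ stdSimplex ℝ ι, ∀ i h : ι, i ≠ h → 1 - ε ≤ p i →
      esym (Finset.univ.erase h) (k + 3) p ≤ T := by
    intro p hp i h hih hpi
    have hi : i ∈ Finset.univ.erase h := Finset.mem_erase.2 ⟨hih, Finset.mem_univ i⟩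
    have hcard : ((Finset.univ.erase h).erase i).card = n + 1 := by
      rw [Finset.card_erase_of_mem hi, card_erase_univ, hb]; rfl
    have hs := sum_erase_erase hp hih.symm
    have hs0 : 0 ≤ ∑ a ∈ (Finset.univ.erase h).erase i, p a := Finset.sum_nonneg fun a _ => hp.1 a
    have hsε : ∑ a ∈ (Finset.univ.erase h).erase i, p a ≤ ε := by linarith [hp.1 h]
    have hb : ∀ l, esym ((Finset.univ.erase h).erase i) l p ≤ unifEsym (n + 1) l * ε ^ l := fun l =>
      (esym_le_unifEsym hcard n.succ_pos l fun a _ => hp.1 a).trans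
        (mul_le_mul_of_nonneg_left (pow_le_pow_left₀ hs0 hsε l) (unifEsym_nonneg _ _))
    have hp1 : p i ≤ 1 := by
      have := sum_erase_of_simplex hp i
      linarith [Finset.sum_nonneg fun a (_ : a ∈ Finset.univ.erase i) => hp.1 a]
    rw [esym_erase_succ hi]
    have h3 := mul_le_of_le_one_left
      (esym_nonneg (S := (Finset.univ.erase h).erase i) (k := k + 2) fun a _ => hp.1 a) hp1
    linarith [hb (k + 2), hb (k + 3)]
  -- it suffices to treat vectors whose large coordinates equal `1 - ε`
  suffices hedge : ∀ p ∈ stdSimplex ℝ ι, ∀ q ∈ stdSimplex ℝ ι, p i = 1 - ε → q h = 1 - ε →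
      fsum (k + 3) p q ≤ T by
    have hone : 1 < Fintype.card ι := by omega
    obtain ⟨q', hq', τ, h0, h1, hqi', g1, g2⟩ := exists_segment hone hq hε0 (by linarith) hqh
    obtain ⟨p', hp', τ', h0', h1', hpi', g1', g2'⟩ := exists_segment hone hp hε0 (by linarith) hpi
    have c1 := fsum_le_chord (k := k + 1) (by omega) hp.1 hq'.1 hε h0 h1 hqi' g1 g2
    have c2 := fsum_le_chord (k := k + 1) (by omega) hq'.1 hp'.1 hε h0' h1' hpi' g1' g2'
    rw [fsum_comm _ q' p, fsum_comm _ q' p'] at c2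
    have d1 := mul_le_mul_of_nonneg_left (he p hp i h hih hpi) (sub_nonneg.2 h1)
    have d2 := mul_le_mul_of_nonneg_left (he q' hq' h i hih.symm hqi'.ge) (sub_nonneg.2 h1')
    have d3 := mul_le_mul_of_nonneg_left (hedge p' hp' q' hq' hpi' hqi') h0'
    have d4 : fsum (k + 3) p q' ≤ T := by
      change fsum (k + 1 + 2) p q' ≤ T
      change τ' * fsum (k + 1 + 2) p' q' ≤ _ at d3
      change (1 - τ') * esym _ (k + 1 + 2) q' ≤ _ at d2
      linarith
    have d5 := mul_le_mul_of_nonneg_left d4 h0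
    change fsum (k + 1 + 2) p q ≤ T
    change τ * fsum (k + 1 + 2) p q' ≤ _ at d5
    change (1 - τ) * esym _ (k + 1 + 2) p ≤ _ at d1
    linarith
  intro p hp q hq hpi hqh
  obtain ⟨l, hl⟩ : ∃ l : ι → ι → ℝ, l = fun i a => if a = i then 1 - ε else 0 := ⟨_, rfl⟩
  obtain ⟨u, hu⟩ : ∃ u : ι → ι → ℝ, u = fun i a => if a = i then 1 - ε else 1 := ⟨_, rfl⟩
  have li : ∀ i, l i i = 1 - ε := fun i => by rw [hl]; simp
  have ui : ∀ i, u i i = 1 - ε := fun i => by rw [hu]; simp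
  have la : ∀ i a, a ≠ i → l i a = 0 := fun i a ha => by rw [hl]; simp [ha]
  have ua : ∀ i a, a ≠ i → u i a = 1 := fun i a ha => by rw [hu]; simp [ha]
  have hmem : ∀ i, ∀ p ∈ stdSimplex ℝ ι, p i = 1 - ε → p ∈ boxSimplex (l i) (u i) := by
    refine fun i p hp hpi => ⟨hp, fun a => ?_⟩
    by_cases ha : a = i
    · rw [ha, li, ui, hpi]; exact ⟨le_rfl, le_rfl⟩
    · rw [la i a ha, ua i a ha]
      exact ⟨hp.1 a, (le_of_sum_erase hp ha hpi.ge).trans (by linarith)⟩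
  have hmem' : ∀ i, ∀ p ∈ boxSimplex (l i) (u i), p i = 1 - ε := fun i p hp =>
    le_antisymm (ui i ▸ (hp.2 i).2) (li i ▸ (hp.2 i).1)
  obtain ⟨⟨x, y⟩, hx⟩ := exists_isExtremal (k + 3)
    ((isCompact_boxSimplex (l i) (u i)).prod (isCompact_boxSimplex (l h) (u h)))
    ⟨(p, q), hmem i p hp hpi, hmem h q hq hqh⟩
  refine (hx.le (p, q) ⟨hmem i p hp hpi, hmem h q hq hqh⟩).trans ?_
  change fsum (k + 3) x y ≤ T
  obtain ⟨hxK, hyK⟩ := hx.mem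
  have hxK : x ∈ boxSimplex (l i) (u i) := hxK
  have hyK : y ∈ boxSimplex (l h) (u h) := hyK
  have hxi := hmem' i x hxK
  have hyh := hmem' h y hyK
  have e : ((k : ℝ) + 2) = ((k + 1 : ℕ) : ℝ) + 1 := by push_cast; ring
  rw [e] at h1 h2
  by_cases hzero : ∃ a, a ≠ i ∧ a ≠ h ∧ (x a = 0 ∨ y a = 0)
  · obtain ⟨a, hai, hah, ha | ha⟩ := hzero
    · exact (fsum_le_of_eq_zero (k := k + 1) hb hn hε0 (by linarith) h2 h1 hxK.1 hyK.1 hih hxi hyh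
        hai hah ha).trans hZ
    · rw [fsum_comm]
      exact (fsum_le_of_eq_zero (k := k + 1) hb hn hε0 (by linarith) h2 h1 hyK.1 hxK.1 hih.symm hyh
        hxi hah hai ha).trans hZ
  push Not at hzero
  obtain ⟨a, ha⟩ : ∃ a, a ∉ ({i, h} : Finset ι) := by
    by_contra hcon
    push Not at hcon
    have h1 := Finset.card_le_card fun a (_ : a ∈ Finset.univ) => hcon a
    have h2 : ({i, h} : Finset ι).card ≤ 2 := Finset.card_le_two
    rw [Finset.card_univ] at h1
    omega
  simp only [Finset.mem_insert, Finset.mem_singleton, not_or] at ha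
  have hc : ∀ c, c ≠ i → c ≠ h → x c = x a ∧ y c = y a := by
    intro c hci hch
    by_cases hca : c = a
    · rw [hca]; exact ⟨rfl, rfl⟩
    have hv : ∀ {a c : ι}, a ≠ i → a ≠ h → c ≠ i → c ≠ h → ¬ Opposed 1 x y a c := by
      rintro a c hai hah hci hch ⟨-, -, g | g | g | g⟩
      · exact (hzero a hai hah).1 g
      · exact (hzero c hci hch).2 g
      · linarith [le_of_sum_erase hxK.1 hci hxi.ge]
      · linarith [le_of_sum_erase hyK.1 hah hyh.ge]
    rcases hx.eq_or_opposed (k := k + 1) (U := 1) hca (la i c hci).le (la i a ha.1).le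
      (la h c hch).le (la h a ha.2).le (ua i c hci) (ua i a ha.1) (ua h c hch) (ua h a ha.2)
      with g | g | g
    · exact g
    · exact absurd g (hv hci hch ha.1 ha.2)
    · exact absurd g (hv ha.1 ha.2 hci hch)
  exact (fsum_le_of_const hb hε0 hε hW hxK.1 hyK.1 hih hxi hyh hc).trans hval.le

end DifferentPeaks

/-! ### The values at the extremal points -/

section Values

variable {b n k : ℕ}

/-- The value of `fsum (k + 3)` at two uniform distributions on `n + 3` points. -/
noncomputable def unifValue (n k : ℕ) : ℝ :=
  2 * ((n + 2).choose (k + 3) : ℝ) / ((n : ℝ) + 3) ^ (k + 3)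

/-- The value of `fsum (k + 3)` at two copies of `peak ε i` on `n + 3` points. -/
noncomputable def peakValue (n k : ℕ) (ε : ℝ) : ℝ :=
  2 * ((1 - ε) * ((n + 2).choose (k + 3) * (ε / ((n : ℝ) + 2)) ^ (k + 3))
    + ε * ((n + 1).choose (k + 3) * (ε / ((n : ℝ) + 2)) ^ (k + 3))
    + (1 - ε) * (ε * ((n + 1).choose (k + 2) * (ε / ((n : ℝ) + 2)) ^ (k + 2))))

/-- The value of `fsum (k + 3)` at `peakOff ε i h` and `peakOff ε h i` on `n + 3` points. -/
noncomputable def peakOffValue (n k : ℕ) (ε : ℝ) : ℝ :=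
  2 * (ε ^ (k + 2) * (ε * (ε * offEsym n (k + 3) + (1 - ε) * offEsym n (k + 2))
    + (1 - ε) * (ε * unifEsym (n + 1) (k + 3)) + (1 - ε) ^ 2 * unifEsym (n + 1) (k + 2)))

lemma fsum_unif (hb : b = n + 3) : fsum (k + 3) (unif b) (unif b) = unifValue n k := by
  have hc : Fintype.card (Fin b) = n + 2 + 1 := by rw [Fintype.card_fin, hb]
  rw [fsum_of_const hc (p := unif b) (q := unif b) (α := 1 / b) (β := 1 / b) (fun a => ⟨rfl, rfl⟩),
    unifValue, hb, one_div_pow]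
  push_cast
  field_simp
  ring

lemma fsum_unifOff_pointMass (hb : b = n + 3) (i : Fin b) :
    fsum (k + 3) (unifOff i) (pointMass i) = unifEsym (n + 2) (k + 3) := by
  have hc : Fintype.card (Fin b) = n + 1 + 2 := by rw [Fintype.card_fin, hb]
  have h : ∀ a, a ≠ i → unifOff i a = 1 / ((b : ℝ) - 1) ∧ pointMass i a = 0 := fun a ha => by
    simp [unifOff, pointMass, ha]
  rw [fsum, mixed_of_const_erase hc (c := 0) (c' := 1) (by simp [unifOff, pointMass]) h,
    mixed_of_const_erase hc (c := 1) (c' := 0) (by simp [unifOff, pointMass]) fun a ha =>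
      (h a ha).symm, unifEsym, hb, one_div_pow]
  push_cast
  rw [show (n : ℝ) + 3 - 1 = n + 2 by ring, zero_pow (by omega), zero_pow (by omega)]
  ring

lemma fsum_peak (hb : b = n + 3) (ε : ℝ) (i : Fin b) :
    fsum (k + 3) (peak ε i) (peak ε i) = peakValue n k ε := by
  have hc : Fintype.card (Fin b) = n + 1 + 2 := by rw [Fintype.card_fin, hb]
  have h : ∀ a, a ≠ i → peak ε i a = ε / ((n : ℝ) + 2) ∧ peak ε i a = ε / ((n : ℝ) + 2) :=
    fun a ha => by
      rw [peak, if_neg ha, hb]; push_cast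
      rw [show (n : ℝ) + 3 - 1 = n + 2 by ring]; exact ⟨rfl, rfl⟩
  have hi : peak ε i i = 1 - ε := by simp [peak]
  rw [fsum, mixed_of_const_erase hc ⟨hi, hi⟩ h, peakValue]
  push_cast
  rw [show ((n : ℝ) + 1 + 1) * (ε / (n + 2)) = ε by field_simp; ring]
  ring

lemma fsum_peakOff (hb : b = n + 3) (ε : ℝ) {i h : Fin b} (hih : i ≠ h) :
    fsum (k + 3) (peakOff ε i h) (peakOff ε h i) = peakOffValue n k ε := by
  have hcard : ((Finset.univ.erase i).erase h).card = n + 1 := by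
    rw [Finset.card_erase_of_mem (by simp [hih.symm]), card_erase_univ, Fintype.card_fin, hb]; rfl
  have hS : ∀ a ∈ (Finset.univ.erase i).erase h,
      peakOff ε i h a = ε / ((n : ℝ) + 1) ∧ peakOff ε h i a = ε / ((n : ℝ) + 1) := by
    intro a ha
    obtain ⟨h1, h2⟩ := Finset.mem_erase.1 ha
    have h2 := Finset.ne_of_mem_erase h2
    rw [peakOff, peakOff, if_neg h1, if_neg h2, if_neg h1, if_neg h2, hb]
    push_cast
    rw [show (n : ℝ) + 3 - 2 = n + 1 by ring]
    exact ⟨rfl, rfl⟩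
  have hS' := fun a ha => (hS a ha).symm
  have e1 : peakOff ε i h i = 1 - ε := by simp [peakOff]
  have e2 : peakOff ε i h h = 0 := by simp [peakOff, hih.symm]
  have e3 : peakOff ε h i h = 1 - ε := by simp [peakOff]
  have e4 : peakOff ε h i i = 0 := by simp [peakOff, hih]
  rw [fsum, mixed_pair_mixedOn hih (k + 1), mixed_pair_mixedOn hih (k + 1), e1, e2, e3, e4]
  simp only [mixedOn_of_const hcard hS, mixedOn_of_const hcard hS',
    esym_of_const fun a ha => (hS a ha).1, esym_of_const fun a ha => (hS a ha).2, hcard]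
  unfold peakOffValue offEsym unifEsym
  push_cast
  rw [show ((n : ℝ) + 1) * (ε / (n + 1)) = ε by field_simp]
  simp only [div_pow]
  ring

end Values

section Suprema

variable {b j : ℕ}

lemma isGreatest_psiValues (hj : j < b) {A B : Set (Fin b → ℝ)} {p q : Fin b → ℝ} (hp : p ∈ A)
    (hq : q ∈ B) (h : ∀ x ∈ A, ∀ y ∈ B, fsum j x y ≤ fsum j p q) :
    IsGreatest (psiValues hj A B) (Psi hj p q) := by
  refine ⟨⟨p, hp, q, hq, rfl⟩, ?_⟩
  rintro _ ⟨x, hx, y, hy, rfl⟩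
  rw [Psi_eq, Psi_eq]
  exact mul_le_mul_of_nonneg_left (h x hx y hy) (Nat.cast_nonneg _)

lemma isLUB_psiValues (hj : j < b) {A B : Set (Fin b → ℝ)} {p q : Fin b → ℝ} (hp : p ∈ closure A)
    (hq : q ∈ closure B) (h : ∀ x ∈ A, ∀ y ∈ B, fsum j x y ≤ fsum j p q) :
    IsLUB (psiValues hj A B) (Psi hj p q) := by
  constructor
  · rintro _ ⟨x, hx, y, hy, rfl⟩
    rw [Psi_eq, Psi_eq]
    exact mul_le_mul_of_nonneg_left (h x hx y hy) (Nat.cast_nonneg _)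
  · intro u hu
    have hcl : IsClosed {x : (Fin b → ℝ) × (Fin b → ℝ) | (j.factorial : ℝ) * fsum j x.1 x.2 ≤ u} :=
      isClosed_le (continuous_const.mul (continuous_fsum j)) continuous_const
    have hsub : A ×ˢ B ⊆ {x : (Fin b → ℝ) × (Fin b → ℝ) | (j.factorial : ℝ) * fsum j x.1 x.2 ≤ u} := by
      rintro ⟨x, y⟩ ⟨hx, hy⟩
      have := hu ⟨x, hx, y, hy, rfl⟩
      rwa [Psi_eq] at this
    have := closure_minimal hsub hcl (by rw [closure_prod_eq]; exact ⟨hp, hq⟩ : (p, q) ∈ closure (A ×ˢ B))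
    rw [Psi_eq]; exact this

lemma pointMass_mem_stdSimplex (i : Fin b) : pointMass i ∈ stdSimplex ℝ (Fin b) := by
  refine ⟨fun a => ?_, by simp [pointMass]⟩
  unfold pointMass; split_ifs <;> norm_num

lemma mem_closure_maxUnbalanced {ε : ℝ} (hε : 0 < ε) {p : Fin b → ℝ}
    (hp : p ∈ stdSimplex ℝ (Fin b)) {i : Fin b} (hi : p i = 1 - ε) :
    p ∈ closure (maxUnbalanced b ε i) := by
  -- `p` is approached along the segment to the point mass at `i`
  have hc : Continuous fun t : ℝ => (1 - t) • p + t • (pointMass i : Fin b → ℝ) := by fun_prop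
  have ht := (hc.tendsto 0).comp tendsto_one_div_add_atTop_nhds_zero_nat
  simp only [sub_zero, one_smul, zero_smul, add_zero] at ht
  refine mem_closure_of_tendsto ht (Filter.Eventually.of_forall fun m => ?_)
  have h0 : (0 : ℝ) < 1 / ((m : ℝ) + 1) := by positivity
  have h1 : 1 / ((m : ℝ) + 1) ≤ 1 := by
    rw [div_le_one (by positivity)]; linarith [m.cast_nonneg (α := ℝ)]
  refine ⟨convex_stdSimplex ℝ (Fin b) hp (pointMass_mem_stdSimplex i) (sub_nonneg.2 h1) h0.le
    (by ring), ?_⟩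
  have : pointMass i i = 1 := by simp [pointMass]
  simp only [Function.comp_apply, Pi.add_apply, Pi.smul_apply, smul_eq_mul, hi, this]
  nlinarith

lemma maxBalanced_subset_boxSimplex (b : ℕ) (ε : ℝ) :
    maxBalanced b ε ⊆ boxSimplex 0 fun _ => 1 - ε :=
  fun _ hp => ⟨hp.1, fun i => ⟨hp.1.1 i, hp.2 i⟩⟩

end Suprema

section Row

/-- The computation that verifies the bound on balanced pairs for `j = k + 3`, `b = n + 3` and
`ε = mu / (mu + cn)`. -/
def balancedOk (n k cn mu : ℕ) : Bool :=
  allFamOk (k + 3) 0 0 1 ((mu + cn) * 2 ^ 14) (cn * 2 ^ 14) (2 * (n + 2).choose (k + 3))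
    ((n + 3) ^ (k + 3)) (n + 3)

/-- The computation that verifies the bound on pairs that are unbalanced at the same coordinate, for
`j = k + 3`, `b = n + 3` and `ε = mu / (mu + cn)`. -/
def peakOk (n k cn mu : ℕ) : Bool :=
  allFamOk (k + 3) 1 cn mu (2 ^ 14) (2 ^ 14)
    (2 * (cn * (n + 2).choose (k + 3) + mu * (n + 1).choose (k + 3)
      + cn * (n + 2) * (n + 1).choose (k + 2)) * mu ^ (k + 3))
    ((mu + cn) * ((mu + cn) * (n + 2)) ^ (k + 3)) (n + 2)

/-- The four suprema for `b = n + 3`, `j = k + 3` and `ε = mu / (mu + cn)`, reduced to two searches and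
to inequalities between explicit numbers. -/
theorem suprema_of_checks {b j n k cn mu : ℕ} {ε v₁ v₂ v₃ v₄ u₃ u₄ : ℝ} (hb : b = n + 3)
    (hjk : j = k + 3) (hn : 0 < n) (hj : j < b) (hmu : 0 < mu) (hcn : mu < cn)
    (hεmu : ε = mu / ((mu + cn : ℕ) : ℝ))
    (hc : 1 / 2 ≤ (1 - ε) * (1 - 1 / ((n : ℝ) + 3)))
    (hok₁ : balancedOk n k cn mu = true) (hok₃ : peakOk n k cn mu = true)
    (hN1 : (1 / 2) ^ (k + 3) * (unifEsym (n + 2) (k + 2) + unifEsym (n + 2) (k + 3))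
      + crudeBound (n + 2) (k + 2) ε ≤ unifValue n k)
    (hN2 : ε * unifEsym (n + 1) (k + 2) * (1 / ((k : ℝ) + 2) + 1 / ((n : ℝ) + 3))
      + crudeBound (n + 2) (k + 2) ε ≤ unifValue n k)
    (h12 : unifValue n k ≤ unifEsym (n + 2) (k + 3))
    (h3 : unifEsym (n + 2) (k + 3) * ε ^ (k + 3) ≤ peakValue n k ε)
    (hW : ε ^ 2 * unifEsym (n + 1) (k + 2) + ε * (1 - ε) * offEsym n (k + 1)
      + ε ^ 2 * offEsym n (k + 2) ≤ (k + 1) * ((1 - ε) ^ 2 * unifEsym (n + 1) (k + 2)))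
    (hD2 : ε * unifEsym n (k + 1) ≤ (k + 2) * ((1 - ε) * unifEsym n (k + 2)))
    (hD1 : ε * unifEsym n (k + 1) ≤ (k + 2) * ((1 - ε) * unifEsym (n + 1) (k + 2)))
    (hZ : ε ^ (k + 2) * ((1 - ε) ^ 2 * unifEsym n (k + 2) + ε ^ 2 * unifEsym n (k + 2)
          + ε * unifEsym n (k + 3) + ε * unifEsym n (k + 2) + ε ^ 2 * unifEsym n (k + 3))
        + ε ^ (k + 2) * ((1 - ε) ^ 2 * unifEsym (n + 1) (k + 2) + ε ^ 2 * unifEsym (n + 1) (k + 2)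
          + ε * unifEsym (n + 1) (k + 3) + ε * unifEsym n (k + 2) + ε ^ 2 * unifEsym n (k + 3))
        ≤ peakOffValue n k ε)
    (h4 : unifEsym (n + 1) (k + 3) * ε ^ (k + 3) + unifEsym (n + 1) (k + 2) * ε ^ (k + 2)
      ≤ peakOffValue n k ε)
    (hv₁ : |(j.factorial : ℝ) * unifValue n k - v₁| ≤ 1 / 10 ^ 6)
    (hv₂ : |(j.factorial : ℝ) * unifEsym (n + 2) (k + 3) - v₂| ≤ 1 / 10 ^ 6)
    (hv₃ : |(j.factorial : ℝ) * peakValue n k ε - v₃| ≤ u₃)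
    (hv₄ : |(j.factorial : ℝ) * peakOffValue n k ε - v₄| ≤ u₄) :
    (unif b ∈ maxBalanced b ε ∧
      IsGreatest (psiValues hj (maxBalanced b ε) (maxBalanced b ε)) (Psi hj (unif b) (unif b)) ∧
      |Psi hj (unif b) (unif b) - v₁| ≤ 1 / 10 ^ 6) ∧
    (∀ i : Fin b,
      unifOff i ∈ maxBalanced b ε ∧ pointMass i ∈ maxUnbalanced b ε i ∧
      IsGreatest (psiValues hj (maxBalanced b ε) (maxUnbalanced b ε i))
        (Psi hj (unifOff i) (pointMass i)) ∧
      |Psi hj (unifOff i) (pointMass i) - v₂| ≤ 1 / 10 ^ 6) ∧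
    (∀ i : Fin b,
      peak ε i ∈ closure (maxUnbalanced b ε i) ∧
      IsLUB (psiValues hj (maxUnbalanced b ε i) (maxUnbalanced b ε i))
        (Psi hj (peak ε i) (peak ε i)) ∧
      |Psi hj (peak ε i) (peak ε i) - v₃| ≤ u₃) ∧
    (∀ i h : Fin b, i ≠ h →
      peakOff ε i h ∈ closure (maxUnbalanced b ε i) ∧
      peakOff ε h i ∈ closure (maxUnbalanced b ε h) ∧
      IsLUB (psiValues hj (maxUnbalanced b ε i) (maxUnbalanced b ε h))
        (Psi hj (peakOff ε i h) (peakOff ε h i)) ∧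
      |Psi hj (peakOff ε i h) (peakOff ε h i) - v₄| ≤ u₄) := by
  subst hjk
  have hcard : Fintype.card (Fin b) = n + 3 := by rw [Fintype.card_fin, hb]
  have hbR : (b : ℝ) = n + 3 := by rw [hb]; push_cast; ring
  have hn0 : (0 : ℝ) < n := by exact_mod_cast hn
  have hmu0 : (0 : ℝ) < mu := by exact_mod_cast hmu
  have hcnR : (mu : ℝ) < cn := by exact_mod_cast hcn
  have hmc : (0 : ℝ) < (mu : ℝ) + cn := by linarith
  have hε0 : 0 < ε := by rw [hεmu]; push_cast; positivity
  have hε : ε < 1 / 2 := by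
    rw [hεmu]; push_cast
    rw [div_lt_div_iff₀ hmc two_pos]; linarith
  have h1 : ∀ p ∈ boxSimplex 0 (fun _ : Fin b => 1 - ε), ∀ q ∈ boxSimplex 0 (fun _ : Fin b => 1 - ε),
      fsum (k + 3) p q ≤ unifValue n k := by
    intro p hp q hq
    refine fsum_le_of_balanced (k := k + 1) (n := n + 1) hcard n.succ_pos hε0 hε ?_
      (Nat.mul_pos (by omega) (by norm_num)) (pow_pos (by omega) _) ?_ hok₁ ?_ ?_ hN1 ?_ hp hq
    · push_cast; rw [show (n : ℝ) + 1 + 2 = n + 3 by ring]; exact hc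
    · rw [hεmu]; push_cast
      refine le_of_eq ?_
      field_simp; ring
    · unfold unifValue; push_cast; exact le_rfl
    · unfold unifValue; push_cast; rw [show (n : ℝ) + 1 + 2 = n + 3 by ring]
    · push_cast
      rw [show (n : ℝ) + 1 + 2 = n + 3 by ring, show (k : ℝ) + 1 + 1 = k + 2 by ring]; exact hN2
  have hunif : unif b ∈ maxBalanced b ε := by
    have hb0 : (0 : ℝ) < b := by rw [hbR]; linarith
    refine ⟨⟨fun a => by unfold unif; positivity, ?_⟩, fun a => ?_⟩
    · simp only [unif, Finset.sum_const, Finset.card_univ, Fintype.card_fin, nsmul_eq_mul]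
      field_simp
    · have : unif b a ≤ 1 / 2 := one_div_le_one_div_of_le two_pos (by linarith)
      linarith
  have sum_off : ∀ (i : Fin b) (f : Fin b → ℝ) (c x : ℝ), f i = c → (∀ a, a ≠ i → f a = x) →
      ∑ a, f a = c + (n + 2) * x := by
    intro i f c x hc hx
    rw [← Finset.add_sum_erase _ _ (Finset.mem_univ i), hc,
      Finset.sum_congr rfl fun a ha => hx a (Finset.ne_of_mem_erase ha), Finset.sum_const,
      card_erase_univ, hcard, nsmul_eq_mul]
    push_cast; ring
  refine ⟨⟨hunif, isGreatest_psiValues hj hunif hunif fun p hp q hq => ?_, ?_⟩,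
    fun i => ?_, fun i => ?_, fun i h hih => ?_⟩
  · rw [fsum_unif hb]
    exact h1 p (maxBalanced_subset_boxSimplex b ε hp) q (maxBalanced_subset_boxSimplex b ε hq)
  · rw [Psi_eq, fsum_unif hb]; exact hv₁
  · have hoff : unifOff i ∈ maxBalanced b ε := by
      have hx : ∀ a, a ≠ i → unifOff i a = 1 / ((n : ℝ) + 2) := fun a ha => by
        rw [unifOff, if_neg ha, hbR]; congr 1; ring
      have hi : unifOff i i = 0 := by simp [unifOff]
      have h01 : ∀ a, 0 ≤ unifOff i a ∧ unifOff i a ≤ 1 - ε := by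
        intro a
        by_cases ha : a = i
        · rw [ha, hi]; exact ⟨le_rfl, by linarith⟩
        · rw [hx a ha]
          have : 1 / ((n : ℝ) + 2) ≤ 1 / 2 := one_div_le_one_div_of_le two_pos (by linarith)
          exact ⟨by positivity, by linarith⟩
      refine ⟨⟨fun a => (h01 a).1, ?_⟩, fun a => (h01 a).2⟩
      rw [sum_off i _ _ _ hi hx]; field_simp; ring
    have hpt : pointMass i ∈ maxUnbalanced b ε i :=
      ⟨pointMass_mem_stdSimplex i, by simp only [pointMass, if_true]; linarith⟩
    refine ⟨hoff, hpt, isGreatest_psiValues hj hoff hpt fun p hp q hq => ?_, ?_⟩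
    · rw [fsum_unifOff_pointMass hb]
      exact fsum_le_of_balanced_of_unbalanced (k := k + 1) (n := n + 1) (by omega) hcard hε0 hε.le
        (fun p hp q hq => (h1 p hp q hq).trans h12) le_rfl (maxBalanced_subset_boxSimplex b ε hp)
        hq.1 hq.2.le
    · rw [Psi_eq, fsum_unifOff_pointMass hb]; exact hv₂
  · have hpeak : peak ε i ∈ closure (maxUnbalanced b ε i) := by
      have hi : peak ε i i = 1 - ε := by simp [peak]
      have hx : ∀ a, a ≠ i → peak ε i a = ε / ((n : ℝ) + 2) := fun a ha => by
        rw [peak, if_neg ha, hbR]; congr 1; ring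
      refine mem_closure_maxUnbalanced hε0 ⟨fun a => ?_, ?_⟩ hi
      · by_cases ha : a = i
        · rw [ha, hi]; linarith
        · rw [hx a ha]; positivity
      · rw [sum_off i _ _ _ hi hx]; field_simp; ring
    refine ⟨hpeak, isLUB_psiValues hj hpeak hpeak fun p hp q hq => ?_, ?_⟩
    · rw [fsum_peak hb]
      refine fsum_le_of_same_unbalanced (k := k + 1) (n := n + 1) (by omega) hcard hε0 hε.le
        (by norm_num) hmu (Nat.mul_pos (by omega) (pow_pos (Nat.mul_pos (by omega) (by omega)) _))
        hεmu hok₃ (le_of_eq ?_) ?_ h3 hp.1 hq.1 hp.2.le hq.2.le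
      · unfold peakValue
        rw [hεmu]; push_cast
        have e : (1 : ℝ) - mu / (mu + cn) = cn / (mu + cn) := by field_simp; ring
        rw [e]; simp only [div_pow, mul_pow]
        field_simp
        ring
      · unfold peakValue; push_cast; rw [show (n : ℝ) + 1 + 1 = n + 2 by ring]
    · rw [Psi_eq, fsum_peak hb]; exact hv₃
  · have hoff : ∀ i h : Fin b, i ≠ h → peakOff ε i h ∈ closure (maxUnbalanced b ε i) := by
      intro i h hih
      have hi : peakOff ε i h i = 1 - ε := by simp [peakOff]
      have hh : peakOff ε i h h = 0 := by simp [peakOff, hih.symm]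
      have hx : ∀ a, a ≠ i → a ≠ h → peakOff ε i h a = ε / ((n : ℝ) + 1) := fun a ha hah => by
        rw [peakOff, if_neg ha, if_neg hah, hbR]; congr 1; ring
      refine mem_closure_maxUnbalanced hε0 ⟨fun a => ?_, ?_⟩ hi
      · by_cases ha : a = i
        · rw [ha, hi]; linarith
        by_cases hah : a = h
        · rw [hah, hh]
        · rw [hx a ha hah]; positivity
      · rw [sum_pair hih, hi, hh, Finset.sum_congr rfl fun a ha => hx a
          (Finset.ne_of_mem_erase (Finset.mem_of_mem_erase ha)) (Finset.ne_of_mem_erase ha),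
          Finset.sum_const, Finset.card_erase_of_mem (by simp [hih.symm]), card_erase_univ, hcard,
          nsmul_eq_mul]
        push_cast; field_simp; ring
    refine ⟨hoff i h hih, hoff h i hih.symm,
      isLUB_psiValues hj (hoff i h hih) (hoff h i hih.symm) fun p hp q hq => ?_, ?_⟩
    · rw [fsum_peakOff hb ε hih]
      exact fsum_le_of_different_unbalanced hcard hn hε0 hε.le rfl hW hD2 hD1 hZ h4 hp.1 hq.1 hih
        hp.2.le hq.2.le
    · rw [Psi_eq, fsum_peakOff hb ε hih]; exact hv₄

end Row

/-! ### The computations and the five rows -/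

section Searches

set_option maxRecDepth 100000

lemma balancedOk_seven : balancedOk 4 2 91 9 = true := by decide +kernel

lemma peakOk_seven : peakOk 4 2 91 9 = true := by decide +kernel

lemma balancedOk_eight : balancedOk 5 3 22 3 = true := by decide +kernel

lemma peakOk_eight : peakOk 5 3 22 3 = true := by decide +kernel

lemma balancedOk_nine : balancedOk 6 3 9 1 = true := by decide +kernel

lemma peakOk_nine : peakOk 6 3 9 1 = true := by decide +kernel

lemma balancedOk_ten : balancedOk 7 4 14 1 = true := by decide +kernel

lemma peakOk_ten : peakOk 7 4 14 1 = true := by decide +kernel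

lemma balancedOk_eleven : balancedOk 8 5 10 1 = true := by decide +kernel

lemma peakOk_eleven : peakOk 8 5 10 1 = true := by decide +kernel

end Searches

theorem mainTheorem4
    (b k j : ℕ) (ε v₁ v₂ v₃ v₄ u₃ u₄ : ℝ)
    (hrow : (b, k, ε, v₁, v₂, v₃, v₄, u₃, u₄) ∈
      ({(7, 7, 9 / 100, 0.085679, 0.092593, 0.000006, 0.000107, 1 / 10 ^ 6, 1 / 10 ^ 6),
        (8, 8, 3 / 25, 0.038453, 0.042840, 0.000002, 0.000022, 1 / 10 ^ 6, 1 / 10 ^ 6),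
        (9, 8, 1 / 10, 0.075870, 0.076905, 0.000001, 0.000015, 1 / 10 ^ 6, 1 / 10 ^ 6),
        (10, 9, 1 / 15, 0.036289, 0.037935, 3.4 / 10 ^ 9, 8.5 / 10 ^ 8, 1 / 10 ^ 10, 1 / 10 ^ 9),
        (11, 10, 1 / 11, 0.016928, 0.018144, 1.4 / 10 ^ 9, 2.7 / 10 ^ 8, 1 / 10 ^ 10, 1 / 10 ^ 9)} :
        Set (ℕ × ℕ × ℝ × ℝ × ℝ × ℝ × ℝ × ℝ × ℝ)))
    (hk : j + 2 = k) (hj : j < b) :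
    -- balanced, balanced: a maximum, attained at two uniform distributions
    (unif b ∈ maxBalanced b ε ∧
      IsGreatest (psiValues hj (maxBalanced b ε) (maxBalanced b ε)) (Psi hj (unif b) (unif b)) ∧
      |Psi hj (unif b) (unif b) - v₁| ≤ 1 / 10 ^ 6) ∧
    -- balanced, unbalanced: a maximum, attained at a point mass and the uniform law off that point
    (∀ i : Fin b,
      unifOff i ∈ maxBalanced b ε ∧ pointMass i ∈ maxUnbalanced b ε i ∧
      IsGreatest (psiValues hj (maxBalanced b ε) (maxUnbalanced b ε i))
        (Psi hj (unifOff i) (pointMass i)) ∧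
      |Psi hj (unifOff i) (pointMass i) - v₂| ≤ 1 / 10 ^ 6) ∧
    -- unbalanced on the same coordinate: the supremum is the value at a point of the closure
    (∀ i : Fin b,
      peak ε i ∈ closure (maxUnbalanced b ε i) ∧
      IsLUB (psiValues hj (maxUnbalanced b ε i) (maxUnbalanced b ε i))
        (Psi hj (peak ε i) (peak ε i)) ∧
      |Psi hj (peak ε i) (peak ε i) - v₃| ≤ u₃) ∧
    -- unbalanced on different coordinates: the supremum is the value at a point of the closure
    (∀ i h : Fin b, i ≠ h →
      peakOff ε i h ∈ closure (maxUnbalanced b ε i) ∧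
      peakOff ε h i ∈ closure (maxUnbalanced b ε h) ∧
      IsLUB (psiValues hj (maxUnbalanced b ε i) (maxUnbalanced b ε h))
        (Psi hj (peakOff ε i h) (peakOff ε h i)) ∧
      |Psi hj (peakOff ε i h) (peakOff ε h i) - v₄| ≤ u₄) := by
  simp only [Set.mem_insert_iff, Set.mem_singleton_iff, Prod.mk.injEq] at hrow
  rcases hrow with ⟨hb, hk', h3, h4, h5, h6, h7, h8, h9⟩ | ⟨hb, hk', h3, h4, h5, h6, h7, h8, h9⟩ |
    ⟨hb, hk', h3, h4, h5, h6, h7, h8, h9⟩ | ⟨hb, hk', h3, h4, h5, h6, h7, h8, h9⟩ |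
    ⟨hb, hk', h3, h4, h5, h6, h7, h8, h9⟩
  · obtain rfl : j = 5 := by omega
    rw [h3, h4, h5, h6, h7, h8, h9]
    refine suprema_of_checks (n := 4) (k := 2) (cn := 91) (mu := 9) hb rfl ?_ hj ?_ ?_ ?_ ?_
      balancedOk_seven peakOk_seven ?_ ?_ ?_ ?_ ?_ ?_ ?_ ?_ ?_ ?_ ?_ ?_ ?_ <;>
    norm_num [unifValue, peakValue, peakOffValue, unifEsym, offEsym, crudeBound, Nat.choose,
      Nat.factorial, abs_le]
  · obtain rfl : j = 6 := by omega
    rw [h3, h4, h5, h6, h7, h8, h9]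
    refine suprema_of_checks (n := 5) (k := 3) (cn := 22) (mu := 3) hb rfl ?_ hj ?_ ?_ ?_ ?_
      balancedOk_eight peakOk_eight ?_ ?_ ?_ ?_ ?_ ?_ ?_ ?_ ?_ ?_ ?_ ?_ ?_ <;>
    norm_num [unifValue, peakValue, peakOffValue, unifEsym, offEsym, crudeBound, Nat.choose,
      Nat.factorial, abs_le]
  · obtain rfl : j = 6 := by omega
    rw [h3, h4, h5, h6, h7, h8, h9]
    refine suprema_of_checks (n := 6) (k := 3) (cn := 9) (mu := 1) hb rfl ?_ hj ?_ ?_ ?_ ?_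
      balancedOk_nine peakOk_nine ?_ ?_ ?_ ?_ ?_ ?_ ?_ ?_ ?_ ?_ ?_ ?_ ?_ <;>
    norm_num [unifValue, peakValue, peakOffValue, unifEsym, offEsym, crudeBound, Nat.choose,
      Nat.factorial, abs_le]
  · obtain rfl : j = 7 := by omega
    rw [h3, h4, h5, h6, h7, h8, h9]
    refine suprema_of_checks (n := 7) (k := 4) (cn := 14) (mu := 1) hb rfl ?_ hj ?_ ?_ ?_ ?_
      balancedOk_ten peakOk_ten ?_ ?_ ?_ ?_ ?_ ?_ ?_ ?_ ?_ ?_ ?_ ?_ ?_ <;>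
    norm_num [unifValue, peakValue, peakOffValue, unifEsym, offEsym, crudeBound, Nat.choose,
      Nat.factorial, abs_le]
  · obtain rfl : j = 8 := by omega
    rw [h3, h4, h5, h6, h7, h8, h9]
    refine suprema_of_checks (n := 8) (k := 5) (cn := 10) (mu := 1) hb rfl ?_ hj ?_ ?_ ?_ ?_
      balancedOk_eleven peakOk_eleven ?_ ?_ ?_ ?_ ?_ ?_ ?_ ?_ ?_ ?_ ?_ ?_ ?_ <;>
    norm_num [unifValue, peakValue, peakOffValue, unifEsym, offEsym, crudeBound, Nat.choose,
      Nat.factorial, abs_le]
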